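/- **Theorem 5 (black-box interactive proof for purity testing).** Purity testing of $n$-qubit states ($d=2^n$, $n\ge 1$) is the many-vs-one distinguishing problem whose instances are all density matrices $\rho$ on $n$ qubits: the only valid answer is "accept" if $\rho=\mathbb 1/d$, the only valid answer is "reject" if $\rho$ is pure, and both answers are valid for every other $\rho$. There is a black-box interactive proof system $(V,P)$ that solves purity testing with success probability $1-\delta$, between an incoherent single-copy verifier $V$ and a coherent multi-copy prover $P$, where $V$ sends qudits to $P$ and $P$ sends classical bits to $V$. Precisely, there are a number of copies $m\ge 1$, an error $\eta<1/2$, verifiers $V=V_{n,\delta}$, circuits $P=P_n$ acting on $m$ stored copies, and constants $C,k$, such that for all $n\ge 1$ and $\delta\in(0,1)$ the following holds. $V$ is a hybrid classical-quantum circuit (fair coins, Boolean gates, classically controlled gates on at most two qubits, resets, measurements) whose only quantum memory is one $n$-qubit register; it may overwrite this register by a fresh copy of $\rho$ (an oracle query), send it to the prover, and receive bits. In the honest interaction the prover collects $m$ received qudits in $m$ registers and, when asked for a bit, runs $P$ on them and sends the answer; it never queries an oracle for $\rho$. * *Completeness:* for every $\rho$, when interacting with the honest prover, $V$ with probability at least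 $1-\delta$ does not abort and outputs a valid answer. * *Soundness:* for every $\rho$ and every (computationally unbounded) quantum prover, with probability less than $\delta$ the verifier does not abort and outputs an invalid answer. * *Black box:* $P$ solves purity testing from $m$ copies with probability at least $1-\eta$, and completeness continues to hold for the same $V$ when $P$ is replaced by any other measurement on $m$ copies that solves purity testing with probability at least $1-\eta$. * *Complexity of $V$:* with $L=1+\log(1/\delta)$, $V$ makes at most $CL$ oracle queries (it uses $\mathcal O(\log(1/\delta))$ copies), and its classical and quantum computation time (the number of parallel layers of elementary operations, plus one step per query or message) is $\tilde{\mathcal O}\big((1+\log n)\,L^2\big)$, that is, $\tilde{\mathcal O}(\log\log(d)\log^2(1/\delta))$. * *Complexity of $P$:* $P$ makes no oracle queries, and its total computation time over the whole interaction is $\tilde{\mathcal O}(L)$, counting as one step each gate on at most two qubits, each controlled exchange of two stored qudits (as in a SWAP test), and each preparation of an auxiliary qubit, measurement and message. * *Communication:* $V$ sends $\tilde{\mathcal O}(L)$ qudits of dimension $d$ to $P$, and $P$ sends at most $CL$ classical bits to $V$. * *Efficiency:* the total numbers of elementary operations on single bits and qubits that $V$ and $P$ perform are at most $C(nL)^k$.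 Here $\tilde{\mathcal O}(x)$ stands for a bound $C\,x\,(1+\log x)^k$, with constants $C,k$ independent of $n$ and $\delta$. -/

import Mathlib

open scoped Matrix Kronecker ComplexOrder

noncomputable section

namespace QIP

/-! ## Quantum states, measurements, gates -/

/-- Computational basis labels of an `n`-qubit register. -/
abbrev Qubits (n : ℕ) : Type := Fin n → Bool

/-- Density matrices: positive semidefinite, of trace one. -/
abbrev State (I : Type) [Fintype I] : Type :=
  {ρ : Matrix I I ℂ // ρ.PosSemidef ∧ ρ.trace = 1}

/-- A state is pure if it is the projection onto a (necessarily unit) vector. -/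
def State.IsPure {I : Type} [Fintype I] (ρ : State I) : Prop :=
  ∃ ψ : I → ℂ, ρ.1 = Matrix.vecMulVec ψ (star ψ)

/-- The state of `m` independent copies, `ρ ⊗ ⋯ ⊗ ρ`. -/
def copies {I : Type} (m : ℕ) (ρ : Matrix I I ℂ) : Matrix (Fin m → I) (Fin m → I) ℂ :=
  fun x y => ∏ j, ρ (x j) (y j)

/-- A quantum instrument with classical outcome in `O`, input system `I` and output system `J`,
given by Kraus operators.  `Instrument Unit I J` is a quantum channel. -/
structure Instrument (O I J : Type) [Fintype O] [Fintype I] [Fintype J] [DecidableEq I] where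
  /-- labels of the Kraus operators belonging to one outcome -/
  ι : Type
  fin : Fintype ι
  op : O → ι → Matrix J I ℂ
  complete : ∑ o, ∑ i, (op o i)ᴴ * op o i = 1

attribute [instance] Instrument.fin

/-- The (unnormalized) state after outcome `o`. -/
def Instrument.apply {O I J : Type} [Fintype O] [Fintype I] [Fintype J] [DecidableEq I]
    (M : Instrument O I J) (o : O) (σ : Matrix I I ℂ) : Matrix J J ℂ :=
  ∑ i, M.op o i * σ * (M.op o i)ᴴ

/-- The unitary `U` on `r` qubits, applied to the wires `f 0, …, f (r-1)` of a system of qubits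
with wires `W`, and the identity on all other wires. -/
def onWires {W : Type} [Fintype W] [DecidableEq W] {r : ℕ} (f : Fin r ↪ W)
    (U : Matrix (Fin r → Bool) (Fin r → Bool) ℂ) : Matrix (W → Bool) (W → Bool) ℂ :=
  fun x y => if ∀ w, (∀ i, f i ≠ w) → x w = y w then U (x ∘ f) (y ∘ f) else 0

/-- The operator `|a⟩⟨b|` on the wire `i`, and the identity on all other wires. -/
def ketBra {W : Type} [Fintype W] [DecidableEq W] (i : W) (a b : Bool) :
    Matrix (W → Bool) (W → Bool) ℂ :=
  fun x y => if x = Function.update y i a ∧ y i = b then 1 else 0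

/-- The state `|0⋯0⟩⟨0⋯0|`. -/
def zeroState (n : ℕ) : Matrix (Qubits n) (Qubits n) ℂ :=
  Matrix.single (fun _ => false) (fun _ => false) 1

/-! ## Many-vs-one distinguishing problems; purity testing -/

/-- A many-vs-one distinguishing problem `(x_A, X_R, X)`. -/
structure ManyVsOne (X : Type) where
  accept : X
  reject : Set X
  accept_notMem : accept ∉ reject

/-- Valid solutions; the answer `true` is "accept", the answer `false` is "reject". Both are valid
on instances that are neither the accept instance nor a reject instance. -/
def ManyVsOne.Valid {X : Type} (p : ManyVsOne X) (x : X) (a : Bool) : Prop :=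
  (x = p.accept → a = true) ∧ (x ∈ p.reject → a = false)

lemma mixed_isState (n : ℕ) :
    (((2 : ℂ) ^ n)⁻¹ • (1 : Matrix (Qubits n) (Qubits n) ℂ)).PosSemidef ∧
      (((2 : ℂ) ^ n)⁻¹ • (1 : Matrix (Qubits n) (Qubits n) ℂ)).trace = 1 := by
  constructor
  · refine Matrix.PosSemidef.one.smul ?_
    have h : (((2 : ℂ) ^ n)⁻¹) = (((2 : ℝ) ^ n)⁻¹ : ℝ) := by push_cast; rfl
    rw [h]
    exact_mod_cast (by positivity : (0 : ℝ) ≤ ((2 : ℝ) ^ n)⁻¹)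
  · simp [Matrix.trace_smul, Matrix.trace_one]

/-- The maximally mixed state `1 / d`, `d = 2 ^ n`. -/
def mixed (n : ℕ) : State (Qubits n) := ⟨((2 : ℂ) ^ n)⁻¹ • 1, mixed_isState n⟩

lemma mixed_not_isPure {n : ℕ} (hn : 0 < n) : ¬ (mixed n).IsPure := by
  rintro ⟨ψ, h⟩
  have e : ∀ x y : Qubits n, (((2 : ℂ) ^ n)⁻¹ • (1 : Matrix (Qubits n) (Qubits n) ℂ)) x y
      = ψ x * star (ψ y) := fun x y => congrFun (congrFun h x) y
  have hne : (fun _ => false : Qubits n) ≠ fun _ => true := fun hc => by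
    simpa using congrFun hc ⟨0, hn⟩
  have h0 := e (fun _ => false) (fun _ => false)
  have h1 := e (fun _ => true) (fun _ => true)
  have h01 := e (fun _ => false) (fun _ => true)
  rw [Matrix.smul_apply, Matrix.one_apply_eq] at h0 h1
  rw [Matrix.smul_apply, Matrix.one_apply_ne hne] at h01
  have a : ψ (fun _ => false) ≠ 0 := fun hz => by simp [hz] at h0
  have b : ψ (fun _ => true) ≠ 0 := fun hz => by simp [hz] at h1
  simp [a, b] at h01

/-- Purity testing of `n`-qubit states: accept the maximally mixed state, reject pure states. -/
def purityTesting (n : ℕ) (hn : 0 < n) : ManyVsOne (State (Qubits n)) where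
  accept := mixed n
  reject := {ρ | ρ.IsPure}
  accept_notMem := mixed_not_isPure hn

/-! ## The verifier: a hybrid classical/quantum machine with a one-copy quantum memory

The verifier has `c` classical bits and one quantum register of `n` qubits, exactly the size of one
copy of the unknown state.  It runs a straight-line program.  Between two instructions it can do
one layer of elementary operations in parallel. -/

/-- Contents of the classical memory. -/
abbrev Mem (c : ℕ) : Type := Fin c → Bool

/-- Elementary operations of the verifier. -/
inductive Op (n c : ℕ) : Type
  /-- write a fair random bit to `k` -/
  | coin (k : Fin c)
  /-- write `f` of the bits `i` and `j` to `k` -/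
  | bool (k i j : Fin c) (f : Bool → Bool → Bool)
  /-- a gate on at most two qubits, applied if the bit `ctl` is set -/
  | gate (ctl : Fin c) (r : ℕ) (hr : r ≤ 2) (f : Fin r ↪ Fin n)
      (U : Matrix.unitaryGroup (Fin r → Bool) ℂ)
  /-- reset the qubit `i` to `|0⟩` if the bit `ctl` is set -/
  | reset (ctl : Fin c) (i : Fin n)
  /-- measure the qubit `i` in the computational basis, write the outcome to `k` -/
  | measure (i : Fin n) (k : Fin c)

/-- The qubits an operation acts on. -/
def Op.qubits {n c : ℕ} : Op n c → Finset (Fin n)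
  | .coin _ => ∅
  | .bool _ _ _ _ => ∅
  | .gate _ _ _ f _ => Finset.univ.map f
  | .reset _ i => {i}
  | .measure i _ => {i}

/-- The classical bits an operation reads. -/
def Op.reads {n c : ℕ} : Op n c → Finset (Fin c)
  | .coin _ => ∅
  | .bool _ i j _ => {i, j}
  | .gate ctl _ _ _ _ => {ctl}
  | .reset ctl _ => {ctl}
  | .measure _ _ => ∅

/-- The classical bits an operation writes. -/
def Op.writes {n c : ℕ} : Op n c → Finset (Fin c)
  | .coin k => {k}
  | .bool k _ _ _ => {k}
  | .gate _ _ _ _ _ => ∅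
  | .reset _ _ => ∅
  | .measure _ k => {k}

/-- Two operations can be performed in parallel: they act on different qubits, and neither of them
writes to a classical bit that the other one uses. -/
def Op.Parallel {n c : ℕ} (a b : Op n c) : Prop :=
  Disjoint a.qubits b.qubits ∧ Disjoint a.writes b.writes ∧
    Disjoint a.writes b.reads ∧ Disjoint a.reads b.writes

/-- The possible results of an operation on the classical memory `μ`: the new memory, and the
Kraus operator on the quantum register. -/
def Op.branches {n c : ℕ} (μ : Mem c) :
    Op n c → List (Mem c × Matrix (Qubits n) (Qubits n) ℂ)
  | .coin k =>
      [(Function.update μ k false, ((Real.sqrt 2)⁻¹ : ℂ) • 1),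
       (Function.update μ k true, ((Real.sqrt 2)⁻¹ : ℂ) • 1)]
  | .bool k i j f => [(Function.update μ k (f (μ i) (μ j)), 1)]
  | .gate ctl _ _ f U => [(μ, if μ ctl then onWires f U.1 else 1)]
  | .reset ctl i =>
      if μ ctl then [(μ, ketBra i false false), (μ, ketBra i false true)] else [(μ, 1)]
  | .measure i k =>
      [(Function.update μ k false, ketBra i false false),
       (Function.update μ k true, ketBra i true true)]

/-- Instructions of the verifier. -/
inductive Instr (n c : ℕ) : Type
  /-- one layer of elementary operations -/
  | layer (ops : List (Op n c))
  /-- query the copy oracle: the register is overwritten by a fresh copy of the unknown state -/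
  | query
  /-- send the register (one qudit of dimension `2 ^ n`) to the prover; afterwards it is `|0⋯0⟩` -/
  | send
  /-- receive one classical bit from the prover and write it to `k` -/
  | recv (k : Fin c)

/-- An incoherent single-copy verifier.  No quantum information other than the content of a single
`n`-qubit register is ever stored, and a query overwrites this register. -/
structure Verifier (n : ℕ) where
  /-- number of classical bits, all initially `false` -/
  c : ℕ
  program : List (Instr n c)
  parallel : ∀ l, Instr.layer l ∈ program → l.Pairwise Op.Parallel
  /-- the verifier aborts if this bit is set at the end -/
  abortBit : Fin c
  /-- otherwise it outputs the answer in this bit -/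
  answerBit : Fin c

/-- The output: `none` is "abort". -/
def Verifier.output {n : ℕ} (V : Verifier n) (μ : Mem V.c) : Option Bool :=
  if μ V.abortBit then none else some (μ V.answerBit)

/-- Number of oracle queries. -/
def Verifier.queries {n : ℕ} (V : Verifier n) : ℕ :=
  V.program.countP fun | .query => true | _ => false

/-- Number of qudits sent to the prover. -/
def Verifier.sends {n : ℕ} (V : Verifier n) : ℕ :=
  V.program.countP fun | .send => true | _ => false

/-- Number of classical bits received from the prover. -/
def Verifier.recvs {n : ℕ} (V : Verifier n) : ℕ :=
  V.program.countP fun | .recv _ => true | _ => false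

/-- Computation time: each layer of classical and quantum operations, each query and each message
takes one time step. -/
def Verifier.time {n : ℕ} (V : Verifier n) : ℕ := V.program.length

/-- Total number of elementary operations, queries and messages. -/
def Verifier.size {n : ℕ} (V : Verifier n) : ℕ :=
  (V.program.map fun | .layer l => l.length | _ => 1).sum

/-! ## Provers and the interaction -/

/-- An arbitrary (computationally unbounded) quantum prover with a finite-dimensional memory `K`:
it absorbs the qudits sent by the verifier into its memory, and it produces its classical bits by
quantum instruments on its memory.  The operations may depend on the position in the protocol. -/
structure Prover (n : ℕ) where
  K : Type
  fin : Fintype K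
  dec : DecidableEq K
  start : State K
  absorb : ℕ → Instrument Unit (Qubits n × K) K
  answer : ℕ → Instrument Bool K K

attribute [instance] Prover.fin Prover.dec

/-- The joint state of an interaction: for each content of the verifier's classical memory an
unnormalized state of the verifier's register and the prover's memory; its trace is the
probability of that content. -/
abbrev Joint (n c : ℕ) (K : Type) : Type := Mem c → Matrix (Qubits n × K) (Qubits n × K) ℂ

/-- Trace out the verifier's register. -/
def traceReg {n : ℕ} {K : Type} (σ : Matrix (Qubits n × K) (Qubits n × K) ℂ) : Matrix K K ℂ :=
  fun k l => ∑ q, σ (q, k) (q, l)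

/-- Effect of an elementary operation of the verifier. -/
def Op.run {n c : ℕ} {K : Type} [Fintype K] [DecidableEq K] (op : Op n c) (Ψ : Joint n c K) :
    Joint n c K :=
  fun ν => ∑ μ, ((op.branches μ).map fun b =>
    if b.1 = ν then (b.2 ⊗ₖ (1 : Matrix K K ℂ)) * Ψ μ * (b.2 ⊗ₖ (1 : Matrix K K ℂ))ᴴ else 0).sum

/-- Effect of receiving a bit that is produced by the instrument `M` on the prover's memory. -/
def recvBit {n c : ℕ} {K : Type} [Fintype K] [DecidableEq K] (M : Instrument Bool K K)
    (k : Fin c) (Ψ : Joint n c K) : Joint n c K :=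
  fun ν => ∑ μ, ∑ b : Bool, if Function.update μ k b = ν then
    ∑ i, ((1 : Matrix (Qubits n) (Qubits n) ℂ) ⊗ₖ M.op b i) * Ψ μ *
      ((1 : Matrix (Qubits n) (Qubits n) ℂ) ⊗ₖ M.op b i)ᴴ else 0

/-- Run a program on the unknown state `ρ` with the prover `P`, where `s` qudits have been sent and
`r` bits have been received so far. -/
def runProgram {n c : ℕ} (ρ : State (Qubits n)) (P : Prover n) :
    List (Instr n c) → ℕ → ℕ → Joint n c P.K → Joint n c P.K
  | [], _, _, Ψ => Ψ
  | .layer l :: p, s, r, Ψ => runProgram ρ P p s r (l.foldl (fun Φ op => op.run Φ) Ψ)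
  | .query :: p, s, r, Ψ => runProgram ρ P p s r fun μ => ρ.1 ⊗ₖ traceReg (Ψ μ)
  | .send :: p, s, r, Ψ =>
      runProgram ρ P p (s + 1) r fun μ => zeroState n ⊗ₖ (P.absorb s).apply () (Ψ μ)
  | .recv k :: p, s, r, Ψ => runProgram ρ P p s (r + 1) (recvBit (P.answer r) k Ψ)

/-- The joint state at the end of the interaction. -/
def finalState {n : ℕ} (V : Verifier n) (P : Prover n) (ρ : State (Qubits n)) :
    Joint n V.c P.K :=
  runProgram ρ P V.program 0 0 fun μ =>
    if μ = fun _ => false then zeroState n ⊗ₖ P.start.1 else 0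

open Classical in
/-- The probability that the output of the verifier (`none` for "abort") lies in `S`, when the
verifier's oracle provides copies of `ρ` and it interacts with `P`. -/
def outputProb {n : ℕ} (V : Verifier n) (P : Prover n) (ρ : State (Qubits n))
    (S : Set (Option Bool)) : ℝ :=
  ∑ μ, if V.output μ ∈ S then (finalState V P ρ μ).trace.re else 0

/-- Completeness: on every instance, with probability at least `1 - δ`, the verifier does not abort
and outputs a valid solution. -/
def Complete {n : ℕ} (p : ManyVsOne (State (Qubits n))) (δ : ℝ) (V : Verifier n) (P : Prover n) :
    Prop :=
  ∀ ρ, 1 - δ ≤ outputProb V P ρ {o | ∃ a, o = some a ∧ p.Valid ρ a}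

/-- Soundness: on every instance and for every prover, with probability less than `δ`, the verifier
does not abort and outputs an invalid solution. -/
def Sound {n : ℕ} (p : ManyVsOne (State (Qubits n))) (δ : ℝ) (V : Verifier n) : Prop :=
  ∀ (ρ : State (Qubits n)) (P : Prover n),
    outputProb V P ρ {o | ∃ a, o = some a ∧ ¬ p.Valid ρ a} < δ

/-- `(V, P)` is an interactive proof system with success probability `1 - δ`, where the prover has
no oracle access. -/
def IsInteractiveProof {n : ℕ} (p : ManyVsOne (State (Qubits n))) (δ : ℝ) (V : Verifier n)
    (P : Prover n) : Prop :=
  Complete p δ V P ∧ Sound p δ V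

/-! ## Multi-copy solvers, and provers that use them as a subroutine -/

/-- A coherent algorithm on `m` copies with output in `Bool`: any quantum instrument on `m`
registers. -/
abbrev Solver (m n : ℕ) : Type 1 := Instrument Bool (Fin m → Qubits n) (Fin m → Qubits n)

open Classical in
/-- The solver outputs a valid solution with probability at least `1 - η`, given `m` copies of any
instance. -/
def Solver.Solves {m n : ℕ} (A : Solver m n) (p : ManyVsOne (State (Qubits n))) (η : ℝ) : Prop :=
  ∀ ρ, 1 - η ≤ ∑ a : Bool, if p.Valid ρ a then (A.apply a (copies m ρ.1)).trace.re else 0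

lemma overwrite_complete {J Q : Type} [Fintype J] [DecidableEq J] [Fintype Q] [DecidableEq Q]
    (j : J) :
    ∑ _o : Unit, ∑ y : Q,
      (Matrix.of fun (x : J → Q) (z : Q × (J → Q)) =>
        if x = Function.update z.2 j z.1 ∧ z.2 j = y then (1 : ℂ) else 0)ᴴ *
      (Matrix.of fun (x : J → Q) (z : Q × (J → Q)) =>
        if x = Function.update z.2 j z.1 ∧ z.2 j = y then (1 : ℂ) else 0) = 1 := by
  ext ⟨q, z⟩ ⟨q', z'⟩
  simp only [Finset.univ_unique, Finset.sum_const, Finset.card_singleton, one_smul]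
  rw [Matrix.sum_apply]
  simp only [Matrix.mul_apply, Matrix.conjTranspose_apply, Matrix.of_apply]
  rw [Matrix.one_apply]
  have hs : ∀ y : Q, (∑ x : J → Q,
      star (if x = Function.update z j q ∧ z j = y then (1 : ℂ) else 0) *
        (if x = Function.update z' j q' ∧ z' j = y then (1 : ℂ) else 0)) =
      if z j = y then (if Function.update z j q = Function.update z' j q' ∧ z' j = y
        then 1 else 0) else 0 := by
    intro y
    rw [Finset.sum_eq_single (Function.update z j q)]
    · by_cases h : z j = y <;> simp [h]
    · intro x _ hx; simp [hx]
    · simp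
  simp only [hs]
  rw [Finset.sum_ite_eq]
  simp only [Finset.mem_univ, if_true]
  congr 1
  apply propext
  constructor
  · rintro ⟨h1, h2⟩
    have hq : q = q' := by simpa using congrFun h1 j
    have hz : z = z' := by
      funext i
      by_cases hi : i = j
      · rw [hi, h2]
      · simpa [hi] using congrFun h1 i
    rw [hq, hz]
  · intro h
    rw [Prod.mk.injEq] at h
    obtain ⟨rfl, rfl⟩ := h
    exact ⟨rfl, rfl⟩

/-- Store an incoming register in slot `j` of a memory of registers, discarding the old content. -/
def overwrite {J Q : Type} [Fintype J] [DecidableEq J] [Fintype Q] [DecidableEq Q] (j : J) :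
    Instrument Unit (Q × (J → Q)) (J → Q) where
  ι := Q
  fin := inferInstance
  op _ y := Matrix.of fun x z => if x = Function.update z.2 j z.1 ∧ z.2 j = y then 1 else 0
  complete := overwrite_complete j

lemma zeros_isState {I : Type} [Fintype I] [DecidableEq I] (i : I) :
    (Matrix.single i i (1 : ℂ)).PosSemidef ∧ (Matrix.single i i (1 : ℂ)).trace = 1 := by
  constructor
  · have h : Matrix.single i i (1 : ℂ) = Matrix.vecMulVec (Pi.single i 1) (star (Pi.single i 1)) := by
      ext a b
      simp only [Matrix.single_apply, Matrix.vecMulVec_apply, Pi.star_apply, Pi.single_apply]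
      by_cases ha : i = a <;> by_cases hb : i = b <;> simp [ha, hb, eq_comm]
    rw [h]
    exact Matrix.posSemidef_vecMulVec_self_star _
  · simp

/-- The honest prover that uses the `m`-copy solver `A` as a subroutine: it stores the incoming
qudits in `m` registers, one after the other, and whenever it has to send a bit, it runs `A` on
these registers and sends the answer.  It has no access to the unknown state of its own. -/
def Solver.prover {m n : ℕ} (hm : 0 < m) (A : Solver m n) : Prover n where
  K := Fin m → Qubits n
  fin := inferInstance
  dec := inferInstance
  start := ⟨Matrix.single (fun _ _ => false) (fun _ _ => false) 1, zeros_isState _⟩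
  absorb s := overwrite ⟨s % m, Nat.mod_lt s hm⟩
  answer _ := A

/-- `V` is the verifier of a black-box interactive proof: all it relies on is that the honest prover
can solve the problem from `m` copies with probability at least `1 - η`, by whatever algorithm. -/
def IsBlackBox {m n : ℕ} (hm : 0 < m) (η : ℝ) (p : ManyVsOne (State (Qubits n))) (δ : ℝ)
    (V : Verifier n) : Prop :=
  ∀ A : Solver m n, A.Solves p η → IsInteractiveProof p δ V (A.prover hm)

/-! ## Circuits of the honest prover -/

/-- The wires of a circuit with `a + 1` auxiliary qubits and `m` registers of `n` qubits. -/
abbrev Wires (a m n : ℕ) : Type := Fin (a + 1) ⊕ (Fin m × Fin n)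

/-- Exchange the registers `i` and `j`, if the auxiliary qubit `q` is in state `1`. -/
def ctrlSwap {a m n : ℕ} (q : Fin (a + 1)) (i j : Fin m) (x : Wires a m n → Bool) :
    Wires a m n → Bool
  | .inl t => x (.inl t)
  | .inr (k, l) => if x (.inl q) then x (.inr (Equiv.swap i j k, l)) else x (.inr (k, l))

/-- Elementary operations of the honest prover: gates on at most two qubits, and the controlled
exchange of two stored qudits, the basic step of the SWAP test. -/
inductive Gate (a m n : ℕ) : Type
  | gate (r : ℕ) (hr : r ≤ 2) (f : Fin r ↪ Wires a m n)
      (U : Matrix.unitaryGroup (Fin r → Bool) ℂ)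
  | ctrlSwap (q : Fin (a + 1)) (i j : Fin m)

/-- The unitary of an elementary operation. -/
def Gate.matrix {a m n : ℕ} : Gate a m n → Matrix (Wires a m n → Bool) (Wires a m n → Bool) ℂ
  | .gate _ _ f U => onWires f U.1
  | .ctrlSwap q i j => fun x y => if x = QIP.ctrlSwap q i j y then 1 else 0

/-- The number of operations on individual qubits that make up an elementary operation: the
controlled exchange of two `n`-qubit registers consists of `n` controlled exchanges of two qubits. -/
def Gate.weight {a m n : ℕ} : Gate a m n → ℕ
  | .gate _ _ _ _ => 1
  | .ctrlSwap _ _ _ => n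

/-- A quantum circuit on `m` stored copies.  The auxiliary qubits start in `|0⟩`, and the answer
is obtained by measuring the first of them at the end. -/
structure Circuit (m n : ℕ) where
  a : ℕ
  gates : List (Gate a m n)

/-- The unitary of a circuit (the first gate of the list is applied first). -/
def Circuit.matrix {m n : ℕ} (P : Circuit m n) :
    Matrix (Wires P.a m n → Bool) (Wires P.a m n → Bool) ℂ :=
  P.gates.foldl (fun M g => g.matrix * M) 1

lemma onWires_unitary {W : Type} [Fintype W] [DecidableEq W] {r : ℕ} (f : Fin r ↪ W)
    (U : Matrix (Fin r → Bool) (Fin r → Bool) ℂ) (hU : Uᴴ * U = 1) :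
    (onWires f U)ᴴ * onWires f U = 1 := by
  ext x y
  rw [Matrix.mul_apply, Matrix.one_apply]
  have key : ∀ g : Fin r → Bool, ∀ w, (∀ i, f i ≠ w) → Function.extend f g x w = x w := by
    intro g w hw
    exact Function.extend_apply' _ _ _ (by rintro ⟨i, hi⟩; exact hw i hi)
  have comp : ∀ g : Fin r → Bool, Function.extend f g x ∘ f = g := fun g =>
    funext fun i => f.injective.extend_apply g x i
  have step : (∑ z, (onWires f U)ᴴ x z * onWires f U z y) =
      ∑ g : Fin r → Bool, star (U g (x ∘ f)) *
        (if ∀ w, (∀ i, f i ≠ w) → x w = y w then U g (y ∘ f) else 0) := by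
    symm
    refine Finset.sum_of_injOn (fun g => Function.extend f g x) ?_ ?_ ?_ ?_
    · intro g _ g' _ h
      have h' : Function.extend f g x = Function.extend f g' x := h
      rw [← comp g, ← comp g', h']
    · intro g _; simp
    · intro z _ hz
      have : ¬ ∀ w, (∀ i, f i ≠ w) → z w = x w := by
        intro hzx
        refine hz ⟨z ∘ f, by simp, ?_⟩
        funext w
        by_cases hw : ∃ i, f i = w
        · obtain ⟨i, rfl⟩ := hw
          exact f.injective.extend_apply _ _ _
        · have hw' : ∀ i, f i ≠ w := fun i hi => hw ⟨i, hi⟩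
          exact (key _ w hw').trans (hzx w hw').symm
      simp [onWires, Matrix.conjTranspose_apply, this]
    · intro g _
      simp only [onWires, Matrix.conjTranspose_apply, comp]
      rw [if_pos (key g)]
      congr 1
      refine if_congr ?_ rfl rfl
      exact forall₂_congr fun w hw => by rw [key g w hw]
  rw [step]
  by_cases h : ∀ w, (∀ i, f i ≠ w) → x w = y w
  · simp only [if_pos h]
    have e := congrFun (congrFun hU (x ∘ f)) (y ∘ f)
    rw [Matrix.mul_apply, Matrix.one_apply] at e
    simp only [Matrix.conjTranspose_apply] at e
    rw [e]
    refine if_congr ?_ rfl rfl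
    constructor
    · intro hxy
      funext w
      by_cases hw : ∃ i, f i = w
      · obtain ⟨i, rfl⟩ := hw
        exact congrFun hxy i
      · exact h w fun i hi => hw ⟨i, hi⟩
    · rintro rfl; rfl
  · have : x ≠ y := by rintro rfl; exact h fun _ _ => rfl
    simp [h, this]

lemma ctrlSwap_ctrlSwap {a m n : ℕ} (q : Fin (a + 1)) (i j : Fin m) (x : Wires a m n → Bool) :
    ctrlSwap q i j (ctrlSwap q i j x) = x := by
  funext w
  rcases w with t | ⟨k, l⟩
  · rfl
  · by_cases h : x (.inl q) = true <;> simp [ctrlSwap, h]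

lemma Gate.unitary {a m n : ℕ} (g : Gate a m n) : g.matrixᴴ * g.matrix = 1 := by
  cases g with
  | gate r hr f U => exact onWires_unitary f U.1 (Matrix.mem_unitaryGroup_iff'.1 U.2)
  | ctrlSwap q i j =>
    ext x y
    have hinj : QIP.ctrlSwap q i j x = QIP.ctrlSwap q i j y ↔ x = y :=
      ⟨fun h => by rw [← ctrlSwap_ctrlSwap q i j x, h, ctrlSwap_ctrlSwap], fun h => by rw [h]⟩
    rw [Matrix.mul_apply, Matrix.one_apply,
      Finset.sum_eq_single (QIP.ctrlSwap q i j x)]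
    · rw [Matrix.conjTranspose_apply]
      simp only [Gate.matrix]
      simp [hinj]
    · intro z _ hz
      rw [Matrix.conjTranspose_apply]
      simp only [Gate.matrix]
      simp [hz]
    · simp

lemma Circuit.unitary {m n : ℕ} (P : Circuit m n) : P.matrixᴴ * P.matrix = 1 := by
  have : ∀ (l : List (Gate P.a m n)) (M : Matrix (Wires P.a m n → Bool) (Wires P.a m n → Bool) ℂ),
      Mᴴ * M = 1 → (l.foldl (fun M g => g.matrix * M) M)ᴴ *
        l.foldl (fun M g => g.matrix * M) M = 1 := by
    intro l
    induction l with
    | nil => intro M h; exact h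
    | cons g l ih =>
      intro M h
      refine ih _ ?_
      rw [Matrix.conjTranspose_mul, Matrix.mul_assoc, ← Matrix.mul_assoc _ g.matrix M, g.unitary,
        Matrix.one_mul, h]
  exact this _ _ (by simp)

/-- Join a basis label of the auxiliary qubits and one of the registers. -/
def join {a m n : ℕ} (u : Fin (a + 1) → Bool) (x : Fin m → Qubits n) : Wires a m n → Bool :=
  Sum.elim u fun w => x w.1 w.2

lemma join_bij (a m n : ℕ) :
    Function.Bijective fun w : (Fin (a + 1) → Bool) × (Fin m → Qubits n) => join w.1 w.2 := by
  constructor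
  · rintro ⟨u, x⟩ ⟨v, y⟩ h
    refine Prod.ext ?_ ?_
    · funext t; exact congrFun h (.inl t)
    · funext k l; exact congrFun h (.inr (k, l))
  · intro z
    refine ⟨(fun t => z (.inl t), fun k l => z (.inr (k, l))), ?_⟩
    funext w
    rcases w with t | ⟨k, l⟩ <;> rfl

lemma Circuit.complete {m n : ℕ} (P : Circuit m n) :
    ∑ b : Bool, ∑ u : Fin (P.a + 1) → Bool,
      (Matrix.of fun x y => if u 0 = b then P.matrix (join u x) (join (fun _ => false) y) else 0 :
        Matrix (Fin m → Qubits n) (Fin m → Qubits n) ℂ)ᴴ *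
      (Matrix.of fun x y => if u 0 = b then P.matrix (join u x) (join (fun _ => false) y) else 0 :
        Matrix (Fin m → Qubits n) (Fin m → Qubits n) ℂ) = 1 := by
  rw [Finset.sum_comm]
  ext y y'
  have e := congrFun (congrFun P.unitary (join (fun _ => false) y)) (join (fun _ => false) y')
  rw [Matrix.mul_apply, ← (join_bij P.a m n).sum_comp, Fintype.sum_prod_type] at e
  have h1 : (1 : Matrix (Wires P.a m n → Bool) (Wires P.a m n → Bool) ℂ)
      (join (fun _ => false) y) (join (fun _ => false) y') =
      (1 : Matrix (Fin m → Qubits n) (Fin m → Qubits n) ℂ) y y' := by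
    rw [Matrix.one_apply, Matrix.one_apply]
    refine if_congr ⟨fun h => ?_, fun h => by rw [h]⟩ rfl rfl
    funext k l; exact congrFun h (.inr (k, l))
  rw [← h1, ← e, Matrix.sum_apply]
  refine Finset.sum_congr rfl fun u _ => ?_
  rw [Matrix.sum_apply, Finset.sum_eq_single (u 0)]
  · simp [Matrix.mul_apply, Matrix.conjTranspose_apply]
  · intro b _ hb
    simp [Matrix.mul_apply, hb.symm]
  · simp

/-- The algorithm on `m` copies that a circuit computes. -/
def Circuit.solver {m n : ℕ} (P : Circuit m n) : Solver m n where
  ι := Fin (P.a + 1) → Bool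
  fin := inferInstance
  op b u := Matrix.of fun x y =>
    if u 0 = b then P.matrix (join u x) (join (fun _ => false) y) else 0
  complete := P.complete

/-- Computation time of the honest prover that runs the circuit `P` with the verifier `V`: one step
for each message, and in each run of `P` one step for each preparation of an auxiliary qubit, each
elementary operation and the measurement. -/
def proverTime {m n : ℕ} (V : Verifier n) (P : Circuit m n) : ℕ :=
  V.sends + V.recvs * ((P.a + 1) + P.gates.length + 1 + 1)

/-- The same, with the controlled exchange of registers counted qubit by qubit. -/
def proverSize {m n : ℕ} (V : Verifier n) (P : Circuit m n) : ℕ :=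
  n * V.sends + V.recvs * ((P.a + 1) + (P.gates.map Gate.weight).sum + 1 + 1)

/-! ## Asymptotics -/

/-- `log (1 / δ)`, with `1` added so that it is bounded away from zero as `δ → 1`. -/
def logInv (δ : ℝ) : ℝ := 1 + Real.log (1 / δ)

/-- The bound `C x (log x) ^ k` that is abbreviated as `Õ(x)`, for `x ≥ 1`. -/
def softO (C : ℝ) (k : ℕ) (x : ℝ) : ℝ := C * x * (1 + Real.log x) ^ k

end QIP

end

/-!
The verifier plays a distinguishing game with the prover, many times, in two variants. In a round of
the first test it sends, with probability one half each, two copies of `U ρ Uᴴ` or two copies of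
`U |0⋯0⟩⟨0⋯0| Uᴴ`, for a random unitary `U`; in a round of the second test the alternative is a pair
of independent random basis states under `U`, which is a pair of maximally mixed states. The prover
has to say which one it received. If `ρ` is pure, the first game cannot be won with an advantage,
since `U` hides which pure state it was applied to; if `ρ` is maximally mixed, the second one cannot,
since the two alternatives coincide. Conversely, from the solution of purity testing on two copies
(accept means "maximally mixed") an honest prover obtains an advantage in the first game if `ρ` is
maximally mixed and in the second one if `ρ` is pure. For any other `ρ` the sum of its winning
probabilities is at least `3 / 2 - η`, because the answers on `ρ` enter the two games with opposite
signs (`le_winRate_add`); so it wins one of the games, and both answers are valid. The verifier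
accepts if the number of wins in the first test reaches a threshold between the two winning
probabilities, rejects if only the number of wins in the second test does, and aborts otherwise. The
numbers of wins are controlled by exponential potentials (`potential_reached_le` and
`potential_missed_le`), which also covers provers that correlate their rounds.

The unitary `U` has to be applied in depth `O(log n)`. Only its action on two copies of a pure state
matters. Random Pauli operators turn such a state into a mixture of `n`-fold tensor products of Bell
states, labelled by pairs `(w, r)` of bit strings, and only the symmetric ones with `r · w = 0` occur
(`bellWeight_eq_zero`). Clifford gates permute the labels (`Cliff.conjPair_bellProj`). A random
diagonal unitary, made of phase gates and controlled phase flips of range `K = O(log n)`, makes `r`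
uniform on the orthogonal complement of `w` as soon as `w` has no gap of length `K`
(`labelAvg_diagKinds`), and a layer of Hadamard gates exchanges `w` and `r`. So the circuit follows
the walk that moves from `w` to a random string orthogonal to `w`, up to the small probability of a
long gap. Two steps of this walk halve the oscillation of every function of the label
(`exists_Icc_perpAvg_perpAvg`), so a constant number of layers of this type is enough.

The honest prover performs a SWAP test whose auxiliary qubit is prepared and measured in tilted
bases, such that purity one and purity `1 / d ≤ 1 / 2` lie on the two sides of `1 / 2` with constant
margins (`honestCircuit_solves`). The interaction is analysed in the Heisenberg picture: an
observable on the final joint state is pulled back through the program (`pairing_runProgram`), which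
reduces a round to the winning probability of the game (`pairing_round`).
-/

noncomputable section

set_option linter.unusedSectionVars false

namespace QIP

/-! ### The interaction in the Heisenberg picture -/

lemma trace_mul_conj {I J : Type} [Fintype I] [Fintype J] (E : Matrix J J ℂ) (A : Matrix J I ℂ)
    (σ : Matrix I I ℂ) : (E * (A * σ * Aᴴ)).trace = (Aᴴ * E * A * σ).trace := by
  rw [← Matrix.mul_assoc, Matrix.trace_mul_comm, ← Matrix.mul_assoc, ← Matrix.mul_assoc]

section Heisenberg

variable {n c : ℕ} {K : Type} [Fintype K] [DecidableEq K]

/-- The expectation of an observable `E` of the classical memory, the register and the prover's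
memory in the joint state `Ψ`. -/
def pairing (E Ψ : Joint n c K) : ℂ := ∑ μ, (E μ * Ψ μ).trace

/-- The observable before an elementary operation that corresponds to `E` after it. -/
def Op.dual (op : Op n c) (E : Joint n c K) : Joint n c K := fun μ =>
  ((op.branches μ).map fun b =>
    (b.2 ⊗ₖ (1 : Matrix K K ℂ))ᴴ * E b.1 * (b.2 ⊗ₖ (1 : Matrix K K ℂ))).sum

lemma sum_trace_branches (E : Joint n c K)
    (L : List (Mem c × Matrix (Qubits n) (Qubits n) ℂ)) (σ : Matrix (Qubits n × K) (Qubits n × K) ℂ) :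
    ∑ ν, (E ν * (L.map fun b => if b.1 = ν then
        (b.2 ⊗ₖ (1 : Matrix K K ℂ)) * σ * (b.2 ⊗ₖ (1 : Matrix K K ℂ))ᴴ else 0).sum).trace =
      ((L.map fun b =>
        (b.2 ⊗ₖ (1 : Matrix K K ℂ))ᴴ * E b.1 * (b.2 ⊗ₖ (1 : Matrix K K ℂ))).sum * σ).trace := by
  induction L with
  | nil => simp
  | cons b L ih =>
    simp only [List.map_cons, List.sum_cons, Matrix.mul_add, Matrix.add_mul, Matrix.trace_add,
      Finset.sum_add_distrib]
    rw [ih, add_left_inj, Finset.sum_eq_single b.1]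
    · rw [if_pos rfl, trace_mul_conj]
    · intro ν _ h
      rw [if_neg h.symm, Matrix.mul_zero, Matrix.trace_zero]
    · intro h
      exact absurd (Finset.mem_univ _) h

lemma pairing_run (op : Op n c) (E Ψ : Joint n c K) :
    pairing E (op.run Ψ) = pairing (op.dual E) Ψ := by
  unfold pairing
  simp only [Op.run, Op.dual, Matrix.mul_sum, Matrix.trace_sum]
  rw [Finset.sum_comm]
  exact Finset.sum_congr rfl fun μ _ => sum_trace_branches E _ _

lemma pairing_foldl_run (l : List (Op n c)) (E Ψ : Joint n c K) :
    pairing E (l.foldl (fun Φ op => op.run Φ) Ψ) = pairing (l.foldr Op.dual E) Ψ := by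
  induction l generalizing Ψ with
  | nil => rfl
  | cons op l ih => rw [List.foldl_cons, ih, pairing_run, List.foldr_cons]

/-- The expectation of `E` over the register in the state `σ`; an observable of the remaining
system. -/
def slice (σ : Matrix (Qubits n) (Qubits n) ℂ) (E : Matrix (Qubits n × K) (Qubits n × K) ℂ) :
    Matrix K K ℂ := fun k l => ∑ q, ∑ q', σ q' q * E (q, k) (q', l)

lemma trace_mul_kronecker (E : Matrix (Qubits n × K) (Qubits n × K) ℂ)
    (σ : Matrix (Qubits n) (Qubits n) ℂ) (κ : Matrix K K ℂ) :
    (E * (σ ⊗ₖ κ)).trace = (slice σ E * κ).trace := by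
  simp only [Matrix.trace, Matrix.diag, Matrix.mul_apply, Fintype.sum_prod_type, slice,
    Matrix.kroneckerMap_apply, Finset.sum_mul]
  rw [Finset.sum_comm]
  refine Finset.sum_congr rfl fun k _ => ?_
  rw [Finset.sum_congr rfl fun q _ => Finset.sum_comm]
  rw [Finset.sum_comm]
  refine Finset.sum_congr rfl fun l _ => Finset.sum_congr rfl fun q _ =>
    Finset.sum_congr rfl fun q' _ => by ring

lemma trace_one_kronecker_mul (X : Matrix K K ℂ) (σ : Matrix (Qubits n × K) (Qubits n × K) ℂ) :
    (((1 : Matrix (Qubits n) (Qubits n) ℂ) ⊗ₖ X) * σ).trace = (X * traceReg σ).trace := by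
  simp only [Matrix.trace, Matrix.diag, Matrix.mul_apply, Fintype.sum_prod_type, traceReg,
    Matrix.kroneckerMap_apply, Finset.mul_sum, Matrix.one_apply, ite_mul, one_mul, zero_mul]
  rw [Finset.sum_comm]
  refine Finset.sum_congr rfl fun k _ => ?_
  rw [Finset.sum_comm]
  rw [Finset.sum_congr rfl fun l _ => Finset.sum_comm]
  simp only [Finset.sum_ite_eq', Finset.mem_univ, if_true]
  exact Finset.sum_comm

/-- The observable before an instrument with outcome `o` that corresponds to `E` after it. -/
def Instrument.dual {O I J : Type} [Fintype O] [Fintype I] [Fintype J] [DecidableEq I]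
    (M : Instrument O I J) (o : O) (E : Matrix J J ℂ) : Matrix I I ℂ :=
  ∑ i, (M.op o i)ᴴ * E * M.op o i

lemma trace_mul_apply {O I J : Type} [Fintype O] [Fintype I] [Fintype J] [DecidableEq I]
    (M : Instrument O I J) (o : O) (E : Matrix J J ℂ) (σ : Matrix I I ℂ) :
    (E * M.apply o σ).trace = (M.dual o E * σ).trace := by
  simp only [Instrument.apply, Instrument.dual, Matrix.mul_sum, Matrix.sum_mul, Matrix.trace_sum]
  exact Finset.sum_congr rfl fun i _ => trace_mul_conj _ _ _

/-- The observable before receiving a bit that corresponds to `E` after it. -/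
def recvDual (M : Instrument Bool K K) (k : Fin c) (E : Joint n c K) : Joint n c K := fun μ =>
  ∑ b : Bool, ∑ i, ((1 : Matrix (Qubits n) (Qubits n) ℂ) ⊗ₖ M.op b i)ᴴ *
    E (Function.update μ k b) * ((1 : Matrix (Qubits n) (Qubits n) ℂ) ⊗ₖ M.op b i)

lemma pairing_recvBit (M : Instrument Bool K K) (k : Fin c) (E Ψ : Joint n c K) :
    pairing E (recvBit M k Ψ) = pairing (recvDual M k E) Ψ := by
  unfold pairing
  simp only [recvBit, recvDual, Matrix.mul_sum, Matrix.trace_sum, Matrix.sum_mul]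
  rw [Finset.sum_comm]
  refine Finset.sum_congr rfl fun μ _ => ?_
  rw [Finset.sum_comm]
  refine Finset.sum_congr rfl fun b _ => ?_
  rw [Finset.sum_eq_single (Function.update μ k b)]
  · rw [if_pos rfl, Matrix.mul_sum, Matrix.trace_sum]
    exact Finset.sum_congr rfl fun i _ => trace_mul_conj _ _ _
  · intro ν _ h
    simp [h.symm]
  · simp

/-- The observable at the start of a program that corresponds to `E` at its end, for an interaction
with the prover `P` in which `s` qudits have been sent and `r` bits have been received before. -/
def programDual (ρ : State (Qubits n)) (P : Prover n) :
    List (Instr n c) → ℕ → ℕ → Joint n c P.K → Joint n c P.K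
  | [], _, _, E => E
  | .layer l :: p, s, r, E => l.foldr Op.dual (programDual ρ P p s r E)
  | .query :: p, s, r, E => fun μ =>
      (1 : Matrix (Qubits n) (Qubits n) ℂ) ⊗ₖ slice ρ.1 (programDual ρ P p s r E μ)
  | .send :: p, s, r, E => fun μ =>
      (P.absorb s).dual () (slice (zeroState n) (programDual ρ P p (s + 1) r E μ))
  | .recv k :: p, s, r, E => recvDual (P.answer r) k (programDual ρ P p s (r + 1) E)

/-- The duality between the Schrödinger and the Heisenberg picture of an interaction. -/
lemma pairing_runProgram (ρ : State (Qubits n)) (P : Prover n) (p : List (Instr n c)) (s r : ℕ)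
    (E Ψ : Joint n c P.K) :
    pairing E (runProgram ρ P p s r Ψ) = pairing (programDual ρ P p s r E) Ψ := by
  induction p generalizing s r Ψ with
  | nil => rfl
  | cons a p ih =>
    cases a with
    | layer l => rw [runProgram, ih, pairing_foldl_run, programDual]
    | query =>
      rw [runProgram, ih, programDual]
      refine Finset.sum_congr rfl fun μ _ => ?_
      rw [trace_mul_kronecker, trace_one_kronecker_mul]
    | send =>
      rw [runProgram, ih, programDual]
      refine Finset.sum_congr rfl fun μ _ => ?_
      rw [trace_mul_kronecker, trace_mul_apply]
    | recv k => rw [runProgram, ih, pairing_recvBit, programDual]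

/-- Number of qudits sent by a program. -/
def sendCount (p : List (Instr n c)) : ℕ := p.countP fun | .send => true | _ => false

/-- Number of bits received by a program. -/
def recvCount (p : List (Instr n c)) : ℕ := p.countP fun | .recv _ => true | _ => false

lemma runProgram_append (ρ : State (Qubits n)) (P : Prover n) (p q : List (Instr n c)) (s r : ℕ)
    (Ψ : Joint n c P.K) :
    runProgram ρ P (p ++ q) s r Ψ =
      runProgram ρ P q (s + sendCount p) (r + recvCount p) (runProgram ρ P p s r Ψ) := by
  induction p generalizing s r Ψ with
  | nil => simp [runProgram, sendCount, recvCount]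
  | cons a p ih =>
    cases a <;>
      simp [runProgram, ih, sendCount, recvCount, Nat.add_assoc, Nat.add_comm 1]

/-! ### Positivity -/

/-- All components of the joint state are positive semidefinite. -/
def Joint.Pos (Ψ : Joint n c K) : Prop := ∀ μ, (Ψ μ).PosSemidef

lemma posSemidef_traceReg {σ : Matrix (Qubits n × K) (Qubits n × K) ℂ} (h : σ.PosSemidef) :
    (traceReg σ).PosSemidef := by
  have : traceReg σ = ∑ q, σ.submatrix (fun k => (q, k)) (fun k => (q, k)) := by
    ext k l
    simp [traceReg, Matrix.sum_apply]
  rw [this]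
  exact Matrix.posSemidef_sum _ fun q _ => h.submatrix _

lemma Instrument.posSemidef_apply {O I J : Type} [Fintype O] [Fintype I] [Fintype J]
    [DecidableEq I] (M : Instrument O I J) (o : O) {σ : Matrix I I ℂ} (h : σ.PosSemidef) :
    (M.apply o σ).PosSemidef :=
  Matrix.posSemidef_sum _ fun _ _ => h.mul_mul_conjTranspose_same _

lemma Op.pos_run (op : Op n c) {Ψ : Joint n c K} (h : Ψ.Pos) : (op.run Ψ).Pos := by
  intro ν
  refine Matrix.posSemidef_sum _ fun μ _ => ?_
  generalize op.branches μ = L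
  induction L with
  | nil => exact Matrix.PosSemidef.zero
  | cons b L ih =>
    rw [List.map_cons, List.sum_cons]
    refine Matrix.PosSemidef.add ?_ ih
    split_ifs
    · exact (h μ).mul_mul_conjTranspose_same _
    · exact Matrix.PosSemidef.zero

lemma posSemidef_zeroState : (zeroState n).PosSemidef := (zeros_isState _).1

lemma pos_runProgram (ρ : State (Qubits n)) (P : Prover n) (p : List (Instr n c)) (s r : ℕ)
    {Ψ : Joint n c P.K} (h : Ψ.Pos) : (runProgram ρ P p s r Ψ).Pos := by
  induction p generalizing s r Ψ with
  | nil => exact h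
  | cons a p ih =>
    cases a with
    | layer l =>
      refine ih _ _ ?_
      induction l generalizing Ψ with
      | nil => exact h
      | cons op l ihl => exact ihl (op.pos_run h)
    | query =>
      refine ih _ _ fun μ => ?_
      exact ρ.2.1.kronecker (posSemidef_traceReg (h μ))
    | send =>
      refine ih _ _ fun μ => ?_
      exact posSemidef_zeroState.kronecker ((P.absorb s).posSemidef_apply () (h μ))
    | recv k =>
      refine ih _ _ fun ν => ?_
      refine Matrix.posSemidef_sum _ fun μ _ => Matrix.posSemidef_sum _ fun b _ => ?_
      split_ifs
      · exact Matrix.posSemidef_sum _ fun i _ => (h μ).mul_mul_conjTranspose_same _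
      · exact Matrix.PosSemidef.zero

end Heisenberg

/-! ### Averages over coins -/

section Coins

variable {n c : ℕ}

/-- The average of `E` over uniformly random values of the bits in the list `ks`. -/
def coinAvg {V : Type*} [AddCommGroup V] [Module ℝ V] : List (Fin c) → (Mem c → V) → Mem c → V
  | [], E => E
  | k :: ks, E => fun μ =>
      (1 / 2 : ℝ) • (coinAvg ks E (Function.update μ k false) +
        coinAvg ks E (Function.update μ k true))

variable {V : Type*} [AddCommGroup V] [Module ℝ V]

lemma coinAvg_append (l l' : List (Fin c)) (E : Mem c → V) :
    coinAvg (l ++ l') E = coinAvg l (coinAvg l' E) := by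
  induction l with
  | nil => rfl
  | cons k l ih => simp [coinAvg, ih]

lemma coinAvg_map {W : Type*} [AddCommGroup W] [Module ℝ W] (f : V →ₗ[ℝ] W) (l : List (Fin c))
    (E : Mem c → V) (μ : Mem c) : f (coinAvg l E μ) = coinAvg l (fun ν => f (E ν)) μ := by
  induction l generalizing μ with
  | nil => rfl
  | cons k l ih => simp [coinAvg, ih]

/-- The average only depends on the values at memories that agree off the averaged bits. -/
lemma coinAvg_congr {l : List (Fin c)} {E E' : Mem c → V} {μ : Mem c}
    (h : ∀ ν, (∀ i, i ∉ l → ν i = μ i) → E ν = E' ν) : coinAvg l E μ = coinAvg l E' μ := by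
  induction l generalizing μ with
  | nil => exact h μ fun _ _ => rfl
  | cons k l ih =>
    have key : ∀ b, coinAvg l E (Function.update μ k b) = coinAvg l E' (Function.update μ k b) :=
      fun b => ih fun ν hν => h ν fun i hi => by
        have hi' := hi
        rw [List.mem_cons, not_or] at hi'
        rw [hν i hi'.2, Function.update_of_ne hi'.1]
    simp only [coinAvg, key]

lemma coinAvg_const (l : List (Fin c)) (v : V) (μ : Mem c) : coinAvg l (fun _ => v) μ = v := by
  induction l generalizing μ with
  | nil => rfl
  | cons k l ih =>
    simp only [coinAvg, ih]
    rw [← two_smul ℝ v, smul_smul]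
    norm_num

lemma foldr_dual_coin {K : Type} [Fintype K] [DecidableEq K] (l : List (Fin c))
    (E : Joint n c K) : (l.map (Op.coin (n := n))).foldr Op.dual E = coinAvg l E := by
  induction l with
  | nil => rfl
  | cons k l ih =>
    rw [List.map_cons, List.foldr_cons, ih]
    funext μ
    have h2 : (((Real.sqrt 2)⁻¹ : ℂ)) * ((Real.sqrt 2)⁻¹ : ℂ) = 1 / 2 := by
      rw [← mul_inv, ← Complex.ofReal_mul, Real.mul_self_sqrt (by norm_num)]
      norm_num
    have hk : ∀ F : Matrix (Qubits n × K) (Qubits n × K) ℂ,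
        ((((Real.sqrt 2)⁻¹ : ℂ) • (1 : Matrix (Qubits n) (Qubits n) ℂ)) ⊗ₖ (1 : Matrix K K ℂ))ᴴ * F *
          ((((Real.sqrt 2)⁻¹ : ℂ) • (1 : Matrix (Qubits n) (Qubits n) ℂ)) ⊗ₖ (1 : Matrix K K ℂ)) =
          (1 / 2 : ℝ) • F := by
      intro F
      rw [Matrix.smul_kronecker, Matrix.one_kronecker_one, Matrix.conjTranspose_smul,
        Matrix.conjTranspose_one, Matrix.smul_mul, Matrix.one_mul, Matrix.mul_smul,
        Matrix.mul_one, smul_smul]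
      have : star ((Real.sqrt 2 : ℂ)⁻¹) = (Real.sqrt 2 : ℂ)⁻¹ := by
        rw [← Complex.ofReal_inv]; exact Complex.conj_ofReal _
      rw [this, h2]
      ext i j
      simp
    simp only [Op.dual, Op.branches, List.map_cons, List.map_nil, List.sum_cons, List.sum_nil,
      add_zero, hk, coinAvg, smul_add]

end Coins

/-! ### Clifford gates and their action on pairs of Bell states -/

/-- The single-qubit gates of the random circuit. -/
inductive Local : Type
  | X | Z | S | H

/-- The gates of the random circuit: single-qubit gates, and controlled phase flips. -/
inductive Cliff (n : ℕ) : Type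
  | loc (k : Local) (i : Fin n)
  | cz (i j : Fin n) (h : i ≠ j)

/-- The matrix of a single-qubit gate. -/
def Local.mat : Local → Matrix Bool Bool ℂ
  | .X => fun a b => if a = !b then 1 else 0
  | .Z => fun a b => if a = b then (if a then -1 else 1) else 0
  | .S => fun a b => if a = b then (if a then Complex.I else 1) else 0
  | .H => fun a b => (Real.sqrt 2 : ℂ)⁻¹ * (if a && b then -1 else 1)

lemma sqrt_two_inv_mul_self : (Real.sqrt 2 : ℂ)⁻¹ * (Real.sqrt 2 : ℂ)⁻¹ = 1 / 2 := by
  rw [← mul_inv, ← Complex.ofReal_mul, Real.mul_self_sqrt (by norm_num)]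
  norm_num

lemma Local.unitary (k : Local) : k.matᴴ * k.mat = 1 := by
  have h := sqrt_two_inv_mul_self
  have hs : (starRingEnd ℂ) (Real.sqrt 2 : ℂ) = (Real.sqrt 2 : ℂ) := Complex.conj_ofReal _
  ext a b
  rw [Matrix.mul_apply, Fintype.sum_bool, Matrix.one_apply]
  simp only [Matrix.conjTranspose_apply]
  cases k <;> cases a <;> cases b <;> simp [Local.mat, hs, h] <;> norm_num

/-- A single-qubit matrix as a matrix on the basis labels of one wire. -/
def wireMat (u : Matrix Bool Bool ℂ) : Matrix (Fin 1 → Bool) (Fin 1 → Bool) ℂ :=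
  u.submatrix (fun x => x 0) (fun x => x 0)

lemma wireMat_unitary {u : Matrix Bool Bool ℂ} (h : uᴴ * u = 1) :
    wireMat u ∈ Matrix.unitaryGroup (Fin 1 → Bool) ℂ := by
  rw [Matrix.mem_unitaryGroup_iff']
  have e : wireMat u = u.submatrix (Equiv.funUnique (Fin 1) Bool) (Equiv.funUnique (Fin 1) Bool) :=
    rfl
  rw [e, Matrix.star_eq_conjTranspose, Matrix.conjTranspose_submatrix,
    Matrix.submatrix_mul_equiv, h, Matrix.submatrix_one_equiv]

/-- The matrix of the controlled phase flip on two wires. -/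
def czMat : Matrix (Fin 2 → Bool) (Fin 2 → Bool) ℂ :=
  Matrix.diagonal fun x => if x 0 && x 1 then -1 else 1

lemma czMat_unitary : czMat ∈ Matrix.unitaryGroup (Fin 2 → Bool) ℂ := by
  rw [Matrix.mem_unitaryGroup_iff', Matrix.star_eq_conjTranspose, czMat,
    Matrix.diagonal_conjTranspose, Matrix.diagonal_mul_diagonal, ← Matrix.diagonal_one]
  congr 1
  funext x
  simp only [Pi.star_apply]
  split_ifs <;> simp

/-- One wire of a register. -/
def wire {W : Type} (i : W) : Fin 1 ↪ W := ⟨fun _ => i, fun _ _ _ => Subsingleton.elim _ _⟩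

/-- Two different wires of a register. -/
def wirePair {W : Type} (i j : W) (h : i ≠ j) : Fin 2 ↪ W :=
  ⟨![i, j], by
    intro a b hab
    fin_cases a <;> fin_cases b <;> simp_all⟩

/-- The gate `g` as an operation of the verifier that is controlled by the bit `ctl`. -/
def Cliff.toOp {n c : ℕ} (ctl : Fin c) : Cliff n → Op n c
  | .loc k i => .gate ctl 1 (by norm_num) (wire i) ⟨wireMat k.mat, wireMat_unitary k.unitary⟩
  | .cz i j h => .gate ctl 2 le_rfl (wirePair i j h) ⟨czMat, czMat_unitary⟩

/-- The matrix of a gate on the register. -/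
def Cliff.mat {n : ℕ} : Cliff n → Matrix (Qubits n) (Qubits n) ℂ
  | .loc k i => onWires (wire i) (wireMat k.mat)
  | .cz i j h => onWires (wirePair i j h) czMat

lemma Cliff.unitary {n : ℕ} (g : Cliff n) : g.matᴴ * g.mat = 1 := by
  cases g with
  | loc k i => exact onWires_unitary _ _ (Matrix.mem_unitaryGroup_iff'.1 (wireMat_unitary k.unitary))
  | cz i j h => exact onWires_unitary _ _ (Matrix.mem_unitaryGroup_iff'.1 czMat_unitary)

lemma wire_forall_iff {W : Type} [DecidableEq W] (i : W) (x z : W → Bool) :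
    (∀ w, (∀ t, wire i t ≠ w) → x w = z w) ↔ z = Function.update x i (z i) := by
  constructor
  · intro h
    funext w
    by_cases hw : w = i
    · subst hw; simp
    · rw [Function.update_of_ne hw, h w fun _ e => hw e.symm]
  · intro h w hw
    have hwi : w ≠ i := fun e => hw 0 e.symm
    rw [h, Function.update_of_ne hwi]

/-- A single-qubit gate applied to the basis expansion of a vector. -/
lemma sum_onWires_wire {W : Type} [Fintype W] [DecidableEq W] (i : W) (u : Matrix Bool Bool ℂ)
    (x : W → Bool) (v : (W → Bool) → ℂ) :
    ∑ z, onWires (wire i) (wireMat u) x z * v z =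
      ∑ b, u (x i) b * v (Function.update x i b) := by
  symm
  refine Finset.sum_of_injOn (fun b => Function.update x i b) ?_ ?_ ?_ ?_
  · intro a _ b _ h
    simpa using congrFun h i
  · intro b _; simp
  · intro z _ hz
    have : ¬ (∀ w, (∀ t, wire i t ≠ w) → x w = z w) := by
      rw [wire_forall_iff]
      intro h
      exact hz ⟨z i, by simp, h.symm⟩
    simp only [onWires, if_neg this, zero_mul]
  · intro b _
    have : ∀ w, (∀ t, wire i t ≠ w) → x w = Function.update x i b w := by
      rw [wire_forall_iff]; simp
    have e : wire i 0 = i := rfl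
    simp only [onWires, if_pos this]
    simp [wireMat, e]

lemma onWires_wirePair_cz {n : ℕ} (i j : Fin n) (h : i ≠ j) :
    onWires (wirePair i j h) czMat =
      Matrix.diagonal fun x : Qubits n => if x i && x j then (-1 : ℂ) else 1 := by
  ext x y
  by_cases hxy : x = y
  · subst hxy
    have e0 : wirePair i j h 0 = i := rfl
    have e1 : wirePair i j h 1 = j := rfl
    simp [onWires, czMat, e0, e1]
  · rw [Matrix.diagonal_apply_ne _ hxy]
    unfold onWires
    split_ifs with hw
    · refine Matrix.diagonal_apply_ne _ fun e => hxy ?_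
      funext w
      by_cases hi : i = w
      · subst hi; exact congrFun e 0
      by_cases hj : j = w
      · subst hj; exact congrFun e 1
      refine hw w fun t => ?_
      fin_cases t
      · exact hi
      · exact hj
    · rfl

/-- The effect of a single-qubit gate on the label of a Bell state of two copies of the qubit. -/
def Local.act : Local → Bool → Bool → Bool × Bool
  | .X, w, r => (w, r)
  | .Z, w, r => (w, r)
  | .S, w, r => (w, xor r !w)
  | .H, w, r => (r, w)

/-- The phase that a Bell state of two copies of a qubit acquires under a single-qubit gate. -/
def Local.phase : Local → Bool → Bool → ℂ
  | .X, _, r => if r then -1 else 1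
  | .Z, w, _ => if w then -1 else 1
  | .S, w, _ => if w then Complex.I else 1
  | .H, w, r => if w && r then -1 else 1

/-- Labels `(w, r)` of the `n`-fold tensor products of Bell states of two copies of a qubit. -/
abbrev Label (n : ℕ) : Type := Qubits n × Qubits n

/-- The effect of a gate, applied to both copies, on the labels of Bell states. -/
def Cliff.act {n : ℕ} : Cliff n → Label n → Label n
  | .loc k i, ℓ => (Function.update ℓ.1 i (k.act (ℓ.1 i) (ℓ.2 i)).1,
      Function.update ℓ.2 i (k.act (ℓ.1 i) (ℓ.2 i)).2)
  | .cz i j _, ℓ => (ℓ.1, Function.update (Function.update ℓ.2 i (xor (ℓ.2 i) (ℓ.1 j))) j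
      (xor (ℓ.2 j) (ℓ.1 i)))

/-- The phase of a Bell state under a gate that is applied to both copies. -/
def Cliff.phase {n : ℕ} : Cliff n → Label n → ℂ
  | .loc k i, ℓ => k.phase (ℓ.1 i) (ℓ.2 i)
  | .cz i j _, ℓ => if ℓ.1 i && ℓ.1 j then -1 else 1

/-- Entries of the unnormalized Bell states `∑ u, (-1) ^ (r u) |u, u + w⟩` of two qubits. -/
def bellSite (w r u v : Bool) : ℤ := if v = xor u w then (if r && u then -1 else 1) else 0

/-- The unnormalized Bell state with label `(w, r)` of two registers. -/
def bell {n : ℕ} (ℓ : Label n) (p : Qubits n × Qubits n) : ℂ :=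
  ((∏ i, bellSite (ℓ.1 i) (ℓ.2 i) (p.1 i) (p.2 i) : ℤ) : ℂ)

lemma bell_split {n : ℕ} (i : Fin n) (w r u v : Qubits n) (a b x y : Bool) :
    bell (Function.update w i a, Function.update r i b)
        (Function.update u i x, Function.update v i y) =
      (bellSite a b x y : ℂ) *
        ((∏ j ∈ Finset.univ.erase i, bellSite (w j) (r j) (u j) (v j) : ℤ) : ℂ) := by
  unfold bell
  rw [← Finset.mul_prod_erase _ _ (Finset.mem_univ i)]
  push_cast
  congr 1
  · simp
  · refine Finset.prod_congr rfl fun j hj => ?_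
    have := Finset.ne_of_mem_erase hj
    simp [this]

lemma Local.sum_bellSite (k : Local) (w r u v : Bool) :
    ∑ a, ∑ b, k.mat u a * k.mat v b * (bellSite w r a b : ℂ) =
      k.phase w r * (bellSite (k.act w r).1 (k.act w r).2 u v : ℂ) := by
  have h := sqrt_two_inv_mul_self
  cases k <;> cases w <;> cases r <;> cases u <;> cases v <;>
    simp [Local.mat, Local.phase, Local.act, bellSite, h] <;> norm_num

lemma bellSite_cz (w r u v w' r' u' v' : Bool) :
    (if u && u' then -1 else 1) * (if v && v' then -1 else 1) *
        (bellSite w r u v * bellSite w' r' u' v') =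
      (if w && w' then -1 else 1) *
        (bellSite w (xor r w') u v * bellSite w' (xor r' w) u' v') := by
  revert w r u v w' r' u' v'
  decide

lemma kronecker_mulVec {I : Type} [Fintype I] (A : Matrix I I ℂ) (v : I × I → ℂ) (x y : I) :
    ((A ⊗ₖ A) *ᵥ v) (x, y) = ∑ z, A x z * ∑ z', A y z' * v (z, z') := by
  simp only [Matrix.mulVec, dotProduct, Fintype.sum_prod_type, Matrix.kroneckerMap_apply,
    Finset.mul_sum, mul_assoc]

/-- Clifford gates, applied to both copies, permute the Bell states up to phases. -/
lemma Cliff.mulVec_bell {n : ℕ} (g : Cliff n) (ℓ : Label n) :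
    (g.mat ⊗ₖ g.mat) *ᵥ bell ℓ = g.phase ℓ • bell (g.act ℓ) := by
  obtain ⟨w, r⟩ := ℓ
  ext ⟨u, v⟩
  rw [kronecker_mulVec]
  cases g with
  | loc k i =>
    simp only [Cliff.mat, sum_onWires_wire, Cliff.phase, Cliff.act, Pi.smul_apply, smul_eq_mul]
    have e1 := bell_split i w r u v (k.act (w i) (r i)).1 (k.act (w i) (r i)).2 (u i) (v i)
    rw [Function.update_eq_self, Function.update_eq_self] at e1
    have e2 : ∀ a b, bell (w, r) (Function.update u i a, Function.update v i b) =
        (bellSite (w i) (r i) a b : ℂ) *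
          ((∏ j ∈ Finset.univ.erase i, bellSite (w j) (r j) (u j) (v j) : ℤ) : ℂ) := fun a b => by
      have := bell_split i w r u v (w i) (r i) a b
      rwa [Function.update_eq_self, Function.update_eq_self] at this
    rw [e1, ← mul_assoc, ← k.sum_bellSite, Finset.sum_mul]
    refine Finset.sum_congr rfl fun a _ => ?_
    rw [Finset.mul_sum, Finset.sum_mul]
    refine Finset.sum_congr rfl fun b _ => ?_
    rw [e2]; ring
  | cz i j h =>
    have hd : ∀ (d f : Qubits n → ℂ) (x : Qubits n), ∑ z, Matrix.diagonal d x z * f z = d x * f x :=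
      fun d f x => Matrix.mulVec_diagonal d f x
    simp only [Cliff.mat, onWires_wirePair_cz, Cliff.phase, Cliff.act, Pi.smul_apply, smul_eq_mul,
      hd]
    have hm : j ∈ Finset.univ.erase i := Finset.mem_erase.2 ⟨h.symm, Finset.mem_univ _⟩
    have hr : ∏ x ∈ (Finset.univ.erase i).erase j, bellSite (w x) (Function.update
        (Function.update r i (xor (r i) (w j))) j (xor (r j) (w i)) x) (u x) (v x) =
        ∏ x ∈ (Finset.univ.erase i).erase j, bellSite (w x) (r x) (u x) (v x) := by
      refine Finset.prod_congr rfl fun x hx => ?_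
      have h1 := Finset.ne_of_mem_erase hx
      have h2 := Finset.ne_of_mem_erase (Finset.mem_of_mem_erase hx)
      simp [h1, h2]
    unfold bell
    rw [← Finset.mul_prod_erase _ _ (Finset.mem_univ i), ← Finset.mul_prod_erase _ _ hm,
      ← Finset.mul_prod_erase Finset.univ (fun x => bellSite (w x) (Function.update
        (Function.update r i (xor (r i) (w j))) j (xor (r j) (w i)) x) (u x) (v x))
        (Finset.mem_univ i), ← Finset.mul_prod_erase _ _ hm, hr]
    have := bellSite_cz (w i) (r i) (u i) (v i) (w j) (r j) (u j) (v j)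
    simp only [Function.update_self, Function.update_of_ne h]
    have e : ∀ a : Bool, (if a = true then (-1 : ℂ) else 1) =
        ((if a = true then (-1 : ℤ) else 1 : ℤ) : ℂ) := by
      intro a; cases a <;> simp
    rw [← mul_assoc, e, e, e, ← Int.cast_mul, ← Int.cast_mul, ← Int.cast_mul]
    congr 1
    generalize ∏ x ∈ (Finset.univ.erase i).erase j, bellSite (w x) (r x) (u x) (v x) = R
    calc _ = ((if u i && u j then -1 else 1) * (if v i && v j then -1 else 1) *
        (bellSite (w i) (r i) (u i) (v i) * bellSite (w j) (r j) (u j) (v j))) * R := by ring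
      _ = _ := by rw [this]; ring

lemma Cliff.phase_mul_star {n : ℕ} (g : Cliff n) (ℓ : Label n) : g.phase ℓ * star (g.phase ℓ) = 1 := by
  cases g with
  | loc k i =>
    simp only [Cliff.phase]
    cases k <;> simp only [Local.phase] <;> split_ifs <;> simp
  | cz i j h =>
    simp only [Cliff.phase]
    split_ifs <;> simp

/-- The projection onto the Bell state with label `ℓ`. -/
def bellProj {n : ℕ} (ℓ : Label n) : Matrix (Qubits n × Qubits n) (Qubits n × Qubits n) ℂ :=
  ((2 : ℂ) ^ n)⁻¹ • Matrix.vecMulVec (bell ℓ) (star (bell ℓ))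

/-- Conjugation of an operator on two registers by `U ⊗ U`. -/
def conjPair {I : Type} [Fintype I] (U : Matrix I I ℂ) (σ : Matrix (I × I) (I × I) ℂ) :
    Matrix (I × I) (I × I) ℂ := (U ⊗ₖ U) * σ * (U ⊗ₖ U)ᴴ

lemma conjPair_vecMulVec {I : Type} [Fintype I] (U : Matrix I I ℂ) (v w : I × I → ℂ) :
    conjPair U (Matrix.vecMulVec v (star w)) =
      Matrix.vecMulVec ((U ⊗ₖ U) *ᵥ v) (star ((U ⊗ₖ U) *ᵥ w)) := by
  rw [conjPair, Matrix.mul_vecMulVec, Matrix.vecMulVec_mul, Matrix.star_mulVec]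

lemma conjPair_conjPair {I : Type} [Fintype I] [DecidableEq I] (U V : Matrix I I ℂ)
    (σ : Matrix (I × I) (I × I) ℂ) : conjPair U (conjPair V σ) = conjPair (U * V) σ := by
  simp only [conjPair, Matrix.mul_kronecker_mul, Matrix.conjTranspose_mul, Matrix.mul_assoc]

lemma conjPair_add {I : Type} [Fintype I] (U : Matrix I I ℂ) (σ τ : Matrix (I × I) (I × I) ℂ) :
    conjPair U (σ + τ) = conjPair U σ + conjPair U τ := by
  simp [conjPair, Matrix.mul_add, Matrix.add_mul]

lemma conjPair_smul {I R : Type} [Fintype I] [Monoid R] [DistribMulAction R ℂ]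
    [IsScalarTower R ℂ ℂ] [SMulCommClass R ℂ ℂ]
    (U : Matrix I I ℂ) (a : R) (σ : Matrix (I × I) (I × I) ℂ) :
    conjPair U (a • σ) = a • conjPair U σ := by
  rw [conjPair, Matrix.mul_smul, Matrix.smul_mul, conjPair]

lemma Cliff.conjPair_bellProj {n : ℕ} (g : Cliff n) (ℓ : Label n) :
    conjPair g.mat (bellProj ℓ) = bellProj (g.act ℓ) := by
  rw [bellProj, conjPair_smul, conjPair_vecMulVec, g.mulVec_bell, star_smul,
    Matrix.smul_vecMulVec, Matrix.vecMulVec_smul, smul_smul (g.phase ℓ),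
    g.phase_mul_star, one_smul]
  rfl

/-! ### Random circuits -/

/-- The random circuits apply each gate with probability `1/2`, except for the Hadamard gates,
which are always applied. -/
def Cliff.isRandom {n : ℕ} : Cliff n → Bool
  | .loc .H _ => false
  | _ => true

/-- The average of `φ (U * A)` over the unitaries `U` of the random circuit `gs`. -/
def circuitAvg {n : ℕ} : List (Cliff n) → (Matrix (Qubits n) (Qubits n) ℂ → ℝ) →
    Matrix (Qubits n) (Qubits n) ℂ → ℝ
  | [], φ, A => φ A
  | g :: gs, φ, A => if g.isRandom then
      (1 / 2 : ℝ) * (circuitAvg gs φ A + circuitAvg gs φ (g.mat * A))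
      else circuitAvg gs φ (g.mat * A)

/-- The effect of a random circuit on two copies. -/
def twirl {n : ℕ} : List (Cliff n) → Matrix (Qubits n × Qubits n) (Qubits n × Qubits n) ℂ →
    Matrix (Qubits n × Qubits n) (Qubits n × Qubits n) ℂ
  | [], σ => σ
  | g :: gs, σ => if g.isRandom then
      (1 / 2 : ℝ) • (twirl gs σ + twirl gs (conjPair g.mat σ)) else twirl gs (conjPair g.mat σ)

/-- The average of a function of Bell labels over the random circuit `gs`. -/
def labelAvg {n : ℕ} : List (Cliff n) → (Label n → ℝ) → Label n → ℝ
  | [], F, ℓ => F ℓ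
  | g :: gs, F, ℓ => if g.isRandom then
      (1 / 2 : ℝ) * (labelAvg gs F ℓ + labelAvg gs F (g.act ℓ)) else labelAvg gs F (g.act ℓ)

section Averages

variable {n : ℕ}

lemma twirl_add (gs : List (Cliff n)) (σ τ) : twirl gs (σ + τ) = twirl gs σ + twirl gs τ := by
  induction gs generalizing σ τ with
  | nil => rfl
  | cons g gs ih =>
    simp only [twirl, conjPair_add, ih]
    split_ifs
    · rw [← smul_add]; congr 1; abel
    · rfl

lemma twirl_smul (gs : List (Cliff n)) (a : ℝ) (σ) : twirl gs (a • σ) = a • twirl gs σ := by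
  induction gs generalizing σ with
  | nil => rfl
  | cons g gs ih =>
    simp only [twirl, conjPair_smul, ih]
    split_ifs
    · rw [← smul_add, smul_comm]
    · rfl

lemma twirl_sum {ι : Type} (s : Finset ι) (gs : List (Cliff n)) (σ : ι → _) :
    twirl gs (∑ i ∈ s, σ i) = ∑ i ∈ s, twirl gs (σ i) :=
  map_sum (⟨⟨twirl gs, by simpa using twirl_smul gs 0 0⟩, twirl_add gs⟩ :
    Matrix (Qubits n × Qubits n) (Qubits n × Qubits n) ℂ →+ _) σ s

lemma twirl_append (gs hs : List (Cliff n)) (σ) : twirl (gs ++ hs) σ = twirl hs (twirl gs σ) := by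
  induction gs generalizing σ with
  | nil => rfl
  | cons g gs ih =>
    simp only [List.cons_append, twirl, ih]
    split_ifs
    · rw [twirl_smul, twirl_add]
    · rfl

/-- A linear functional of two copies of `U`, averaged over the random circuit, is its value on the
twirled state. -/
lemma circuitAvg_eq_twirl (gs : List (Cliff n))
    (h : Matrix (Qubits n × Qubits n) (Qubits n × Qubits n) ℂ →ₗ[ℝ] ℝ) (σ) (A) :
    circuitAvg gs (fun U => h (conjPair U σ)) A = h (twirl gs (conjPair A σ)) := by
  induction gs generalizing A with
  | nil => rfl
  | cons g gs ih =>
    simp only [circuitAvg, twirl, ih, conjPair_conjPair]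
    split_ifs <;> simp [mul_add]

/-- Twirling a Bell state amounts to averaging over the labels that it is sent to. -/
lemma map_twirl_bellProj (gs : List (Cliff n))
    (h : Matrix (Qubits n × Qubits n) (Qubits n × Qubits n) ℂ →ₗ[ℝ] ℝ) (ℓ : Label n) :
    h (twirl gs (bellProj ℓ)) = labelAvg gs (fun ℓ => h (bellProj ℓ)) ℓ := by
  induction gs generalizing ℓ with
  | nil => rfl
  | cons g gs ih =>
    simp only [twirl, labelAvg, g.conjPair_bellProj, ← ih]
    split_ifs <;> simp [mul_add]

lemma labelAvg_append (gs hs : List (Cliff n)) (F : Label n → ℝ) :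
    labelAvg (gs ++ hs) F = labelAvg gs (labelAvg hs F) := by
  induction gs with
  | nil => rfl
  | cons g gs ih =>
    funext ℓ
    simp only [List.cons_append, labelAvg, ih]

lemma circuitAvg_mono_on (gs : List (Cliff n)) {φ φ' : Matrix (Qubits n) (Qubits n) ℂ → ℝ}
    (h : ∀ U, Uᴴ * U = 1 → φ U ≤ φ' U) {A} (hA : Aᴴ * A = 1) :
    circuitAvg gs φ A ≤ circuitAvg gs φ' A := by
  induction gs generalizing A with
  | nil => exact h A hA
  | cons g gs ih =>
    have hg : (g.mat * A)ᴴ * (g.mat * A) = 1 := by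
      rw [Matrix.conjTranspose_mul, Matrix.mul_assoc, ← Matrix.mul_assoc _ g.mat A, g.unitary,
        Matrix.one_mul, hA]
    simp only [circuitAvg]
    split_ifs
    · have := ih hA; have := ih hg; linarith
    · exact ih hg

lemma circuitAvg_congr_on (gs : List (Cliff n)) {φ φ' : Matrix (Qubits n) (Qubits n) ℂ → ℝ}
    (h : ∀ U, Uᴴ * U = 1 → φ U = φ' U) {A} (hA : Aᴴ * A = 1) :
    circuitAvg gs φ A = circuitAvg gs φ' A :=
  le_antisymm (circuitAvg_mono_on gs (fun U hU => (h U hU).le) hA)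
    (circuitAvg_mono_on gs (fun U hU => (h U hU).ge) hA)

lemma circuitAvg_const (gs : List (Cliff n)) (a : ℝ) (A) : circuitAvg gs (fun _ => a) A = a := by
  induction gs generalizing A with
  | nil => rfl
  | cons g gs ih =>
    simp only [circuitAvg, ih]
    split_ifs
    · ring
    · rfl

lemma circuitAvg_add (gs : List (Cliff n)) (φ φ' : Matrix (Qubits n) (Qubits n) ℂ → ℝ) (A) :
    circuitAvg gs (fun U => φ U + φ' U) A = circuitAvg gs φ A + circuitAvg gs φ' A := by
  induction gs generalizing A with
  | nil => rfl
  | cons g gs ih =>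
    simp only [circuitAvg, ih]
    split_ifs
    · ring
    · rfl

lemma circuitAvg_const_mul (gs : List (Cliff n)) (a : ℝ) (φ : Matrix (Qubits n) (Qubits n) ℂ → ℝ)
    (A) : circuitAvg gs (fun U => a * φ U) A = a * circuitAvg gs φ A := by
  induction gs generalizing A with
  | nil => rfl
  | cons g gs ih =>
    simp only [circuitAvg, ih]
    split_ifs
    · ring
    · rfl

end Averages

/-! ### Two copies of a pure state under random Pauli gates -/

section PureStates

variable {n : ℕ}

lemma sum_prod_bool {R : Type*} [CommSemiring R] (f : Fin n → Bool → R) :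
    ∑ x : Qubits n, ∏ i, f i (x i) = ∏ i, ∑ a, f i a := by
  rw [Finset.prod_univ_sum, Fintype.piFinset_univ]

lemma sum_label_prod {R : Type*} [CommSemiring R] (f : Fin n → Bool → Bool → R) :
    ∑ ℓ : Label n, ∏ i, f i (ℓ.1 i) (ℓ.2 i) = ∏ i, ∑ a, ∑ b, f i a b := by
  rw [Fintype.sum_prod_type, ← sum_prod_bool]
  exact Finset.sum_congr rfl fun w _ => sum_prod_bool fun i b => f i (w i) b

lemma sum_bellSite_mul (u v u' v' : Bool) :
    ∑ w, ∑ r, bellSite w r u v * bellSite w r u' v' = if u = u' ∧ v = v' then 2 else 0 := by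
  revert u v u' v'
  decide

lemma sum_bell_mul_bell (p p' : Qubits n × Qubits n) :
    ∑ ℓ, bell ℓ p * bell ℓ p' = if p = p' then (2 : ℂ) ^ n else 0 := by
  have h : ∑ ℓ : Label n, (∏ i, bellSite (ℓ.1 i) (ℓ.2 i) (p.1 i) (p.2 i)) *
      (∏ i, bellSite (ℓ.1 i) (ℓ.2 i) (p'.1 i) (p'.2 i)) = if p = p' then (2 : ℤ) ^ n else 0 := by
    simp only [← Finset.prod_mul_distrib]
    rw [sum_label_prod fun i w r => bellSite w r (p.1 i) (p.2 i) * bellSite w r (p'.1 i) (p'.2 i)]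
    simp only [sum_bellSite_mul]
    split_ifs with hp
    · subst hp; simp
    · have : ∃ i, ¬ (p.1 i = p'.1 i ∧ p.2 i = p'.2 i) := by
        by_contra! hc
        exact hp (Prod.ext (funext fun i => (hc i).1) (funext fun i => (hc i).2))
      obtain ⟨i, hi⟩ := this
      exact Finset.prod_eq_zero (Finset.mem_univ i) (if_neg hi)
  have h' := congrArg (Int.cast : ℤ → ℂ) h
  push_cast at h'
  simpa [bell] using h'

lemma star_bell (ℓ : Label n) : star (bell ℓ) = bell ℓ := by
  funext p
  simp [bell]

/-- The matrix element of `σ` between two unnormalized Bell states. -/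
def bellCoeff (ℓ ℓ' : Label n) (σ : Matrix (Qubits n × Qubits n) (Qubits n × Qubits n) ℂ) : ℂ :=
  bell ℓ ⬝ᵥ (σ *ᵥ bell ℓ')

/-- Completeness of the Bell basis. -/
lemma eq_sum_bellCoeff (σ : Matrix (Qubits n × Qubits n) (Qubits n × Qubits n) ℂ) :
    σ = ((2 : ℂ) ^ n)⁻¹ • ((2 : ℂ) ^ n)⁻¹ • ∑ ℓ, ∑ ℓ', bellCoeff ℓ ℓ' σ •
      Matrix.vecMulVec (bell ℓ) (bell ℓ') := by
  have h2 : ((2 : ℂ) ^ n) ≠ 0 := by positivity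
  rw [eq_inv_smul_iff₀ h2, eq_inv_smul_iff₀ h2]
  ext p q
  simp only [Matrix.sum_apply, Matrix.smul_apply, Matrix.vecMulVec_apply, smul_eq_mul, bellCoeff,
    dotProduct, Matrix.mulVec, Finset.mul_sum, Finset.sum_mul]
  have e : ∀ ℓ ℓ' : Label n, ∑ x, ∑ y, bell ℓ x * (σ x y * bell ℓ' y) * (bell ℓ p * bell ℓ' q) =
      ∑ x, ∑ y, σ x y * ((bell ℓ x * bell ℓ p) * (bell ℓ' y * bell ℓ' q)) := fun ℓ ℓ' =>
    Finset.sum_congr rfl fun x _ => Finset.sum_congr rfl fun y _ => by ring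
  simp only [e]
  have e' : ∀ x y, ∑ ℓ : Label n, ∑ ℓ' : Label n,
      σ x y * ((bell ℓ x * bell ℓ p) * (bell ℓ' y * bell ℓ' q)) =
      σ x y * ((if x = p then (2 : ℂ) ^ n else 0) * (if y = q then (2 : ℂ) ^ n else 0)) := by
    intro x y
    rw [← sum_bell_mul_bell, ← sum_bell_mul_bell, Finset.sum_mul_sum]
    simp only [Finset.mul_sum]
  rw [Finset.sum_congr rfl fun ℓ _ => Finset.sum_comm, Finset.sum_comm,
    Finset.sum_congr rfl fun x _ => Finset.sum_congr rfl fun ℓ _ => Finset.sum_comm,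
    Finset.sum_congr rfl fun x _ => Finset.sum_comm]
  simp only [e']
  rw [Finset.sum_eq_single p, Finset.sum_eq_single q]
  · rw [if_pos rfl, if_pos rfl]; ring
  · intro y _ hy
    rw [if_neg hy, mul_zero, mul_zero]
  · intro hq; exact absurd (Finset.mem_univ _) hq
  · intro x _ hx
    simp [hx]
  · intro hp; exact absurd (Finset.mem_univ _) hp

lemma bellCoeff_add (ℓ ℓ' : Label n) (σ τ) :
    bellCoeff ℓ ℓ' (σ + τ) = bellCoeff ℓ ℓ' σ + bellCoeff ℓ ℓ' τ := by
  simp [bellCoeff, Matrix.add_mulVec]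

lemma bellCoeff_smul (ℓ ℓ' : Label n) (a : ℝ) (σ) :
    bellCoeff ℓ ℓ' (a • σ) = a • bellCoeff ℓ ℓ' σ := by
  simp [bellCoeff, Matrix.smul_mulVec]

/-- A gate that fixes all labels multiplies the matrix elements between Bell states by a phase. -/
lemma bellCoeff_conjPair (g : Cliff n) (hg : ∀ ℓ, g.act ℓ = ℓ) (ℓ ℓ' : Label n) (σ) :
    bellCoeff ℓ ℓ' (conjPair g.mat σ) = (g.phase ℓ * star (g.phase ℓ')) * bellCoeff ℓ ℓ' σ := by
  have hA : (g.mat ⊗ₖ g.mat)ᴴ * (g.mat ⊗ₖ g.mat) = 1 := by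
    rw [Matrix.conjTranspose_kronecker, ← Matrix.mul_kronecker_mul, g.unitary,
      Matrix.one_kronecker_one]
  have h1 : ∀ ℓ, (g.mat ⊗ₖ g.mat)ᴴ *ᵥ bell ℓ = star (g.phase ℓ) • bell ℓ := by
    intro ℓ
    have e := congrArg (fun v => star (g.phase ℓ) • (g.mat ⊗ₖ g.mat)ᴴ *ᵥ v) (g.mulVec_bell ℓ)
    simp only [Matrix.mulVec_mulVec, hA, Matrix.one_mulVec, Matrix.mulVec_smul, smul_smul] at e
    rw [mul_comm (star _), g.phase_mul_star, one_smul, hg] at e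
    exact e.symm
  have h2 : bell ℓ ᵥ* (g.mat ⊗ₖ g.mat) = g.phase ℓ • bell ℓ := by
    have e := congrArg star (h1 ℓ)
    rw [Matrix.star_mulVec, Matrix.conjTranspose_conjTranspose, star_smul, star_star,
      star_bell] at e
    exact e
  rw [bellCoeff, conjPair, ← Matrix.mulVec_mulVec, ← Matrix.mulVec_mulVec, h1,
    Matrix.dotProduct_mulVec, h2, Matrix.mulVec_smul, smul_dotProduct, dotProduct_smul, smul_eq_mul,
    smul_eq_mul, bellCoeff, mul_assoc]

lemma bellCoeff_twirl (gs : List (Cliff n)) (hg : ∀ g ∈ gs, g.isRandom = true ∧ ∀ ℓ, g.act ℓ = ℓ)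
    (ℓ ℓ' : Label n) (σ) :
    bellCoeff ℓ ℓ' (twirl gs σ) =
      (gs.map fun g => (1 + g.phase ℓ * star (g.phase ℓ')) / 2).prod * bellCoeff ℓ ℓ' σ := by
  induction gs generalizing σ with
  | nil => simp [twirl]
  | cons g gs ih =>
    have hg' := fun g hm => hg g (List.mem_cons_of_mem _ hm)
    obtain ⟨hr, ha⟩ := hg g List.mem_cons_self
    rw [twirl, if_pos hr, bellCoeff_smul, bellCoeff_add, ih hg', ih hg',
      bellCoeff_conjPair g ha, List.map_cons, List.prod_cons, Complex.real_smul]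
    push_cast
    ring

/-- The gates of a random Pauli operator. -/
def pauliGates (n : ℕ) : List (Cliff n) :=
  (List.finRange n).map (.loc .X) ++ (List.finRange n).map (.loc .Z)

lemma pauliGates_spec : ∀ g ∈ pauliGates n, g.isRandom = true ∧ ∀ ℓ, g.act ℓ = ℓ := by
  intro g hg
  rw [pauliGates, List.mem_append, List.mem_map, List.mem_map] at hg
  rcases hg with ⟨i, -, rfl⟩ | ⟨i, -, rfl⟩ <;>
    exact ⟨rfl, fun ℓ => by simp [Cliff.act, Local.act]⟩

/-- A random Pauli operator on both copies removes the coherences between different Bell states. -/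
lemma bellCoeff_twirl_pauliGates (ℓ ℓ' : Label n) (σ) :
    bellCoeff ℓ ℓ' (twirl (pauliGates n) σ) = if ℓ = ℓ' then bellCoeff ℓ ℓ' σ else 0 := by
  rw [bellCoeff_twirl _ pauliGates_spec]
  split_ifs with h
  · subst h
    rw [List.prod_eq_one, one_mul]
    simp only [Cliff.phase_mul_star, List.mem_map]
    rintro x ⟨g, -, rfl⟩
    norm_num
  · rw [List.prod_eq_zero, zero_mul]
    rw [List.mem_map]
    have : ∃ i, ℓ.1 i ≠ ℓ'.1 i ∨ ℓ.2 i ≠ ℓ'.2 i := by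
      by_contra! hc
      exact h (Prod.ext (funext fun i => (hc i).1) (funext fun i => (hc i).2))
    obtain ⟨i, hi | hi⟩ := this
    · refine ⟨.loc .Z i, by simp [pauliGates], ?_⟩
      simp only [Cliff.phase, Local.phase]
      revert hi
      cases ℓ.1 i <;> cases ℓ'.1 i <;> simp
    · refine ⟨.loc .X i, by simp [pauliGates], ?_⟩
      simp only [Cliff.phase, Local.phase]
      revert hi
      cases ℓ.2 i <;> cases ℓ'.2 i <;> simp

/-- The weight of the Bell state with label `ℓ` in the pure state `v`. -/
def bellWeight (v : Qubits n × Qubits n → ℂ) (ℓ : Label n) : ℝ :=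
  Complex.normSq (bell ℓ ⬝ᵥ v) / 2 ^ n

/-- A random Pauli operator turns two copies of a state into a mixture of Bell states. -/
lemma twirl_pauliGates_pure (v : Qubits n × Qubits n → ℂ) :
    twirl (pauliGates n) (Matrix.vecMulVec v (star v)) = ∑ ℓ, bellWeight v ℓ • bellProj ℓ := by
  rw [eq_sum_bellCoeff (twirl _ _)]
  simp only [bellCoeff_twirl_pauliGates, ite_smul, zero_smul, Finset.sum_ite_eq, Finset.mem_univ,
    if_true]
  rw [Finset.smul_sum, Finset.smul_sum]
  refine Finset.sum_congr rfl fun ℓ _ => ?_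
  have h1 : star v ⬝ᵥ bell ℓ = (starRingEnd ℂ) (bell ℓ ⬝ᵥ v) := by
    rw [starRingEnd_apply, ← Matrix.star_dotProduct_star, star_bell, dotProduct_comm]
  have h : bellCoeff ℓ ℓ (Matrix.vecMulVec v (star v)) = (Complex.normSq (bell ℓ ⬝ᵥ v) : ℂ) := by
    rw [bellCoeff, Matrix.vecMulVec_mulVec, ← Complex.mul_conj, ← h1]
    simp [dotProduct_smul, mul_comm]
  rw [h, bellProj, star_bell, bellWeight]
  ext p q
  simp only [Matrix.smul_apply, smul_eq_mul, Complex.real_smul]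
  push_cast
  field_simp

lemma bellWeight_nonneg (v : Qubits n × Qubits n → ℂ) (ℓ : Label n) : 0 ≤ bellWeight v ℓ :=
  div_nonneg (Complex.normSq_nonneg _) (by positivity)

lemma sum_bellWeight (v : Qubits n × Qubits n → ℂ) :
    ∑ ℓ, bellWeight v ℓ = ∑ p, Complex.normSq (v p) := by
  have h2 : ((2 : ℂ) ^ n) ≠ 0 := by positivity
  have : ((∑ ℓ, bellWeight v ℓ : ℝ) : ℂ) = ((∑ p, Complex.normSq (v p) : ℝ) : ℂ) := by
    push_cast
    have e : ∀ ℓ : Label n, (bellWeight v ℓ : ℂ) =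
        (∑ p, ∑ q, (v p * (starRingEnd ℂ) (v q)) * (bell ℓ p * bell ℓ q)) / 2 ^ n := by
      intro ℓ
      rw [bellWeight]
      push_cast
      rw [← Complex.mul_conj]
      have hb : ∀ q, (starRingEnd ℂ) (bell ℓ q) = bell ℓ q := fun q => congrFun (star_bell ℓ) q
      simp only [dotProduct, map_sum, map_mul, hb, Finset.sum_mul_sum]
      congr 1
      exact Finset.sum_congr rfl fun p _ => Finset.sum_congr rfl fun q _ => by ring
    simp only [e, ← Finset.sum_div]
    rw [Finset.sum_comm, Finset.sum_congr rfl fun p _ => Finset.sum_comm]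
    simp only [← Finset.mul_sum, sum_bell_mul_bell, mul_ite, mul_zero, Finset.sum_ite_eq,
      Finset.mem_univ, if_true, ← Finset.sum_mul, Complex.mul_conj]
    field_simp
  exact_mod_cast this

/-- The sign `(-1) ^ (r · w)`. -/
def sgn (r w : Qubits n) : ℤ := ∏ i, if r i && w i then -1 else 1

lemma bellSite_swap (w r u v : Bool) :
    bellSite w r v u = (if r && w then -1 else 1) * bellSite w r u v := by
  revert w r u v
  decide

/-- Bell states are symmetric or antisymmetric under the exchange of the copies. -/
lemma bell_swap (ℓ : Label n) (u v : Qubits n) :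
    bell ℓ (v, u) = (sgn ℓ.2 ℓ.1 : ℂ) * bell ℓ (u, v) := by
  rw [bell, bell, sgn, ← Int.cast_mul, ← Finset.prod_mul_distrib]
  congr 1
  exact Finset.prod_congr rfl fun i _ => bellSite_swap _ _ _ _

lemma sgn_eq_one_or (r w : Qubits n) : sgn r w = 1 ∨ sgn r w = -1 := by
  refine Finset.prod_induction _ (fun z : ℤ => z = 1 ∨ z = -1) ?_ (Or.inl rfl) ?_
  · rintro a b (rfl | rfl) (rfl | rfl) <;> simp
  · intro i _
    split_ifs <;> simp

/-- Two copies of a pure state have no antisymmetric component. -/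
lemma bellWeight_eq_zero (ψ : Qubits n → ℂ) (ℓ : Label n) (h : sgn ℓ.2 ℓ.1 ≠ 1) :
    bellWeight (fun p => ψ p.1 * ψ p.2) ℓ = 0 := by
  have h' : sgn ℓ.2 ℓ.1 = -1 := (sgn_eq_one_or _ _).resolve_left h
  have e : bell ℓ ⬝ᵥ (fun p => ψ p.1 * ψ p.2) = -(bell ℓ ⬝ᵥ fun p => ψ p.1 * ψ p.2) := by
    conv_lhs => rw [dotProduct, ← (Equiv.prodComm _ _).sum_comp]
    rw [dotProduct, ← Finset.sum_neg_distrib]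
    refine Finset.sum_congr rfl fun p _ => ?_
    obtain ⟨u, v⟩ := p
    simp only [Equiv.prodComm_apply, Prod.swap]
    rw [bell_swap, h']
    push_cast
    ring
  have : bell ℓ ⬝ᵥ (fun p => ψ p.1 * ψ p.2) = 0 := self_eq_neg.1 e
  simp [bellWeight, this]

/-- If a random circuit brings all symmetric Bell states into states with values of `h` in `[a, b]`,
then together with a random Pauli operator it does so for two copies of any pure state. -/
lemma twirl_pure_mem_Icc (gs : List (Cliff n))
    (h : Matrix (Qubits n × Qubits n) (Qubits n × Qubits n) ℂ →ₗ[ℝ] ℝ) (a b : ℝ)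
    (hab : ∀ ℓ : Label n, sgn ℓ.2 ℓ.1 = 1 →
      labelAvg gs (fun ℓ => h (bellProj ℓ)) ℓ ∈ Set.Icc a b)
    (ψ : Qubits n → ℂ) (hψ : ∑ x, Complex.normSq (ψ x) = 1) :
    h (twirl (pauliGates n ++ gs) (Matrix.vecMulVec (fun p => ψ p.1 * ψ p.2)
      (star fun p => ψ p.1 * ψ p.2))) ∈ Set.Icc a b := by
  set v : Qubits n × Qubits n → ℂ := fun p => ψ p.1 * ψ p.2
  have hs : ∑ ℓ, bellWeight v ℓ = 1 := by
    rw [sum_bellWeight, Fintype.sum_prod_type]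
    simp only [v, Complex.normSq_mul, ← Finset.mul_sum, hψ, mul_one]
  rw [twirl_append, twirl_pauliGates_pure, twirl_sum, map_sum]
  simp only [twirl_smul, map_smul, map_twirl_bellProj, smul_eq_mul]
  have key : ∀ ℓ, bellWeight v ℓ * a ≤ bellWeight v ℓ * labelAvg gs (fun ℓ => h (bellProj ℓ)) ℓ ∧
      bellWeight v ℓ * labelAvg gs (fun ℓ => h (bellProj ℓ)) ℓ ≤ bellWeight v ℓ * b := by
    intro ℓ
    by_cases hℓ : sgn ℓ.2 ℓ.1 = 1
    · exact ⟨mul_le_mul_of_nonneg_left (hab ℓ hℓ).1 (bellWeight_nonneg v ℓ),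
        mul_le_mul_of_nonneg_left (hab ℓ hℓ).2 (bellWeight_nonneg v ℓ)⟩
    · simp [v, bellWeight_eq_zero ψ ℓ hℓ]
  constructor
  · calc a = ∑ ℓ, bellWeight v ℓ * a := by rw [← Finset.sum_mul, hs, one_mul]
      _ ≤ _ := Finset.sum_le_sum fun ℓ _ => (key ℓ).1
  · calc _ ≤ ∑ ℓ, bellWeight v ℓ * b := Finset.sum_le_sum fun ℓ _ => (key ℓ).2
      _ = b := by rw [← Finset.sum_mul, hs, one_mul]

end PureStates

/-! ### Orthogonal complements in the space of bit strings -/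

section Perp

variable {n : ℕ}

lemma sgn_comm (r w : Qubits n) : sgn r w = sgn w r :=
  Finset.prod_congr rfl fun i _ => by rw [Bool.and_comm]

/-- Bitwise exclusive or. -/
def bxor (u v : Qubits n) : Qubits n := fun k => xor (u k) (v k)

/-- The bit string with the bit `a` at position `i`, and zeros elsewhere. -/
def delta (i : Fin n) (a : Bool) : Qubits n := fun k => if k = i then a else false

lemma bxor_bxor_cancel (u v : Qubits n) : bxor (bxor u v) v = u := by
  funext k; simp [bxor]

lemma bxor_right_comm (u v w : Qubits n) : bxor (bxor u v) w = bxor (bxor u w) v := by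
  funext k
  simp only [bxor]
  cases u k <;> cases v k <;> cases w k <;> rfl

lemma bxor_assoc (u v w : Qubits n) : bxor (bxor u v) w = bxor u (bxor v w) := by
  funext k
  simp only [bxor]
  cases u k <;> cases v k <;> cases w k <;> rfl

lemma sgn_bxor (u v w : Qubits n) : sgn (bxor u v) w = sgn u w * sgn v w := by
  rw [sgn, sgn, sgn, ← Finset.prod_mul_distrib]
  refine Finset.prod_congr rfl fun i _ => ?_
  have : ∀ a b c : Bool, (if (xor a b) && c then (-1 : ℤ) else 1) =
      (if a && c then -1 else 1) * if b && c then -1 else 1 := by decide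
  exact this _ _ _

lemma sgn_delta (i : Fin n) (a : Bool) (w : Qubits n) :
    sgn (delta i a) w = if a && w i then -1 else 1 := by
  rw [sgn, Finset.prod_eq_single i]
  · simp [delta]
  · intro j _ hj; simp [delta, hj]
  · simp

/-- The strings `r` with `r · w = 0`. -/
def perp (w : Qubits n) : Finset (Qubits n) := Finset.univ.filter fun r => sgn r w = 1

lemma mem_perp {w r : Qubits n} : r ∈ perp w ↔ sgn r w = 1 := by simp [perp]

/-- The average of `h` over the strings orthogonal to `w`. -/
def perpAvg (w : Qubits n) (h : Qubits n → ℝ) : ℝ := (∑ r ∈ perp w, h r) / (perp w).card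

lemma sum_prod_nonneg (f : Fin n → Bool → ℝ) (h : ∀ i, 0 ≤ ∑ a, f i a) :
    0 ≤ ∑ x : Qubits n, ∏ i, f i (x i) := by
  rw [sum_prod_bool]
  exact Finset.prod_nonneg fun i _ => h i

lemma sum_sgn_nonneg (w : Qubits n) : 0 ≤ ∑ r, (sgn r w : ℝ) := by
  have := sum_prod_nonneg (fun i a => ((if a && w i then -1 else 1 : ℤ) : ℝ)) fun i => by
    cases w i <;> simp
  simpa [sgn] using this

lemma sum_sgn_mul_sgn_nonneg (z r : Qubits n) : 0 ≤ ∑ w, (sgn w z : ℝ) * sgn r w := by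
  have := sum_prod_nonneg (fun i a => ((if a && z i then -1 else 1 : ℤ) : ℝ) *
    ((if r i && a then -1 else 1 : ℤ) : ℝ)) fun i => by
      cases z i <;> cases r i <;> simp
  simp only [Finset.prod_mul_distrib] at this
  simpa [sgn] using this

/-- The indicator of orthogonality. -/
lemma ite_sgn (r w : Qubits n) :
    (if sgn r w = 1 then (1 : ℝ) else 0) = (1 + sgn r w) / 2 := by
  rcases sgn_eq_one_or r w with h | h <;> rw [h] <;> norm_num

lemma card_perp (w : Qubits n) : ((perp w).card : ℝ) = ∑ r, (1 + (sgn r w : ℝ)) / 2 := by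
  rw [perp, Finset.card_filter]
  push_cast
  exact Finset.sum_congr rfl fun r _ => ite_sgn r w

lemma sum_one_qubits : ∑ _r : Qubits n, (1 : ℝ) = 2 ^ n := by simp

lemma card_perp_ge (w : Qubits n) : (2 : ℝ) ^ n / 2 ≤ (perp w).card := by
  rw [card_perp, ← Finset.sum_div, Finset.sum_add_distrib, sum_one_qubits]
  have := sum_sgn_nonneg w
  linarith

lemma card_perp_pos (w : Qubits n) : (0 : ℝ) < (perp w).card :=
  lt_of_lt_of_le (by positivity) (card_perp_ge w)

lemma card_perp_le (w : Qubits n) : ((perp w).card : ℝ) ≤ 2 ^ n := by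
  have h : (perp w).card ≤ (Finset.univ : Finset (Qubits n)).card := Finset.card_le_univ _
  have h2 : (Finset.univ : Finset (Qubits n)).card = 2 ^ n := by simp
  rw [h2] at h
  exact_mod_cast h

lemma perpAvg_mono {w : Qubits n} {h h' : Qubits n → ℝ} (H : ∀ r ∈ perp w, h r ≤ h' r) :
    perpAvg w h ≤ perpAvg w h' :=
  div_le_div_of_nonneg_right (Finset.sum_le_sum H) (card_perp_pos w).le

lemma perpAvg_const (w : Qubits n) (a : ℝ) : perpAvg w (fun _ => a) = a := by
  rw [perpAvg, Finset.sum_const, nsmul_eq_mul]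
  field_simp [(card_perp_pos w).ne']

lemma perpAvg_add (w : Qubits n) (h h' : Qubits n → ℝ) :
    perpAvg w (fun r => h r + h' r) = perpAvg w h + perpAvg w h' := by
  rw [perpAvg, Finset.sum_add_distrib, add_div, perpAvg, perpAvg]

lemma perpAvg_sub (w : Qubits n) (h h' : Qubits n → ℝ) :
    perpAvg w (fun r => h r - h' r) = perpAvg w h - perpAvg w h' := by
  rw [perpAvg, Finset.sum_sub_distrib, sub_div, perpAvg, perpAvg]

lemma perpAvg_mul (w : Qubits n) (a : ℝ) (h : Qubits n → ℝ) :
    perpAvg w (fun r => a * h r) = a * perpAvg w h := by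
  rw [perpAvg, ← Finset.mul_sum, mul_div_assoc, perpAvg]

lemma perpAvg_mem_Icc {w : Qubits n} {h : Qubits n → ℝ} {a b : ℝ}
    (H : ∀ r, h r ∈ Set.Icc a b) : perpAvg w h ∈ Set.Icc a b := by
  constructor
  · rw [← perpAvg_const w a]; exact perpAvg_mono fun r _ => (H r).1
  · rw [← perpAvg_const w b]; exact perpAvg_mono fun r _ => (H r).2

lemma perpAvg_le_two_mul {w : Qubits n} {h : Qubits n → ℝ} (H : ∀ r, 0 ≤ h r) :
    perpAvg w h ≤ 2 * ((∑ r, h r) / 2 ^ n) := by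
  have h1 : ∑ r ∈ perp w, h r ≤ ∑ r, h r :=
    Finset.sum_le_sum_of_subset_of_nonneg (Finset.subset_univ _) fun r _ _ => H r
  have h2 : (0 : ℝ) < 2 ^ n := by positivity
  have h3 := card_perp_ge w
  rw [perpAvg, div_le_iff₀ (card_perp_pos w)]
  have h4 : 0 ≤ (∑ r, h r) / 2 ^ n := div_nonneg (Finset.sum_nonneg fun r _ => H r) h2.le
  calc _ ≤ ∑ r, h r := h1
    _ = 2 * ((∑ r, h r) / 2 ^ n) * (2 ^ n / 2) := by field_simp
    _ ≤ _ := mul_le_mul_of_nonneg_left h3 (by linarith)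

/-- Doeblin's condition: two steps of the walk that moves from `z` to a random string orthogonal to
`z` dominate half of the uniform distribution. -/
lemma half_avg_le_perpAvg_perpAvg (z : Qubits n) {F : Qubits n → ℝ} (hF : ∀ r, 0 ≤ F r) :
    (1 / 2) * ((∑ r, F r) / 2 ^ n) ≤ perpAvg z fun w => perpAvg w F := by
  have h2 : (0 : ℝ) < 2 ^ n := by positivity
  have h1 : ∀ w, (∑ r, F r * ((1 + (sgn r w : ℝ)) / 2)) / 2 ^ n ≤ perpAvg w F := by
    intro w
    have e : ∑ r, F r * ((1 + (sgn r w : ℝ)) / 2) = ∑ r ∈ perp w, F r := by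
      rw [perp, Finset.sum_filter]
      refine Finset.sum_congr rfl fun r _ => ?_
      rw [← ite_sgn]
      split_ifs <;> simp
    rw [e, perpAvg]
    exact div_le_div_of_nonneg_left (Finset.sum_nonneg fun r _ => hF r) (card_perp_pos w)
      (card_perp_le w)
  refine le_trans ?_ (perpAvg_mono fun w _ => h1 w)
  rw [perpAvg, le_div_iff₀ (card_perp_pos z), ← Finset.sum_div, Finset.sum_comm]
  simp only [← Finset.mul_sum]
  rw [← mul_div_assoc, div_mul_eq_mul_div]
  refine div_le_div_of_nonneg_right ?_ h2.le
  rw [mul_assoc, mul_comm (1 / 2 : ℝ), mul_assoc, Finset.sum_mul]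
  refine Finset.sum_le_sum fun r _ => mul_le_mul_of_nonneg_left ?_ (hF r)
  have e : ∑ w ∈ perp z, (1 + (sgn r w : ℝ)) / 2 =
      ∑ w, ((1 + (sgn w z : ℝ)) / 2) * ((1 + (sgn r w : ℝ)) / 2) := by
    rw [perp, Finset.sum_filter]
    refine Finset.sum_congr rfl fun w _ => ?_
    rw [← ite_sgn w z]
    split_ifs <;> simp
  have e2 : ∑ w, ((1 + (sgn w z : ℝ)) / 2) * ((1 + (sgn r w : ℝ)) / 2) =
      (1 / 2) * ∑ w, (1 + (sgn w z : ℝ)) / 2 + (1 / 4) * ∑ w, (sgn w r : ℝ) +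
        (1 / 4) * ∑ w, (sgn w z : ℝ) * sgn r w := by
    rw [Finset.mul_sum, Finset.mul_sum, Finset.mul_sum, ← Finset.sum_add_distrib,
      ← Finset.sum_add_distrib]
    refine Finset.sum_congr rfl fun w _ => ?_
    rw [sgn_comm w r]
    ring
  rw [e, e2, card_perp]
  have := sum_sgn_nonneg r
  have := sum_sgn_mul_sgn_nonneg z r
  linarith

/-- Two steps of the walk halve the oscillation. -/
lemma exists_Icc_perpAvg_perpAvg {F : Qubits n → ℝ} {a b : ℝ} (H : ∀ r, F r ∈ Set.Icc a b) :
    ∃ a' b', b' - a' = (b - a) / 2 ∧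
      ∀ z, (perpAvg z fun w => perpAvg w F) ∈ Set.Icc a' b' := by
  have h2 : (0 : ℝ) < 2 ^ n := by positivity
  set m : ℝ := (∑ r, F r) / 2 ^ n with hm
  refine ⟨m / 2 + a / 2, m / 2 + b / 2, by ring, fun z => ⟨?_, ?_⟩⟩
  · have := half_avg_le_perpAvg_perpAvg z (F := fun r => F r - a) fun r => sub_nonneg.2 (H r).1
    simp only [perpAvg_sub, perpAvg_const, Finset.sum_sub_distrib, sub_div] at this
    have e : (∑ _r : Qubits n, a) / 2 ^ n = a := by
      rw [Finset.sum_const, nsmul_eq_mul]; simp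
    rw [e] at this
    linarith
  · have := half_avg_le_perpAvg_perpAvg z (F := fun r => b - F r) fun r => sub_nonneg.2 (H r).2
    simp only [perpAvg_sub, perpAvg_const, Finset.sum_sub_distrib, sub_div] at this
    have e : (∑ _r : Qubits n, b) / 2 ^ n = b := by
      rw [Finset.sum_const, nsmul_eq_mul]; simp
    rw [e] at this
    linarith

end Perp

/-! ### Strings without long gaps -/

section Gaps

variable {n : ℕ}

/-- Every window of `K` consecutive positions contains a one. -/
def GapFree (K : ℕ) (w : Qubits n) : Prop :=
  ∀ a, a + K ≤ n → ∃ i : Fin n, a ≤ i ∧ i < a + K ∧ w i = true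

open Classical in
/-- The indicator of the strings with a gap of length `K`. -/
def gapInd (K : ℕ) (w : Qubits n) : ℝ := if GapFree K w then 0 else 1

lemma gapInd_nonneg (K : ℕ) (w : Qubits n) : 0 ≤ gapInd K w := by
  unfold gapInd; split_ifs <;> norm_num

/-- The indicator, in product form, of the strings that vanish on the positions `a, …, a + K - 1`. -/
def windowInd (a K : ℕ) (i : Fin n) (x : Bool) : ℝ :=
  if a ≤ i ∧ i < a + K then (if x then 0 else 1) else 1

/-- Union bound over the positions of a gap. -/
lemma gapInd_le (K : ℕ) (hK : 0 < K) (w : Qubits n) :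
    gapInd K w ≤ ∑ a ∈ (Finset.range n).filter (fun a => a + K ≤ n), ∏ i, windowInd a K i (w i) := by
  have hnn : ∀ a, 0 ≤ ∏ i, windowInd a K i (w i) := fun a => Finset.prod_nonneg fun i _ => by
    unfold windowInd; split_ifs <;> norm_num
  unfold gapInd
  split_ifs with h
  · exact Finset.sum_nonneg fun a _ => hnn a
  · simp only [GapFree] at h
    push Not at h
    obtain ⟨a, ha, h⟩ := h
    have hm : a ∈ (Finset.range n).filter (fun a => a + K ≤ n) := by
      simp only [Finset.mem_filter, Finset.mem_range]; omega
    refine le_trans ?_ (Finset.single_le_sum (fun a _ => hnn a) hm)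
    rw [Finset.prod_eq_one]
    intro i _
    unfold windowInd
    split_ifs with h1 h2
    · exact absurd h2 (h i h1.1 h1.2)
    · rfl
    · rfl

/-- The value `c` at each position of a window of length `K`. -/
lemma prod_window (a K : ℕ) (h : a + K ≤ n) (c : ℝ) :
    ∏ i : Fin n, (if a ≤ (i : ℕ) ∧ (i : ℕ) < a + K then c else 1) = c ^ K := by
  rw [Fin.prod_univ_eq_prod_range (fun i => if a ≤ i ∧ i < a + K then c else 1) n,
    Finset.prod_ite, Finset.prod_const, Finset.prod_const_one, mul_one]
  have : (Finset.range n).filter (fun i => a ≤ i ∧ i < a + K) = Finset.Ico a (a + K) := by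
    ext i; simp only [Finset.mem_filter, Finset.mem_range, Finset.mem_Ico]; omega
  rw [this, Nat.card_Ico]
  congr 1
  omega

lemma sum_range_filter_le (K : ℕ) (f : ℕ → ℝ) (c : ℝ) (hc : 0 ≤ c) (h : ∀ a, a + K ≤ n → f a ≤ c) :
    ∑ a ∈ (Finset.range n).filter (fun a => a + K ≤ n), f a ≤ n * c := by
  calc _ ≤ ∑ a ∈ (Finset.range n).filter (fun a => a + K ≤ n), c :=
        Finset.sum_le_sum fun a ha => h a (Finset.mem_filter.1 ha).2
    _ = ((Finset.range n).filter (fun a => a + K ≤ n)).card * c := by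
        rw [Finset.sum_const, nsmul_eq_mul]
    _ ≤ n * c := by
        refine mul_le_mul_of_nonneg_right ?_ hc
        have := Finset.card_filter_le (Finset.range n) (fun a => a + K ≤ n)
        rw [Finset.card_range] at this
        exact_mod_cast this

lemma sum_gapInd_le (K : ℕ) (hK : 0 < K) :
    (∑ w : Qubits n, gapInd K w) / 2 ^ n ≤ n * (1 / 2) ^ K := by
  have h2 : (0 : ℝ) < 2 ^ n := by positivity
  rw [div_le_iff₀ h2]
  refine (Finset.sum_le_sum fun w _ => gapInd_le K hK w).trans ?_
  rw [Finset.sum_comm, mul_assoc]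
  refine sum_range_filter_le K _ _ (by positivity) fun a ha => ?_
  rw [sum_prod_bool, ← prod_window a K ha]
  have : (2 : ℝ) ^ n = ∏ _i : Fin n, (2 : ℝ) := by simp
  rw [this, ← Finset.prod_mul_distrib]
  refine le_of_eq (Finset.prod_congr rfl fun i _ => ?_)
  unfold windowInd
  split_ifs <;> norm_num

lemma perpAvg_gapInd_le (K : ℕ) (hK : 0 < K) (w : Qubits n) :
    perpAvg w (gapInd K) ≤ 2 * (n * (1 / 2) ^ K) :=
  (perpAvg_le_two_mul (gapInd_nonneg K)).trans
    (mul_le_mul_of_nonneg_left (sum_gapInd_le K hK) (by norm_num))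

/-- A function of strings that is invariant under flips of bits outside the support of `w` and under
flips of two bits of the support with distance at most `K` only depends on `r · w`, if `w` has no
gaps of length `K`. -/
lemma eq_of_flip_invariant {w : Qubits n} {K : ℕ} (hw : GapFree K w) (G : Qubits n → ℝ)
    (h1 : ∀ i, w i = false → ∀ r, G (bxor r (delta i true)) = G r)
    (h2 : ∀ i j : Fin n, w i = true → w j = true → i < j → (j : ℕ) ≤ i + K →
      ∀ r, G (bxor r (bxor (delta i true) (delta j true))) = G r)
    {r r' : Qubits n} (h : sgn r w = sgn r' w) : G r = G r' := by
  -- distant positions of the support are connected by steps of length at most `K`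
  have h3 : ∀ d : ℕ, ∀ i j : Fin n, w i = true → w j = true → i < j → (j : ℕ) ≤ i + d →
      ∀ r, G (bxor r (bxor (delta i true) (delta j true))) = G r := by
    intro d
    induction d with
    | zero =>
      intro i j _ _ hij hd
      exact absurd (show (i : ℕ) < j from hij) (by omega)
    | succ d ih =>
      intro i j hi hj hij hd r
      by_cases hK : (j : ℕ) ≤ i + K
      · exact h2 i j hi hj hij hK r
      · obtain ⟨l, hl1, hl2, hl⟩ := hw (i + 1) (by have := j.2; omega)
        have hil : i < l := by rw [Fin.lt_def]; omega
        have hlj : l < j := by rw [Fin.lt_def]; omega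
        have e : bxor r (bxor (delta i true) (delta j true)) =
            bxor (bxor r (bxor (delta i true) (delta l true)))
              (bxor (delta l true) (delta j true)) := by
          funext k
          simp only [bxor]
          cases r k <;> cases delta i true k <;> cases delta j true k <;> cases delta l true k <;>
            rfl
        rw [e, ih l j hl hj hlj (by omega), h2 i l hi hl hil (by omega)]
  have h4 : ∀ i j : Fin n, w i = true → w j = true → i ≠ j →
      ∀ r, G (bxor r (bxor (delta i true) (delta j true))) = G r := by
    intro i j hi hj hij r
    rcases lt_or_gt_of_ne hij with hl | hl
    · exact h3 j i j hi hj hl (by omega) r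
    · have e : bxor (delta i true) (delta j true) = bxor (delta j true) (delta i true) := by
        funext k; exact Bool.xor_comm _ _
      rw [e]
      exact h3 i j i hj hi hl (by omega) r
  have flipped : ∀ (r : Qubits n) (i k : Fin n),
      bxor r (delta i true) k = if k = i then !r k else r k := by
    intro r i k
    by_cases hk : k = i <;> simp [bxor, delta, hk]
  -- each flip reduces the number of positions at which `r` and `r'` differ
  generalize hN : (Finset.univ.filter fun i => r i ≠ r' i).card = N
  induction N using Nat.strong_induction_on generalizing r with
  | _ N ih =>
    by_cases h0 : ∀ i, r i = r' i
    · rw [funext h0]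
    push Not at h0
    obtain ⟨i, hi⟩ := h0
    have hmem : i ∈ Finset.univ.filter fun i => r i ≠ r' i := by simpa using hi
    cases hwi : w i with
    | false =>
      rw [← h1 i hwi r]
      refine ih _ ?_ ?_ rfl
      · rw [← hN]
        refine Finset.card_lt_card ⟨fun k hk => ?_, fun hc => ?_⟩
        · simp only [Finset.mem_filter, Finset.mem_univ, true_and, flipped] at hk ⊢
          by_cases hki : k = i
          · rw [hki]; exact hi
          · simpa [hki] using hk
        · have := hc hmem
          simp only [Finset.mem_filter, Finset.mem_univ, true_and, flipped, if_true] at this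
          revert hi this
          cases r i <;> cases r' i <;> simp
      · rw [sgn_bxor, sgn_delta, hwi, h]; simp
    | true =>
      -- a single difference in the support would change the sign
      obtain ⟨j, hij, hj⟩ : ∃ j, j ≠ i ∧ r j ≠ r' j := by
        by_contra! hc
        have e : r' = bxor r (delta i true) := by
          funext k
          rw [flipped]
          split_ifs with hk
          · subst hk
            revert hi
            cases r k <;> cases r' k <;> simp
          · exact (hc k hk).symm
        rw [e, sgn_bxor, sgn_delta, hwi] at h
        rcases sgn_eq_one_or r w with h' | h' <;> rw [h'] at h <;> simp at h
      cases hwj : w j with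
      | false =>
        rw [← h1 j hwj r]
        refine ih _ ?_ ?_ rfl
        · rw [← hN]
          refine Finset.card_lt_card ⟨fun k hk => ?_, fun hc => ?_⟩
          · simp only [Finset.mem_filter, Finset.mem_univ, true_and, flipped] at hk ⊢
            by_cases hki : k = j
            · rw [hki]; exact hj
            · simpa [hki] using hk
          · have := hc (show j ∈ Finset.univ.filter fun i => r i ≠ r' i by simpa using hj)
            simp only [Finset.mem_filter, Finset.mem_univ, true_and, flipped, if_true] at this
            revert hj this
            cases r j <;> cases r' j <;> simp
        · rw [sgn_bxor, sgn_delta, hwj, h]; simp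
      | true =>
        rw [← h4 i j hwi hwj hij.symm r]
        refine ih _ ?_ ?_ rfl
        · rw [← hN, ← bxor_assoc]
          refine Finset.card_lt_card ⟨fun k hk => ?_, fun hc => ?_⟩
          · simp only [Finset.mem_filter, Finset.mem_univ, true_and, flipped] at hk ⊢
            by_cases hki : k = i
            · rw [hki]; exact hi
            by_cases hkj : k = j
            · rw [hkj]; exact hj
            · simpa [hki, hkj] using hk
          · have := hc hmem
            simp only [Finset.mem_filter, Finset.mem_univ, true_and, flipped, hij.symm, if_true,
              if_false] at this
            revert hi this
            cases r i <;> cases r' i <;> simp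
        · rw [sgn_bxor, sgn_bxor, sgn_delta, sgn_delta, hwi, hwj, h]; simp

end Gaps

/-! ### The twirling circuit and its action on Bell labels -/

/-- The layers of the twirling circuit: the same single-qubit gate on every qubit, or controlled
phase flips on the pairs `(i, i + t)` with `i / t` of parity `p`, which are disjoint. -/
inductive LayerKind : Type
  | loc (k : Local)
  | cz (t p : ℕ)

/-- The gates of a layer. -/
def LayerKind.gates (n : ℕ) : LayerKind → List (Cliff n)
  | .loc k => (List.finRange n).map (.loc k)
  | .cz t p => (List.finRange n).filterMap fun i =>
      if h : i.1 + t < n ∧ 0 < t ∧ i.1 / t % 2 = p then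
        some (.cz i ⟨i.1 + t, h.1⟩ fun e => by have := congrArg Fin.val e; simp at this; omega)
      else none

/-- The layers of a random diagonal unitary: phase gates, and controlled phase flips on all pairs of
qubits with distance at most `K`. -/
def diagKinds (K : ℕ) : List LayerKind :=
  .loc .S :: (List.range K).flatMap fun t => [.cz (t + 1) 0, .cz (t + 1) 1]

/-- Random diagonal unitaries, alternating with `R` layers of Hadamard gates. -/
def mixKinds (K : ℕ) : ℕ → List LayerKind
  | 0 => diagKinds K
  | R + 1 => diagKinds K ++ .loc .H :: mixKinds K R

/-- Layers that apply an independent random single-qubit unitary to each qubit. -/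
def spreadKinds : List LayerKind := [.loc .S, .loc .H, .loc .S, .loc .H]

/-- All gates of a list of layers. -/
def gatesOf (n : ℕ) (ks : List LayerKind) : List (Cliff n) := ks.flatMap (LayerKind.gates n)

section Circuits

variable {n : ℕ}

lemma gatesOf_append (ks ks' : List LayerKind) :
    gatesOf n (ks ++ ks') = gatesOf n ks ++ gatesOf n ks' := List.flatMap_append

lemma gatesOf_cons (k : LayerKind) (ks : List LayerKind) :
    gatesOf n (k :: ks) = k.gates n ++ gatesOf n ks := List.flatMap_cons

/-- The diagonal gates. -/
def Cliff.IsDiag : Cliff n → Prop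
  | .loc .S _ => True
  | .cz _ _ _ => True
  | _ => False

/-- The string that a diagonal gate adds to the second component of a label `(w, r)`. -/
def Cliff.shift : Cliff n → Qubits n → Qubits n
  | .loc _ i, w => delta i !w i
  | .cz i j _, w => bxor (delta i (w j)) (delta j (w i))

lemma Cliff.IsDiag.act_eq {g : Cliff n} (hg : g.IsDiag) (ℓ : Label n) :
    g.act ℓ = (ℓ.1, bxor ℓ.2 (g.shift ℓ.1)) := by
  cases g with
  | loc k i =>
    cases k <;> try exact hg.elim
    refine Prod.ext (by simp [Cliff.act, Local.act]) (funext fun m => ?_)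
    by_cases hm : m = i
    · subst hm; simp [Cliff.act, Local.act, bxor, Cliff.shift, delta]
    · simp [Cliff.act, bxor, Cliff.shift, delta, hm]
  | cz i j h =>
    refine Prod.ext rfl (funext fun m => ?_)
    by_cases hi : m = i
    · subst hi; simp [Cliff.act, bxor, Cliff.shift, delta, h]
    · by_cases hj : m = j
      · subst hj; simp [Cliff.act, bxor, Cliff.shift, delta, hi]
      · simp [Cliff.act, bxor, Cliff.shift, delta, hi, hj]

lemma Cliff.IsDiag.isRandom {g : Cliff n} (hg : g.IsDiag) : g.isRandom = true := by
  cases g with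
  | loc k i => cases k <;> first | rfl | exact hg.elim
  | cz i j h => rfl

lemma Cliff.IsDiag.sgn_shift {g : Cliff n} (hg : g.IsDiag) (w : Qubits n) :
    sgn (g.shift w) w = 1 := by
  cases g with
  | loc k i => simp only [Cliff.shift, sgn_delta]; cases w i <;> simp
  | cz i j h =>
    simp only [Cliff.shift, sgn_bxor, sgn_delta]
    cases w i <;> cases w j <;> simp

/-- Diagonal gates and Hadamard gates preserve the symmetry of a Bell state. -/
lemma Cliff.sgn_act {g : Cliff n} (hg : g.IsDiag ∨ ∃ i, g = .loc .H i) (ℓ : Label n) :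
    sgn (g.act ℓ).2 (g.act ℓ).1 = sgn ℓ.2 ℓ.1 := by
  rcases hg with hg | ⟨i, rfl⟩
  · rw [hg.act_eq, sgn_bxor, hg.sgn_shift, mul_one]
  · refine Finset.prod_congr rfl fun j _ => ?_
    by_cases hj : j = i
    · subst hj; simp [Cliff.act, Local.act, and_comm]
    · simp [Cliff.act, hj]

/-- Monotonicity of averages, where functions are compared on symmetric labels only. -/
lemma labelAvg_mono_on {gs : List (Cliff n)} (hgs : ∀ g ∈ gs, g.IsDiag ∨ ∃ i, g = .loc .H i)
    {F F' : Label n → ℝ} (h : ∀ ℓ : Label n, sgn ℓ.2 ℓ.1 = 1 → F ℓ ≤ F' ℓ) (ℓ : Label n)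
    (hℓ : sgn ℓ.2 ℓ.1 = 1) : labelAvg gs F ℓ ≤ labelAvg gs F' ℓ := by
  induction gs generalizing ℓ with
  | nil => exact h ℓ hℓ
  | cons g gs ih =>
    have hg := Cliff.sgn_act (hgs g List.mem_cons_self) ℓ
    have ih' := ih fun g hm => hgs g (List.mem_cons_of_mem _ hm)
    have h1 := ih' ℓ hℓ
    have h2 := ih' (g.act ℓ) (hg.trans hℓ)
    simp only [labelAvg]
    split_ifs
    · linarith
    · exact h2

lemma labelAvg_mono (gs : List (Cliff n)) {F F' : Label n → ℝ} (h : ∀ ℓ, F ℓ ≤ F' ℓ)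
    (ℓ : Label n) : labelAvg gs F ℓ ≤ labelAvg gs F' ℓ := by
  induction gs generalizing ℓ with
  | nil => exact h ℓ
  | cons g gs ih =>
    have h1 := ih ℓ
    have h2 := ih (g.act ℓ)
    simp only [labelAvg]
    split_ifs
    · linarith
    · exact h2

lemma labelAvg_const (gs : List (Cliff n)) (a : ℝ) (ℓ : Label n) :
    labelAvg gs (fun _ => a) ℓ = a := by
  induction gs generalizing ℓ with
  | nil => rfl
  | cons g gs ih => simp only [labelAvg, ih]; split_ifs <;> ring

lemma labelAvg_add (gs : List (Cliff n)) (F F' : Label n → ℝ) (ℓ : Label n) :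
    labelAvg gs (fun ℓ => F ℓ + F' ℓ) ℓ = labelAvg gs F ℓ + labelAvg gs F' ℓ := by
  induction gs generalizing ℓ with
  | nil => rfl
  | cons g gs ih => simp only [labelAvg, ih]; split_ifs <;> ring

lemma labelAvg_mul (gs : List (Cliff n)) (a : ℝ) (F : Label n → ℝ) (ℓ : Label n) :
    labelAvg gs (fun ℓ => a * F ℓ) ℓ = a * labelAvg gs F ℓ := by
  induction gs generalizing ℓ with
  | nil => rfl
  | cons g gs ih => simp only [labelAvg, ih]; split_ifs <;> ring

lemma labelAvg_sum {ι : Type} (s : Finset ι) (gs : List (Cliff n)) (F : ι → Label n → ℝ)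
    (ℓ : Label n) : labelAvg gs (fun ℓ => ∑ a ∈ s, F a ℓ) ℓ = ∑ a ∈ s, labelAvg gs (F a) ℓ := by
  classical
  induction s using Finset.induction_on with
  | empty => simp [labelAvg_const]
  | insert a s ha ih => simp [Finset.sum_insert ha, labelAvg_add, ih]

lemma labelAvg_mem_Icc (gs : List (Cliff n)) {F : Label n → ℝ} {a b : ℝ}
    (h : ∀ ℓ, F ℓ ∈ Set.Icc a b) (ℓ : Label n) : labelAvg gs F ℓ ∈ Set.Icc a b := by
  constructor
  · rw [← labelAvg_const gs a ℓ]; exact labelAvg_mono gs (fun ℓ => (h ℓ).1) ℓ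
  · rw [← labelAvg_const gs b ℓ]; exact labelAvg_mono gs (fun ℓ => (h ℓ).2) ℓ

lemma Cliff.IsDiag.act_act {g : Cliff n} (hg : g.IsDiag) (ℓ : Label n) : g.act (g.act ℓ) = ℓ := by
  simp only [hg.act_eq, bxor_bxor_cancel]

lemma Cliff.IsDiag.act_comm {g h : Cliff n} (hg : g.IsDiag) (hh : h.IsDiag) (ℓ : Label n) :
    g.act (h.act ℓ) = h.act (g.act ℓ) := by
  simp only [hg.act_eq, hh.act_eq]
  rw [bxor_right_comm]

/-- Averages over random diagonal gates are invariant under each of the gates. -/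
lemma labelAvg_act_of_mem {gs : List (Cliff n)} (hgs : ∀ g ∈ gs, g.IsDiag) {h : Cliff n}
    (hh : h ∈ gs) (F : Label n → ℝ) (ℓ : Label n) :
    labelAvg gs F (h.act ℓ) = labelAvg gs F ℓ := by
  induction gs generalizing ℓ with
  | nil => simp at hh
  | cons g gs ih =>
    have hg := hgs g List.mem_cons_self
    have hgs' := fun g hm => hgs g (List.mem_cons_of_mem _ hm)
    rcases List.mem_cons.1 hh with rfl | hm
    · simp only [labelAvg, hg.isRandom, if_true, hg.act_act]
      ring
    · simp only [labelAvg, hg.act_comm (hgs' h hm), ih hgs' hm]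

/-- Random diagonal gates preserve averages over all symmetric labels with given first component. -/
lemma perpAvg_labelAvg {gs : List (Cliff n)} (hgs : ∀ g ∈ gs, g.IsDiag) (F : Label n → ℝ)
    (w : Qubits n) : perpAvg w (fun r => labelAvg gs F (w, r)) = perpAvg w fun r => F (w, r) := by
  induction gs with
  | nil => rfl
  | cons g gs ih =>
    have hg := hgs g List.mem_cons_self
    have ih' := ih fun g hm => hgs g (List.mem_cons_of_mem _ hm)
    have e : perpAvg w (fun r => labelAvg gs F (g.act (w, r))) =
        perpAvg w fun r => labelAvg gs F (w, r) := by
      rw [perpAvg, perpAvg]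
      congr 1
      have hm : ∀ r ∈ perp w, bxor r (g.shift w) ∈ perp w := fun r hr => by
        rw [mem_perp] at hr ⊢
        rw [sgn_bxor, hr, hg.sgn_shift, mul_one]
      refine Finset.sum_nbij' (fun r => bxor r (g.shift w)) (fun r => bxor r (g.shift w)) hm hm
        (fun r _ => bxor_bxor_cancel _ _) (fun r _ => bxor_bxor_cancel _ _) fun r _ => ?_
      rw [hg.act_eq]
    simp only [labelAvg, hg.isRandom, if_true]
    rw [perpAvg_mul, perpAvg_add, e, ih']
    ring

lemma isDiag_of_mem_diagKinds {K : ℕ} : ∀ g ∈ gatesOf n (diagKinds K), g.IsDiag := by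
  intro g hg
  rw [diagKinds, gatesOf_cons, List.mem_append] at hg
  rcases hg with hg | hg
  · obtain ⟨i, -, rfl⟩ := List.mem_map.1 hg
    trivial
  · rw [gatesOf, List.mem_flatMap] at hg
    obtain ⟨k, hk, hg⟩ := hg
    rw [List.mem_flatMap] at hk
    obtain ⟨t, -, hk⟩ := hk
    have hk' : ∃ p, k = .cz (t + 1) p := by
      simp only [List.mem_cons, List.not_mem_nil, or_false] at hk
      rcases hk with rfl | rfl <;> exact ⟨_, rfl⟩
    obtain ⟨p, rfl⟩ := hk'
    rw [LayerKind.gates, List.mem_filterMap] at hg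
    obtain ⟨i, -, hi⟩ := hg
    split_ifs at hi
    cases hi
    trivial

lemma loc_mem_diagKinds (K : ℕ) (i : Fin n) : Cliff.loc .S i ∈ gatesOf n (diagKinds K) := by
  rw [diagKinds, gatesOf_cons, List.mem_append]
  exact Or.inl (List.mem_map.2 ⟨i, List.mem_finRange i, rfl⟩)

/-- Every pair of qubits with distance at most `K` is coupled in one of the layers: the pair
`(i, i + t)` in that of distance `t` and of the parity of `i / t`. -/
lemma cz_mem_diagKinds {K : ℕ} {i j : Fin n} (h : i < j) (hK : (j : ℕ) ≤ i + K) :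
    Cliff.cz i j h.ne ∈ gatesOf n (diagKinds K) := by
  have hij : (i : ℕ) < j := h
  rw [diagKinds, gatesOf_cons, List.mem_append, gatesOf, List.mem_flatMap]
  refine Or.inr ⟨.cz ((j : ℕ) - i - 1 + 1) ((i : ℕ) / ((j : ℕ) - i - 1 + 1) % 2), ?_, ?_⟩
  · rw [List.mem_flatMap]
    refine ⟨(j : ℕ) - i - 1, List.mem_range.2 (by omega), ?_⟩
    rcases Nat.mod_two_eq_zero_or_one ((i : ℕ) / ((j : ℕ) - i - 1 + 1)) with h | h <;>
      rw [h] <;> simp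
  · rw [LayerKind.gates, List.mem_filterMap]
    have e : (i : ℕ) + ((j : ℕ) - i - 1 + 1) = j := by omega
    refine ⟨i, List.mem_finRange i, ?_⟩
    rw [dif_pos ⟨by rw [e]; exact j.2, by omega, rfl⟩]
    simp only [Option.some.injEq, Cliff.cz.injEq, true_and]
    exact Fin.ext e

/-- The random diagonal unitary randomizes the second component of a symmetric label `(w, r)`, if
`w` has no long gaps. -/
lemma labelAvg_diagKinds {K : ℕ} {w : Qubits n} (hw : GapFree K w) (F : Label n → ℝ) {r : Qubits n}
    (hr : sgn r w = 1) :
    labelAvg (gatesOf n (diagKinds K)) F (w, r) = perpAvg w fun r => F (w, r) := by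
  have hd := isDiag_of_mem_diagKinds (n := n) (K := K)
  have hinv : ∀ g ∈ gatesOf n (diagKinds K), ∀ r,
      labelAvg (gatesOf n (diagKinds K)) F (w, bxor r (g.shift w)) =
        labelAvg (gatesOf n (diagKinds K)) F (w, r) := fun g hg r => by
    rw [← labelAvg_act_of_mem hd hg F (w, r), (hd g hg).act_eq]
  have key : ∀ r', sgn r' w = 1 → labelAvg (gatesOf n (diagKinds K)) F (w, r') =
      labelAvg (gatesOf n (diagKinds K)) F (w, r) := by
    intro r' hr'
    refine eq_of_flip_invariant hw (fun r => labelAvg (gatesOf n (diagKinds K)) F (w, r)) ?_ ?_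
      (hr'.trans hr.symm)
    · intro i hi r
      have := hinv _ (loc_mem_diagKinds K i) r
      simpa [Cliff.shift, hi] using this
    · intro i j hi hj hij hK r
      have := hinv _ (cz_mem_diagKinds hij hK) r
      simpa [Cliff.shift, hi, hj] using this
  rw [← perpAvg_labelAvg hd F w, ← perpAvg_const w (labelAvg _ F (w, r)), perpAvg, perpAvg]
  congr 1
  exact Finset.sum_congr rfl fun r' hr' => (key r' (mem_perp.1 hr')).symm

/-! ### Product functions of labels -/

/-- The average over one single-qubit gate of a function of the label of one qubit. -/
def Local.avg (k : Local) (h : Bool → Bool → ℝ) (w r : Bool) : ℝ :=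
  match k with
  | .H => h r w
  | k => (1 / 2) * (h w r + h (k.act w r).1 (k.act w r).2)

/-- The same single-qubit gate on several qubits acts independently on the factors of a product. -/
lemma labelAvg_loc_prod (k : Local) (l : List (Fin n)) (hl : l.Nodup)
    (h : Fin n → Bool → Bool → ℝ) (ℓ : Label n) :
    labelAvg (l.map (.loc k)) (fun ℓ => ∏ i, h i (ℓ.1 i) (ℓ.2 i)) ℓ =
      ∏ i, (if i ∈ l then k.avg (h i) else h i) (ℓ.1 i) (ℓ.2 i) := by
  induction l generalizing ℓ with
  | nil => simp [labelAvg]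
  | cons i l ih =>
    rw [List.nodup_cons] at hl
    have hact : ∏ j, (if j ∈ l then k.avg (h j) else h j) ((Cliff.loc k i).act ℓ |>.1 j)
        ((Cliff.loc k i).act ℓ |>.2 j) =
        h i (k.act (ℓ.1 i) (ℓ.2 i)).1 (k.act (ℓ.1 i) (ℓ.2 i)).2 * ∏ j ∈ Finset.univ.erase i,
          (if j ∈ l then k.avg (h j) else h j) (ℓ.1 j) (ℓ.2 j) := by
      rw [← Finset.mul_prod_erase _ _ (Finset.mem_univ i)]
      congr 1
      · simp [hl.1, Cliff.act]
      · refine Finset.prod_congr rfl fun j hj => ?_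
        have hj := Finset.ne_of_mem_erase hj
        simp [Cliff.act, hj]
    have hid : ∏ j, (if j ∈ l then k.avg (h j) else h j) (ℓ.1 j) (ℓ.2 j) =
        h i (ℓ.1 i) (ℓ.2 i) * ∏ j ∈ Finset.univ.erase i,
          (if j ∈ l then k.avg (h j) else h j) (ℓ.1 j) (ℓ.2 j) := by
      rw [← Finset.mul_prod_erase _ _ (Finset.mem_univ i), if_neg hl.1]
    have hgoal : ∏ j, (if j ∈ i :: l then k.avg (h j) else h j) (ℓ.1 j) (ℓ.2 j) =
        k.avg (h i) (ℓ.1 i) (ℓ.2 i) * ∏ j ∈ Finset.univ.erase i,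
          (if j ∈ l then k.avg (h j) else h j) (ℓ.1 j) (ℓ.2 j) := by
      rw [← Finset.mul_prod_erase _ _ (Finset.mem_univ i), if_pos List.mem_cons_self]
      congr 1
      refine Finset.prod_congr rfl fun j hj => ?_
      have hj := Finset.ne_of_mem_erase hj
      simp [hj]
    rw [hgoal, List.map_cons, labelAvg, ih hl.2, ih hl.2, hact, hid]
    cases k <;> simp [Cliff.isRandom, Local.avg, Local.act] <;> ring

lemma labelAvg_layer_prod (k : Local) (h : Fin n → Bool → Bool → ℝ) :
    labelAvg ((LayerKind.loc k).gates n) (fun ℓ => ∏ i, h i (ℓ.1 i) (ℓ.2 i)) =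
      fun ℓ => ∏ i, k.avg (h i) (ℓ.1 i) (ℓ.2 i) := by
  funext ℓ
  rw [LayerKind.gates, labelAvg_loc_prod k _ (List.nodup_finRange n)]
  simp

/-- A layer of Hadamard gates exchanges the two components of a label. -/
lemma labelAvg_hadamard (F : Label n → ℝ) (ℓ : Label n) :
    labelAvg ((LayerKind.loc .H).gates n) F ℓ = F (ℓ.2, ℓ.1) := by
  have key : ∀ (l : List (Fin n)), l.Nodup → ∀ ℓ : Label n, labelAvg (l.map (.loc .H)) F ℓ =
      F (fun i => if i ∈ l then ℓ.2 i else ℓ.1 i, fun i => if i ∈ l then ℓ.1 i else ℓ.2 i) := by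
    intro l
    induction l with
    | nil => intro _ ℓ; simp [labelAvg]
    | cons i l ih =>
      intro hl ℓ
      rw [List.nodup_cons] at hl
      rw [List.map_cons, labelAvg, if_neg (by simp [Cliff.isRandom]), ih hl.2]
      congr 1
      refine Prod.ext (funext fun j => ?_) (funext fun j => ?_)
      · by_cases hj : j = i
        · subst hj; simp [hl.1, Cliff.act, Local.act]
        · simp [Cliff.act, hj]
      · by_cases hj : j = i
        · subst hj; simp [hl.1, Cliff.act, Local.act]
        · simp [Cliff.act, hj]
  rw [LayerKind.gates, key _ (List.nodup_finRange n)]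
  simp

/-- After random single-qubit unitaries, long gaps are unlikely. -/
lemma labelAvg_spreadKinds_gapInd (K : ℕ) (hK : 0 < K) (ℓ : Label n) :
    labelAvg (gatesOf n spreadKinds) (fun ℓ => gapInd K ℓ.1) ℓ ≤ n * (3 / 4) ^ K := by
  refine (labelAvg_mono _ (fun ℓ => gapInd_le K hK ℓ.1) ℓ).trans ?_
  rw [labelAvg_sum]
  refine sum_range_filter_le K _ _ (by positivity) fun a ha => ?_
  have hg : gatesOf n spreadKinds = (LayerKind.loc .S).gates n ++ ((LayerKind.loc .H).gates n ++
      ((LayerKind.loc .S).gates n ++ (LayerKind.loc .H).gates n)) := by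
    simp [gatesOf, spreadKinds]
  rw [hg, labelAvg_append, labelAvg_append, labelAvg_append,
    labelAvg_layer_prod .H fun i w _ => windowInd a K i w, labelAvg_layer_prod,
    labelAvg_layer_prod, labelAvg_layer_prod, ← prod_window a K ha]
  have key : ∀ i : Fin n, ∀ w r,
      0 ≤ Local.avg .S (Local.avg .H (Local.avg .S (Local.avg .H
        fun w _ => windowInd a K i w))) w r ∧
      Local.avg .S (Local.avg .H (Local.avg .S (Local.avg .H
        fun w _ => windowInd a K i w))) w r ≤
        if a ≤ (i : ℕ) ∧ (i : ℕ) < a + K then 3 / 4 else 1 := by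
    intro i w r
    unfold windowInd
    split_ifs <;> cases w <;> cases r <;> simp [Local.avg, Local.act] <;> norm_num
  exact Finset.prod_le_prod (fun i _ => (key i _ _).1) fun i _ => (key i _ _).2

/-! ### Mixing -/

/-- After the `m`-th step of the walk, the average of `F`, as a function of the first component of
the label. -/
def walkAvg (f : Label n → ℝ) : ℕ → Qubits n → ℝ
  | 0, w => perpAvg w fun r => f (w, r)
  | R + 1, w => perpAvg w (walkAvg f R)

lemma walkAvg_mem_Icc {f : Label n → ℝ} {a b : ℝ} (hf : ∀ ℓ, f ℓ ∈ Set.Icc a b) (R : ℕ)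
    (w : Qubits n) : walkAvg f R w ∈ Set.Icc a b := by
  induction R generalizing w with
  | zero => exact perpAvg_mem_Icc fun r => hf _
  | succ R ih => exact perpAvg_mem_Icc ih

/-- After `2 m` steps of the walk, the starting point is forgotten up to an error `2 ^ (-m)`. -/
lemma exists_Icc_walkAvg {f : Label n → ℝ} {B : ℝ} (hf : ∀ ℓ, f ℓ ∈ Set.Icc 0 B) (m : ℕ) :
    ∃ a b, b - a = B / 2 ^ m ∧ ∀ w, walkAvg f (2 * m) w ∈ Set.Icc a b := by
  induction m with
  | zero => exact ⟨0, B, by simp, fun w => walkAvg_mem_Icc hf _ w⟩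
  | succ m ih =>
    obtain ⟨a, b, hab, h⟩ := ih
    obtain ⟨a', b', hab', h'⟩ := exists_Icc_perpAvg_perpAvg h
    refine ⟨a', b', ?_, h'⟩
    rw [hab', hab, pow_succ, div_div]

/-- On symmetric labels without long gaps, the circuit acts like the ideal walk. -/
lemma abs_labelAvg_mixKinds_sub {f : Label n → ℝ} {B : ℝ} (hf : ∀ ℓ, f ℓ ∈ Set.Icc 0 B)
    {K : ℕ} (hK : 0 < K) (R : ℕ) {w r : Qubits n} (hw : GapFree K w) (hr : sgn r w = 1) :
    |labelAvg (gatesOf n (mixKinds K R)) f (w, r) - walkAvg f R w| ≤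
      R * (2 * (n * (1 / 2) ^ K)) * B := by
  have hB : 0 ≤ B := (hf (w, r)).1.trans (hf (w, r)).2
  induction R generalizing w r with
  | zero => rw [mixKinds, labelAvg_diagKinds hw f hr, walkAvg]; simp
  | succ R ih =>
    rw [mixKinds, gatesOf_append, gatesOf_cons, labelAvg_append, labelAvg_append,
      labelAvg_diagKinds hw _ hr, walkAvg]
    simp only [labelAvg_hadamard]
    set G := labelAvg (gatesOf n (mixKinds K R)) f
    have hG : ∀ ℓ, G ℓ ∈ Set.Icc 0 B := labelAvg_mem_Icc _ hf
    set ε : ℝ := R * (2 * (n * (1 / 2) ^ K)) * B with hε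
    have hε0 : 0 ≤ ε := by positivity
    have key : ∀ r' ∈ perp w, |G (r', w) - walkAvg f R r'| ≤ ε + B * gapInd K r' := by
      intro r' hr'
      by_cases hg : GapFree K r'
      · have := ih hg ((sgn_comm _ _).trans (mem_perp.1 hr'))
        simpa [gapInd, hg] using this
      · have h1 := hG (r', w)
        have h2 := walkAvg_mem_Icc hf R r'
        rw [gapInd, if_neg hg, abs_le]
        constructor <;> linarith [h1.1, h1.2, h2.1, h2.2]
    have hsum : ε + B * perpAvg w (gapInd K) ≤ (R + 1 : ℕ) * (2 * (n * (1 / 2) ^ K)) * B := by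
      have := mul_le_mul_of_nonneg_left (perpAvg_gapInd_le K hK w) hB
      rw [hε]; push_cast; linarith
    refine le_trans ?_ hsum
    rw [← perpAvg_sub, ← perpAvg_const w ε, ← perpAvg_mul, ← perpAvg_add, abs_le]
    have hneg : ∀ h : Qubits n → ℝ, -perpAvg w h = perpAvg w fun r => (-1) * h r := fun h => by
      rw [perpAvg_mul]; ring
    constructor
    · rw [hneg]
      exact perpAvg_mono fun r hr => by have := (abs_le.1 (key r hr)).1; linarith
    · exact perpAvg_mono fun r hr => (abs_le.1 (key r hr)).2

/-- The layers of the twirling circuit after the random Pauli operator. -/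
def coreKinds (K m : ℕ) : List LayerKind := spreadKinds ++ mixKinds K (2 * m)

lemma spreadKinds_spec : ∀ g ∈ gatesOf n spreadKinds, g.IsDiag ∨ ∃ i, g = .loc .H i := by
  intro g hg
  rw [gatesOf, List.mem_flatMap] at hg
  obtain ⟨k, hk, hg⟩ := hg
  simp only [spreadKinds, List.mem_cons, List.not_mem_nil, or_false] at hk
  rcases hk with rfl | rfl | rfl | rfl <;> obtain ⟨i, -, rfl⟩ := List.mem_map.1 hg
  · exact Or.inl trivial
  · exact Or.inr ⟨i, rfl⟩
  · exact Or.inl trivial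
  · exact Or.inr ⟨i, rfl⟩

/-- The twirling circuit almost forgets from which symmetric Bell state it started. -/
lemma exists_Icc_labelAvg_coreKinds {f : Label n → ℝ} {B : ℝ} (hf : ∀ ℓ, f ℓ ∈ Set.Icc 0 B)
    {K : ℕ} (hK : 0 < K) (m : ℕ) :
    ∃ a b, b - a = (1 / 2 ^ m + 2 * (2 * m * (2 * (n * (1 / 2) ^ K)) + n * (3 / 4) ^ K)) * B ∧
      ∀ ℓ : Label n, sgn ℓ.2 ℓ.1 = 1 →
        labelAvg (gatesOf n (coreKinds K m)) f ℓ ∈ Set.Icc a b := by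
  obtain ⟨a, b, hab, h⟩ := exists_Icc_walkAvg hf m
  have hB : 0 ≤ B := (hf default).1.trans (hf default).2
  set ε : ℝ := 2 * m * (2 * (n * (1 / 2) ^ K)) * B with hε
  have hε0 : 0 ≤ ε := by positivity
  set β : ℝ := n * (3 / 4) ^ K with hβ
  refine ⟨a - ε - β * B, b + ε + β * B, ?_, fun ℓ hℓ => ?_⟩
  · rw [show b + ε + β * B - (a - ε - β * B) = (b - a) + 2 * (ε + β * B) by ring, hab, hε]; ring
  have key : ∀ ℓ : Label n, sgn ℓ.2 ℓ.1 = 1 →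
      a - ε + -B * gapInd K ℓ.1 ≤ labelAvg (gatesOf n (mixKinds K (2 * m))) f ℓ ∧
      labelAvg (gatesOf n (mixKinds K (2 * m))) f ℓ ≤ b + ε + B * gapInd K ℓ.1 := by
    rintro ⟨w, r⟩ hr
    have hw := h w
    by_cases hg : GapFree K w
    · have := abs_le.1 (abs_labelAvg_mixKinds_sub hf hK (2 * m) hg hr)
      push_cast at this
      rw [← hε] at this
      simp only [gapInd, if_pos hg]
      constructor <;> linarith [this.1, this.2, hw.1, hw.2]
    · have h1 := labelAvg_mem_Icc (gatesOf n (mixKinds K (2 * m))) hf (w, r)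
      have h2 := walkAvg_mem_Icc hf (2 * m) w
      simp only [gapInd, if_neg hg]
      constructor <;> linarith [h1.1, h1.2, hw.1, hw.2, h2.1, h2.2]
  have hgap := mul_le_mul_of_nonneg_left (labelAvg_spreadKinds_gapInd K hK ℓ) hB
  rw [← hβ] at hgap
  rw [coreKinds, gatesOf_append, labelAvg_append]
  constructor
  · refine le_trans ?_ (labelAvg_mono_on spreadKinds_spec (fun ℓ hℓ => (key ℓ hℓ).1) ℓ hℓ)
    rw [labelAvg_add, labelAvg_const, labelAvg_mul]
    linarith
  · refine (labelAvg_mono_on spreadKinds_spec (fun ℓ hℓ => (key ℓ hℓ).2) ℓ hℓ).trans ?_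
    rw [labelAvg_add, labelAvg_const, labelAvg_mul]
    linarith

end Circuits

/-! ### The honest prover: a biased SWAP test -/

section Honest

lemma Instrument.sum_trace_apply {O I J : Type} [Fintype O] [Fintype I] [Fintype J] [DecidableEq I]
    (M : Instrument O I J) (σ : Matrix I I ℂ) : ∑ o, (M.apply o σ).trace = σ.trace := by
  have h := congrArg (fun A => (A * σ).trace) M.complete
  simp only [Matrix.sum_mul, Matrix.trace_sum, Matrix.one_mul] at h
  rw [← h]
  refine Finset.sum_congr rfl fun o _ => ?_
  rw [Instrument.apply, Matrix.trace_sum]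
  refine Finset.sum_congr rfl fun i _ => ?_
  rw [Matrix.mul_assoc, Matrix.trace_mul_comm, Matrix.mul_assoc, Matrix.trace_mul_comm]

lemma Instrument.trace_apply_nonneg {O I J : Type} [Fintype O] [Fintype I] [Fintype J]
    [DecidableEq I] (M : Instrument O I J) (o : O) {σ : Matrix I I ℂ} (h : σ.PosSemidef) :
    0 ≤ (M.apply o σ).trace.re :=
  (Complex.le_def.1 (M.posSemidef_apply o h).trace_nonneg).1

variable {n : ℕ}

lemma sum_fin_two {Q R : Type} [Fintype Q] [DecidableEq Q] [AddCommMonoid R] (f : (Fin 2 → Q) → R) :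
    ∑ x, f x = ∑ a, ∑ b, f ![a, b] := by
  rw [← (finTwoArrowEquiv Q).symm.sum_comp, Fintype.sum_prod_type]
  rfl

lemma trace_copies_two (ρ : Matrix (Qubits n) (Qubits n) ℂ) :
    (copies 2 ρ).trace = ρ.trace * ρ.trace := by
  simp only [Matrix.trace, Matrix.diag, copies]
  rw [sum_fin_two, Finset.sum_mul_sum]
  simp

lemma posSemidef_copies_two {ρ : Matrix (Qubits n) (Qubits n) ℂ} (h : ρ.PosSemidef) :
    (copies 2 ρ).PosSemidef := by
  have e : copies 2 ρ = (ρ ⊗ₖ ρ).submatrix (finTwoArrowEquiv _) (finTwoArrowEquiv _) := by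
    ext x y
    simp [copies, finTwoArrowEquiv]
  rw [e]
  exact (h.kronecker h).submatrix _

/-- The exchange of two registers. -/
def swapMat (n : ℕ) : Matrix (Fin 2 → Qubits n) (Fin 2 → Qubits n) ℂ :=
  fun x y => if x ∘ Equiv.swap 0 1 = y then 1 else 0

lemma comp_swap_comp_swap {Q : Type} (x : Fin 2 → Q) :
    (x ∘ Equiv.swap 0 1) ∘ Equiv.swap 0 1 = x := by
  funext i; simp

lemma swapMat_mul_self : swapMat n * swapMat n = 1 := by
  ext x y
  rw [Matrix.mul_apply, Finset.sum_eq_single (x ∘ Equiv.swap 0 1)]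
  · simp [swapMat, Matrix.one_apply, comp_swap_comp_swap]
  · intro z _ hz
    simp [swapMat, hz.symm]
  · simp

lemma swapMat_conjTranspose : (swapMat n)ᴴ = swapMat n := by
  ext x y
  rw [Matrix.conjTranspose_apply]
  have : (y ∘ Equiv.swap 0 1 = x) ↔ (x ∘ Equiv.swap 0 1 = y) :=
    ⟨fun h => by rw [← h, comp_swap_comp_swap], fun h => by rw [← h, comp_swap_comp_swap]⟩
  simp only [swapMat, this]
  split_ifs <;> simp

/-- The SWAP trick. -/
lemma trace_swapMat_mul_copies (ρ : Matrix (Qubits n) (Qubits n) ℂ) :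
    (swapMat n * copies 2 ρ).trace = (ρ * ρ).trace := by
  have h : ∀ x, (swapMat n * copies 2 ρ) x x = copies 2 ρ (x ∘ Equiv.swap 0 1) x := by
    intro x
    rw [Matrix.mul_apply, Finset.sum_eq_single (x ∘ Equiv.swap 0 1)]
    · simp [swapMat]
    · intro z _ hz
      simp [swapMat, hz.symm]
    · simp
  simp only [Matrix.trace, Matrix.diag, h]
  rw [sum_fin_two]
  simp only [copies, Fin.prod_univ_two, Function.comp, Equiv.swap_apply_left,
    Equiv.swap_apply_right, Matrix.cons_val_zero, Matrix.cons_val_one, Matrix.mul_apply]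
  exact Finset.sum_congr rfl fun a _ => Finset.sum_congr rfl fun b _ => mul_comm _ _

/-- The amplitudes of the auxiliary qubit in the SWAP test. Their squares are chosen such that the
test accepts with probability less than one half on the symmetric subspace, and with certainty on
the antisymmetric one. -/
def ampA : ℝ := Real.sqrt (33 / 40)

/-- The second amplitude of the auxiliary qubit in the SWAP test. -/
def ampB : ℝ := Real.sqrt (7 / 40)

lemma ampA_sq : (ampA : ℂ) * ampA = 33 / 40 := by
  rw [← Complex.ofReal_mul, ampA, Real.mul_self_sqrt (by norm_num)]
  norm_num

lemma ampB_sq : (ampB : ℂ) * ampB = 7 / 40 := by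
  rw [← Complex.ofReal_mul, ampB, Real.mul_self_sqrt (by norm_num)]
  norm_num

/-- The preparation of the auxiliary qubit. -/
def prepMat : Matrix Bool Bool ℂ := fun a b => match a, b with
  | false, false => ampA
  | true, false => ampB
  | false, true => ampB
  | true, true => -ampA

/-- The rotation of the auxiliary qubit before its measurement. -/
def readMat : Matrix Bool Bool ℂ := fun a b => match a, b with
  | false, false => ampB
  | true, false => ampA
  | false, true => ampA
  | true, true => -ampB

lemma prepMat_unitary : prepMatᴴ * prepMat = 1 := by
  have hA := ampA_sq
  have hB := ampB_sq
  ext a b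
  rw [Matrix.mul_apply, Fintype.sum_bool, Matrix.one_apply]
  simp only [Matrix.conjTranspose_apply]
  cases a <;> cases b <;> simp [prepMat, hA, hB, mul_comm] <;> norm_num

lemma readMat_unitary : readMatᴴ * readMat = 1 := by
  have hA := ampA_sq
  have hB := ampB_sq
  ext a b
  rw [Matrix.mul_apply, Fintype.sum_bool, Matrix.one_apply]
  simp only [Matrix.conjTranspose_apply]
  cases a <;> cases b <;> simp [readMat, hA, hB, mul_comm] <;> norm_num

/-- The circuit of the honest prover. -/
def honestCircuit (n : ℕ) : Circuit 2 n where
  a := 0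
  gates := [.gate 1 (by norm_num) (wire (.inl 0)) ⟨wireMat prepMat, wireMat_unitary prepMat_unitary⟩,
    .ctrlSwap 0 0 1,
    .gate 1 (by norm_num) (wire (.inl 0)) ⟨wireMat readMat, wireMat_unitary readMat_unitary⟩]

lemma update_join (u : Fin 1 → Bool) (x : Fin 2 → Qubits n) (c : Bool) :
    Function.update (join (a := 0) u x) (.inl 0) c = join (fun _ => c) x := by
  funext w
  rcases w with t | w
  · have : t = 0 := Subsingleton.elim (α := Fin 1) _ _
    subst this
    simp [join]
  · simp [join]

lemma ctrlSwap_join (x : Fin 2 → Qubits n) (c : Bool) :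
    ctrlSwap (a := 0) 0 0 1 (join (fun _ => c) x) =
      join (fun _ => c) (if c then x ∘ Equiv.swap 0 1 else x) := by
  funext w
  rcases w with t | ⟨k, l⟩
  · rfl
  · cases c <;> simp [ctrlSwap, join]

lemma join_injective {u v : Fin 1 → Bool} {x y : Fin 2 → Qubits n} :
    join (a := 0) u x = join v y ↔ u = v ∧ x = y := by
  constructor
  · intro h
    have := (join_bij 0 2 n).1 (a₁ := (u, x)) (a₂ := (v, y)) h
    exact Prod.mk.inj this
  · rintro ⟨rfl, rfl⟩; rfl

lemma honestCircuit_matrix (u : Fin 1 → Bool) (x y : Fin 2 → Qubits n) :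
    (honestCircuit n).matrix (join (a := 0) u x) (join (fun _ => false) y) =
      ∑ c, readMat (u 0) c * (prepMat c false *
        if (if c then x ∘ Equiv.swap 0 1 else x) = y then 1 else 0) := by
  suffices h : ∀ X Y : Wires 0 2 n → Bool, X = join u x → Y = join (fun _ => false) y →
      ((onWires (wire (Sum.inl 0 : Wires 0 2 n)) (wireMat readMat) *
        ((Gate.ctrlSwap (a := 0) (m := 2) (n := n) 0 0 1).matrix *
          (onWires (wire (Sum.inl 0 : Wires 0 2 n)) (wireMat prepMat) * 1)) :
        Matrix (Wires 0 2 n → Bool) (Wires 0 2 n → Bool) ℂ)) X Y =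
        ∑ c, readMat (u 0) c * (prepMat c false *
          if (if c then x ∘ Equiv.swap 0 1 else x) = y then 1 else 0) from h _ _ rfl rfl
  rintro X Y rfl rfl
  rw [Matrix.mul_one, Matrix.mul_apply, sum_onWires_wire]
  refine Finset.sum_congr rfl fun c _ => ?_
  rw [update_join, Matrix.mul_apply,
    Finset.sum_eq_single (ctrlSwap (a := 0) 0 0 1 (join (fun _ => c) x))]
  · have h1 : (Gate.ctrlSwap (a := 0) (m := 2) (n := n) 0 0 1).matrix (join (fun _ => c) x)
        (ctrlSwap (a := 0) 0 0 1 (join (fun _ => c) x)) = 1 := by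
      simp [Gate.matrix, ctrlSwap_ctrlSwap]
    rw [h1, one_mul, ctrlSwap_join]
    have h2 := sum_onWires_wire (Sum.inl 0 : Wires 0 2 n) prepMat
      (join (fun _ => c) (if c then x ∘ Equiv.swap 0 1 else x))
      (fun z => if z = join (fun _ => false) y then 1 else 0)
    simp only [mul_ite, mul_one, mul_zero, Finset.sum_ite_eq', Finset.mem_univ, if_true,
      update_join, join_injective] at h2
    rw [h2, Fintype.sum_bool]
    have h3 : ((fun _ => true : Fin 1 → Bool) = fun _ => false) ↔ False :=
      ⟨fun h => by simpa using congrFun h 0, False.elim⟩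
    simp only [h3, false_and, if_false, true_and, zero_add, mul_ite, mul_one, mul_zero, join]
    rfl
  · intro z _ hz
    have : ¬ join (a := 0) (fun _ => c) x = ctrlSwap 0 0 1 z := fun h => hz (by
      rw [h, ctrlSwap_ctrlSwap])
    have h1 : (Gate.ctrlSwap (a := 0) (m := 2) (n := n) 0 0 1).matrix (join (fun _ => c) x) z = 0 :=
      if_neg this
    rw [h1, zero_mul]
  · simp

/-- The measured operator is a combination of the identity and the exchange of the copies, as the
auxiliary qubit controls the exchange. -/
lemma honestCircuit_op_true (u : Fin 1 → Bool) :
    (honestCircuit n).solver.op true u =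
      if u 0 = true then (33 / 40 : ℂ) • (1 : Matrix (Fin 2 → Qubits n) (Fin 2 → Qubits n) ℂ) -
        (7 / 40 : ℂ) • swapMat n else 0 := by
  ext x y
  have e : (honestCircuit n).solver.op true u x y =
      if u 0 = true then (honestCircuit n).matrix (join (a := 0) u x) (join (fun _ => false) y)
        else 0 := rfl
  rw [e]
  split_ifs with hu
  · rw [honestCircuit_matrix, hu, Fintype.sum_bool]
    simp only [if_true, Bool.false_eq_true, if_false, readMat, prepMat, Matrix.sub_apply,
      Matrix.smul_apply, swapMat, Matrix.one_apply, smul_eq_mul]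
    rw [← mul_assoc, ← mul_assoc, neg_mul, ampB_sq, ampA_sq]
    ring
  · rfl

/-- The acceptance probability is affine in the purity. -/
lemma trace_honestCircuit_apply_true (ρ : State (Qubits n)) :
    ((honestCircuit n).solver.apply true (copies 2 ρ.1)).trace =
      1138 / 1600 - 462 / 1600 * (ρ.1 * ρ.1).trace := by
  set A : Matrix (Fin 2 → Qubits n) (Fin 2 → Qubits n) ℂ := (33 / 40 : ℂ) • 1 -
    (7 / 40 : ℂ) • swapMat n with hA
  have h1 : (honestCircuit n).solver.apply true (copies 2 ρ.1) = A * copies 2 ρ.1 * Aᴴ := by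
    have e : (honestCircuit n).solver.apply true (copies 2 ρ.1) = ∑ u : Fin 1 → Bool,
        (honestCircuit n).solver.op true u * copies 2 ρ.1 *
          ((honestCircuit n).solver.op true u)ᴴ := rfl
    rw [e, ← (Equiv.funUnique (Fin 1) Bool).symm.sum_comp, Fintype.sum_bool,
      honestCircuit_op_true, honestCircuit_op_true]
    simp [hA]
  have hAA : Aᴴ = A := by
    rw [hA, Matrix.conjTranspose_sub, Matrix.conjTranspose_smul, Matrix.conjTranspose_smul,
      Matrix.conjTranspose_one, swapMat_conjTranspose]
    simp
  have h2 : A * A = (1138 / 1600 : ℂ) • (1 : Matrix (Fin 2 → Qubits n) (Fin 2 → Qubits n) ℂ) -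
      (462 / 1600 : ℂ) • swapMat n := by
    rw [hA, Matrix.sub_mul, Matrix.mul_sub, Matrix.mul_sub]
    simp only [Matrix.smul_mul, Matrix.mul_smul, Matrix.one_mul, Matrix.mul_one, swapMat_mul_self,
      smul_smul]
    module
  rw [h1, hAA, Matrix.trace_mul_comm, ← Matrix.mul_assoc, h2, Matrix.sub_mul, Matrix.trace_sub,
    Matrix.smul_mul, Matrix.smul_mul, Matrix.one_mul, Matrix.trace_smul, Matrix.trace_smul,
    trace_swapMat_mul_copies, trace_copies_two, ρ.2.2]
  simp

lemma State.IsPure.trace_mul_self {ρ : State (Qubits n)} (h : ρ.IsPure) :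
    (ρ.1 * ρ.1).trace = 1 := by
  obtain ⟨ψ, hψ⟩ := h
  have ht := ρ.2.2
  rw [hψ, Matrix.trace_vecMulVec] at ht
  rw [hψ, Matrix.vecMulVec_mul_vecMulVec, dotProduct_comm, ht, one_smul, Matrix.trace_vecMulVec, ht]

lemma trace_mixed_mul_self : ((mixed n).1 * (mixed n).1).trace = ((2 : ℂ) ^ n)⁻¹ := by
  simp only [mixed, Matrix.smul_mul, Matrix.mul_smul, Matrix.one_mul, Matrix.trace_smul,
    Matrix.trace_one, smul_smul]
  have : ((2 : ℂ) ^ n) ≠ 0 := by positivity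
  simp

/-- The probability that the solver `A` answers `a` on two copies of `ρ`. -/
def Solver.prob {n : ℕ} (A : Solver 2 n) (a : Bool) (ρ : Matrix (Qubits n) (Qubits n) ℂ) : ℝ :=
  (A.apply a (copies 2 ρ)).trace.re

lemma Solver.prob_nonneg (A : Solver 2 n) (a : Bool) (ρ : State (Qubits n)) : 0 ≤ A.prob a ρ.1 :=
  A.trace_apply_nonneg a (posSemidef_copies_two ρ.2.1)

lemma Solver.prob_add (A : Solver 2 n) (ρ : State (Qubits n)) :
    A.prob true ρ.1 + A.prob false ρ.1 = 1 := by
  have := A.sum_trace_apply (copies 2 ρ.1)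
  rw [Fintype.sum_bool, trace_copies_two, ρ.2.2, mul_one] at this
  have := congrArg Complex.re this
  simpa [Solver.prob] using this

lemma valid_mixed (hn : 0 < n) (a : Bool) : (purityTesting n hn).Valid (mixed n) a ↔ a = true :=
  ⟨fun h => h.1 rfl, fun h => ⟨fun _ => h, fun hr => (mixed_not_isPure hn hr).elim⟩⟩

lemma valid_pure (hn : 0 < n) {ρ : State (Qubits n)} (h : ρ.IsPure) (a : Bool) :
    (purityTesting n hn).Valid ρ a ↔ a = false :=
  ⟨fun hv => hv.2 h, fun ha => ⟨fun e => by
    rw [show ρ = mixed n from e] at h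
    exact (mixed_not_isPure hn h).elim, fun _ => ha⟩⟩

/-- On the maximally mixed state the purity is at most `1 / 2`, so the circuit accepts with probability
at least `907 / 1600`; on pure states it accepts with probability `676 / 1600`. -/
lemma honestCircuit_solves (hn : 0 < n) :
    (honestCircuit n).solver.Solves (purityTesting n hn) (693 / 1600) := by
  intro ρ
  have h0 := Solver.prob_nonneg (honestCircuit n).solver true ρ
  have h0' := Solver.prob_nonneg (honestCircuit n).solver false ρ
  have h1 := Solver.prob_add (honestCircuit n).solver ρ
  have h2 : (honestCircuit n).solver.prob true ρ.1 =
      1138 / 1600 - 462 / 1600 * ((ρ.1 * ρ.1).trace).re := by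
    rw [Solver.prob, trace_honestCircuit_apply_true]
    simp
  rw [Fintype.sum_bool]
  have hq : ∀ a, ((honestCircuit n).solver.apply a (copies 2 ρ.1)).trace.re =
      (honestCircuit n).solver.prob a ρ.1 := fun _ => rfl
  rw [hq, hq]
  by_cases hm : ρ = mixed n
  · subst hm
    rw [if_pos ((valid_mixed hn _).2 rfl), h2, trace_mixed_mul_self]
    have e : (((2 : ℂ) ^ n)⁻¹).re = ((2 : ℝ) ^ n)⁻¹ := by
      have : (((2 : ℂ) ^ n)⁻¹) = (((2 : ℝ) ^ n)⁻¹ : ℝ) := by push_cast; rfl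
      rw [this, Complex.ofReal_re]
    have h3 : ((2 : ℝ) ^ n)⁻¹ ≤ 1 / 2 := by
      have : (2 : ℝ) ^ 1 ≤ 2 ^ n := pow_le_pow_right₀ (by norm_num) hn
      rw [inv_eq_one_div]
      exact one_div_le_one_div_of_le (by norm_num) (by linarith)
    rw [e]
    split_ifs <;> linarith
  · by_cases hp : ρ.IsPure
    · rw [if_pos ((valid_pure hn hp _).2 rfl : (purityTesting n hn).Valid ρ false)]
      rw [hp.trace_mul_self] at h2
      simp only [Complex.one_re] at h2
      split_ifs <;> linarith
    · have hv : ∀ a, (purityTesting n hn).Valid ρ a := fun a =>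
        ⟨fun e => (hm e).elim, fun e => (hp e).elim⟩
      rw [if_pos (hv _), if_pos (hv _)]
      linarith

end Honest

/-! ### Operations on the register before it is sent -/

section Register

variable {n c : ℕ} {K : Type} [Fintype K] [DecidableEq K]

lemma Op.dual_bool (k i j : Fin c) (f : Bool → Bool → Bool) (E : Joint n c K) :
    Op.dual (.bool k i j f) E = fun μ => E (Function.update μ k (f (μ i) (μ j))) := by
  funext μ
  simp [Op.dual, Op.branches]

lemma slice_one_kronecker (σ : Matrix (Qubits n) (Qubits n) ℂ) (Y : Matrix K K ℂ) :
    slice σ ((1 : Matrix (Qubits n) (Qubits n) ℂ) ⊗ₖ Y) = σ.trace • Y := by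
  ext k l
  simp only [slice, Matrix.kroneckerMap_apply, Matrix.one_apply, ite_mul, one_mul, zero_mul,
    mul_ite, mul_zero, Finset.sum_ite_eq, Finset.mem_univ, if_true, Matrix.smul_apply, smul_eq_mul,
    Matrix.trace, Matrix.diag, Finset.sum_mul]

lemma slice_conj (σ A : Matrix (Qubits n) (Qubits n) ℂ)
    (E : Matrix (Qubits n × K) (Qubits n × K) ℂ) :
    slice σ ((A ⊗ₖ (1 : Matrix K K ℂ))ᴴ * E * (A ⊗ₖ (1 : Matrix K K ℂ))) =
      slice (A * σ * Aᴴ) E := by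
  rw [Matrix.ext_iff_trace_mul_right]
  intro κ
  rw [← trace_mul_kronecker, ← trace_mul_kronecker, ← trace_mul_conj, Matrix.conjTranspose_kronecker,
    Matrix.conjTranspose_one, ← Matrix.mul_kronecker_mul, ← Matrix.mul_kronecker_mul,
    Matrix.one_mul, Matrix.mul_one]

lemma slice_add (σ : Matrix (Qubits n) (Qubits n) ℂ)
    (E F : Matrix (Qubits n × K) (Qubits n × K) ℂ) : slice σ (E + F) = slice σ E + slice σ F := by
  ext k l
  simp [slice, mul_add, Finset.sum_add_distrib]

lemma slice_zero (σ : Matrix (Qubits n) (Qubits n) ℂ) :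
    slice σ (0 : Matrix (Qubits n × K) (Qubits n × K) ℂ) = 0 := by
  ext k l
  simp [slice]

lemma add_slice (σ τ : Matrix (Qubits n) (Qubits n) ℂ)
    (E : Matrix (Qubits n × K) (Qubits n × K) ℂ) : slice (σ + τ) E = slice σ E + slice τ E := by
  ext k l
  simp [slice, add_mul, Finset.sum_add_distrib]

lemma zero_slice (E : Matrix (Qubits n × K) (Qubits n × K) ℂ) :
    slice (0 : Matrix (Qubits n) (Qubits n) ℂ) E = 0 := by
  ext k l
  simp [slice]

/-- The effect of an operation on the state of the register, for the content `μ` of the classical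
memory, summed over the branches. -/
def Op.chan (μ : Mem c) (σ : Matrix (Qubits n) (Qubits n) ℂ) (op : Op n c) :
    Matrix (Qubits n) (Qubits n) ℂ := ((op.branches μ).map fun b => b.2 * σ * b.2ᴴ).sum

/-- An operation that does not write to the classical memory. -/
def Op.KeepsMem (op : Op n c) : Prop := ∀ μ, ∀ b ∈ op.branches μ, b.1 = μ

/-- In the Heisenberg picture, an operation that keeps the classical memory moves from the observable to
the state of the register. -/
lemma slice_dual {op : Op n c} (h : op.KeepsMem) (μ : Mem c) (σ : Matrix (Qubits n) (Qubits n) ℂ)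
    (E : Joint n c K) : slice σ (op.dual E μ) = slice (op.chan μ σ) (E μ) := by
  have h' := h μ
  unfold Op.dual Op.chan
  generalize op.branches μ = L at h'
  induction L with
  | nil => simp [slice_zero, zero_slice]
  | cons b L ih =>
    simp only [List.map_cons, List.sum_cons, slice_add, add_slice, slice_conj]
    rw [ih fun b hb => h' b (List.mem_cons_of_mem _ hb), h' b List.mem_cons_self]

lemma slice_foldr_dual {l : List (Op n c)} (h : ∀ op ∈ l, op.KeepsMem) (μ : Mem c)
    (σ : Matrix (Qubits n) (Qubits n) ℂ) (E : Joint n c K) :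
    slice σ (l.foldr Op.dual E μ) = slice (l.foldl (Op.chan μ) σ) (E μ) := by
  induction l generalizing σ with
  | nil => rfl
  | cons op l ih =>
    rw [List.foldr_cons, List.foldl_cons, slice_dual (h op List.mem_cons_self),
      ih fun op hop => h op (List.mem_cons_of_mem _ hop)]

lemma Cliff.branches_toOp (g : Cliff n) (k : Fin c) (μ : Mem c) :
    (g.toOp k).branches μ = [(μ, if μ k then g.mat else 1)] := by
  cases g <;> rfl

lemma Cliff.keepsMem_toOp (g : Cliff n) (k : Fin c) : (g.toOp k).KeepsMem := by
  intro μ b hb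
  rw [g.branches_toOp] at hb
  rw [List.mem_singleton.1 hb]

lemma Op.keepsMem_reset (k : Fin c) (i : Fin n) : (Op.reset k i).KeepsMem := by
  intro μ b hb
  rw [Op.branches] at hb
  split_ifs at hb <;> aesop

/-- The unitary of a list of controlled gates, for the content `μ` of the classical memory. -/
def umat (μ : Mem c) : List (Fin c × Cliff n) → Matrix (Qubits n) (Qubits n) ℂ
  | [] => 1
  | p :: l => umat μ l * if μ p.1 then p.2.mat else 1

lemma foldl_chan_toOp (μ : Mem c) (l : List (Fin c × Cliff n)) (σ : Matrix (Qubits n) (Qubits n) ℂ) :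
    (l.map fun p => p.2.toOp p.1).foldl (Op.chan μ) σ = umat μ l * σ * (umat μ l)ᴴ := by
  induction l generalizing σ with
  | nil => simp [umat]
  | cons p l ih =>
    rw [List.map_cons, List.foldl_cons, ih, Op.chan, p.2.branches_toOp]
    simp only [umat, List.map_cons, List.map_nil, List.sum_singleton, Matrix.conjTranspose_mul,
      Matrix.mul_assoc]

lemma umat_unitary (μ : Mem c) (l : List (Fin c × Cliff n)) : (umat μ l)ᴴ * umat μ l = 1 := by
  induction l with
  | nil => simp [umat]
  | cons p l ih =>
    rw [umat, Matrix.conjTranspose_mul, Matrix.mul_assoc, ← Matrix.mul_assoc _ (umat μ l), ih,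
      Matrix.one_mul]
    split_ifs
    · exact p.2.unitary
    · simp

lemma umat_congr {μ ν : Mem c} {l : List (Fin c × Cliff n)} (h : ∀ p ∈ l, μ p.1 = ν p.1) :
    umat μ l = umat ν l := by
  induction l with
  | nil => rfl
  | cons p l ih =>
    rw [umat, umat, h p List.mem_cons_self, ih fun q hq => h q (List.mem_cons_of_mem _ hq)]

lemma umat_eq_one {μ : Mem c} {l : List (Fin c × Cliff n)} (h : ∀ p ∈ l, μ p.1 = false) :
    umat μ l = 1 := by
  induction l with
  | nil => rfl
  | cons p l ih =>
    rw [umat, h p List.mem_cons_self, ih fun q hq => h q (List.mem_cons_of_mem _ hq)]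
    simp

lemma mul_single_mul (A : Matrix (Qubits n) (Qubits n) ℂ) (u : Qubits n) :
    A * Matrix.single u u 1 * Aᴴ = Matrix.vecMulVec (fun x => A x u) (star fun x => A x u) := by
  ext x y
  rw [Matrix.mul_apply, Finset.sum_eq_single u]
  · simp [Matrix.vecMulVec_apply]
  · intro z _ hz
    rw [Matrix.mul_single_apply_of_ne _ _ _ _ _ hz, zero_mul]
  · simp

lemma flip_conj_single (i : Fin n) (u : Qubits n) :
    (Cliff.loc .X i).mat * Matrix.single u u 1 * ((Cliff.loc .X i).mat)ᴴ =
      Matrix.single (Function.update u i !u i) (Function.update u i !u i) 1 := by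
  have h : ∀ x, (Cliff.loc .X i).mat x u = if Function.update u i (!u i) = x then 1 else 0 := by
    intro x
    have h1 := sum_onWires_wire i Local.X.mat x fun z => if z = u then 1 else 0
    simp only [mul_ite, mul_one, mul_zero, Finset.sum_ite_eq', Finset.mem_univ, if_true] at h1
    have h2 : (Cliff.loc .X i).mat x u = onWires (wire i) (wireMat Local.X.mat) x u := rfl
    rw [h2, h1]
    simp only [Local.mat]
    have hx : ∀ b, (Function.update x i b = u) ↔ (b = u i ∧ ∀ j, j ≠ i → x j = u j) :=
      fun b => Function.update_eq_iff
    have hu : (Function.update u i (!u i) = x) ↔ ((!u i) = x i ∧ ∀ j, j ≠ i → u j = x j) :=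
      Function.update_eq_iff
    have hc : (∀ j, j ≠ i → u j = x j) ↔ ∀ j, j ≠ i → x j = u j :=
      forall₂_congr fun j _ => eq_comm
    simp only [hx, hu, hc, Fintype.sum_bool]
    cases x i <;> cases u i <;> simp
  rw [mul_single_mul]
  ext x y
  simp only [Matrix.vecMulVec_apply, Pi.star_apply, h, Matrix.single_apply]
  by_cases hx : Function.update u i (!u i) = x <;> by_cases hy : Function.update u i (!u i) = y <;>
    simp [hx, hy]

/-- Controlled bit flips on the wires in `l` map basis states to basis states. -/
lemma umat_flip_conj_single (k : Fin n → Fin c) (μ : Mem c) (l : List (Fin n)) (hl : l.Nodup)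
    (u : Qubits n) :
    umat μ (l.map fun i => (k i, Cliff.loc .X i)) * Matrix.single u u 1 *
        (umat μ (l.map fun i => (k i, Cliff.loc .X i)))ᴴ =
      Matrix.single (fun i => if i ∈ l then xor (u i) (μ (k i)) else u i)
        (fun i => if i ∈ l then xor (u i) (μ (k i)) else u i) 1 := by
  induction l generalizing u with
  | nil => simp [umat]
  | cons i l ih =>
    rw [List.nodup_cons] at hl
    have h1 : (if μ (k i) then (Cliff.loc .X i).mat else 1) * Matrix.single u u 1 *
        (if μ (k i) then (Cliff.loc .X i).mat else 1)ᴴ = Matrix.single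
          (Function.update u i (xor (u i) (μ (k i)))) (Function.update u i (xor (u i) (μ (k i))))
          (1 : ℂ) := by
      cases μ (k i)
      · simp
      · simp [flip_conj_single]
    have h2 := ih hl.2 (Function.update u i (xor (u i) (μ (k i))))
    rw [← h1] at h2
    have h3 : (fun j => if j ∈ l then xor (Function.update u i (xor (u i) (μ (k i))) j) (μ (k j))
        else Function.update u i (xor (u i) (μ (k i))) j) =
        fun j => if j ∈ i :: l then xor (u j) (μ (k j)) else u j := by
      funext j
      by_cases hj : j = i
      · subst hj; simp [hl.1]
      · simp [hj]
    rw [h3] at h2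
    rw [← h2, List.map_cons, umat, Matrix.conjTranspose_mul]
    simp only [Matrix.mul_assoc]

/-! ### Resets -/

lemma ketBra_false_conj (i : Fin n) (b : Bool) (σ : Matrix (Qubits n) (Qubits n) ℂ)
    (x y : Qubits n) : (ketBra i false b * σ * (ketBra i false b)ᴴ) x y =
      if x i = false ∧ y i = false then σ (Function.update x i b) (Function.update y i b) else 0 := by
  have key : ∀ x z : Qubits n, (ketBra i false b : Matrix (Qubits n) (Qubits n) ℂ) x z =
      if z = Function.update x i b ∧ x i = false then 1 else 0 := by
    intro x z
    refine if_congr ⟨?_, ?_⟩ rfl rfl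
    · rintro ⟨rfl, rfl⟩; simp
    · rintro ⟨rfl, hx⟩; simp [← hx]
  have h1 : ∀ z, (ketBra i false b * σ) x z = if x i = false then σ (Function.update x i b) z else 0 := by
    intro z
    rw [Matrix.mul_apply, Finset.sum_eq_single (Function.update x i b)]
    · rw [key]; simp
    · intro w _ hw; rw [key, if_neg fun h => hw h.1, zero_mul]
    · simp
  rw [Matrix.mul_apply, Finset.sum_eq_single (Function.update y i b)]
  · rw [h1, Matrix.conjTranspose_apply, key]
    by_cases hx : x i = false <;> by_cases hy : y i = false <;> simp [hx, hy]
  · intro w _ hw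
    rw [Matrix.conjTranspose_apply, key, if_neg fun h => hw h.1, star_zero, mul_zero]
  · simp

lemma chan_reset_apply {μ : Mem c} {k : Fin c} (hk : μ k = true) (i : Fin n)
    (σ : Matrix (Qubits n) (Qubits n) ℂ) (x y : Qubits n) :
    Op.chan μ σ (.reset k i) x y = if x i = false ∧ y i = false then
      σ (Function.update x i false) (Function.update y i false) +
        σ (Function.update x i true) (Function.update y i true) else 0 := by
  have h := ketBra_false_conj i false σ x y
  have h' := ketBra_false_conj i true σ x y
  simp only [Op.chan, Op.branches, hk, if_true, List.map_cons, List.map_nil, List.sum_cons,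
    List.sum_nil, add_zero, Matrix.add_apply, h, h']
  split_ifs <;> simp

/-- Bit strings are grouped into pairs that differ at position `i`. -/
lemma sum_qubits_split {R : Type*} [AddCommMonoid R] (i : Fin n) (f : Qubits n → R) :
    ∑ x, f x = ∑ x, if x i = false then
      f (Function.update x i false) + f (Function.update x i true) else 0 := by
  have h1 : ∀ x : Qubits n, (if x i = false then
      f (Function.update x i false) + f (Function.update x i true) else 0) =
      (if x i = false then f x else 0) +
        (if x i = false then f (Function.update x i !(x i)) else 0) := by
    intro x
    split_ifs with h
    · rw [h]
      nth_rw 3 [← Function.update_eq_self i x]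
      rw [h]; rfl
    · simp
  simp only [h1, Finset.sum_add_distrib]
  have h2 : ∑ x : Qubits n, (if x i = false then f (Function.update x i !(x i)) else 0) =
      ∑ x : Qubits n, if x i = true then f x else 0 := by
    let e : Qubits n ≃ Qubits n := Function.Involutive.toPerm (fun x => Function.update x i !(x i))
      fun x => by simp
    rw [← e.sum_comp fun x => if x i = true then f x else 0]
    refine Finset.sum_congr rfl fun x _ => ?_
    have : e x = Function.update x i !(x i) := rfl
    rw [this]
    simp
  rw [h2, ← Finset.sum_add_distrib]
  refine Finset.sum_congr rfl fun x _ => ?_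
  cases x i <;> simp

lemma trace_chan_reset {μ : Mem c} {k : Fin c} (hk : μ k = true) (i : Fin n)
    (σ : Matrix (Qubits n) (Qubits n) ℂ) : (Op.chan μ σ (.reset k i)).trace = σ.trace := by
  simp only [Matrix.trace, Matrix.diag, chan_reset_apply hk, and_self]
  exact (sum_qubits_split i fun x => σ x x).symm

/-- Resets one by one: the trace is preserved, and all matrix elements of the result with a bit set at
a reset position vanish. -/
lemma foldl_chan_reset_aux {μ : Mem c} {k : Fin c} (hk : μ k = true) (l : List (Fin n))
    (S : Set (Fin n)) (σ : Matrix (Qubits n) (Qubits n) ℂ)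
    (hσ : ∀ x y : Qubits n, ∀ i ∈ S, (x i = true ∨ y i = true) → σ x y = 0) :
    ((l.map (Op.reset k)).foldl (Op.chan μ) σ).trace = σ.trace ∧
      ∀ x y : Qubits n, ∀ i, (i ∈ S ∨ i ∈ l) → (x i = true ∨ y i = true) →
        (l.map (Op.reset k)).foldl (Op.chan μ) σ x y = 0 := by
  induction l generalizing S σ with
  | nil => exact ⟨rfl, fun x y i hi => hσ x y i (by simpa using hi)⟩
  | cons j l ih =>
    rw [List.map_cons, List.foldl_cons]
    have := ih (insert j S) (Op.chan μ σ (.reset k j)) (by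
      intro x y i hi hxy
      rw [chan_reset_apply hk]
      split_ifs with h
      · have hij : i ≠ j := by
          rintro rfl
          rw [h.1, h.2] at hxy
          simp at hxy
        have hiS : i ∈ S := (Set.mem_insert_iff.1 hi).resolve_left hij
        rw [hσ _ _ i hiS (by simpa [hij] using hxy), hσ _ _ i hiS (by simpa [hij] using hxy),
          add_zero]
      · rfl)
    refine ⟨by rw [this.1, trace_chan_reset hk], fun x y i hi => this.2 x y i ?_⟩
    rw [List.mem_cons] at hi
    rw [Set.mem_insert_iff]
    tauto

/-- Resetting all qubits produces the state `|0⋯0⟩`, whatever the state of the register was. -/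
lemma foldl_chan_reset {μ : Mem c} {k : Fin c} (hk : μ k = true)
    (σ : Matrix (Qubits n) (Qubits n) ℂ) (hσ : σ.trace = 1) :
    ((List.finRange n).map (Op.reset k)).foldl (Op.chan μ) σ = zeroState n := by
  obtain ⟨h1, h2⟩ := foldl_chan_reset_aux hk (List.finRange n) ∅ σ (by simp)
  generalize ((List.finRange n).map (Op.reset k)).foldl (Op.chan μ) σ = τ at h1 h2
  have h0 : ∀ x y : Qubits n, ¬ (x = (fun _ => false) ∧ y = fun _ => false) → τ x y = 0 := by
    intro x y hxy
    by_contra hne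
    have : ∀ i, x i = false ∧ y i = false := fun i => by
      by_contra hc
      refine hne (h2 x y i (Or.inr (List.mem_finRange i)) ?_)
      cases hx : x i <;> cases hy : y i <;> simp_all
    exact hxy ⟨funext fun i => (this i).1, funext fun i => (this i).2⟩
  have ht : τ (fun _ => false) (fun _ => false) = 1 := by
    rw [← hσ, ← h1, Matrix.trace, Finset.sum_eq_single (fun _ => false)]
    · rfl
    · intro x _ hx
      exact h0 x x fun h => hx h.1
    · simp
  ext x y
  rw [zeroState, Matrix.single_apply]
  split_ifs with h
  · rw [← h.1, ← h.2]; exact ht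
  · exact h0 x y fun hc => h ⟨hc.1.symm, hc.2.symm⟩

lemma foldl_chan_reset_false {μ : Mem c} {k : Fin c} (hk : μ k = false)
    (σ : Matrix (Qubits n) (Qubits n) ℂ) (l : List (Fin n)) :
    (l.map (Op.reset k)).foldl (Op.chan μ) σ = σ := by
  induction l with
  | nil => rfl
  | cons i l ih =>
    rw [List.map_cons, List.foldl_cons]
    have : Op.chan μ σ (.reset k i) = σ := by simp [Op.chan, Op.branches, hk]
    rw [this, ih]

end Register

/-! ### Averages over the coins of a random circuit -/

section CoinAverages

variable {n c : ℕ}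

/-- The coins of a list of controlled gates: the control bits of the gates that are random. -/
def coinsOf (l : List (Fin c × Cliff n)) : List (Fin c) :=
  (l.filter fun p => p.2.isRandom).map Prod.fst

/-- The average over the control bits of a controlled circuit is the average over the random circuit.
The control bit `o` is set, and belongs to the gates that are always applied. -/
lemma coinAvg_umat (o : Fin c) (l : List (Fin c × Cliff n)) (hl : (coinsOf l).Nodup)
    (ho : o ∉ coinsOf l) (hd : ∀ p ∈ l, p.2.isRandom = false → p.1 = o) {μ : Mem c}
    (hμ : μ o = true) (φ : Matrix (Qubits n) (Qubits n) ℂ → ℝ) (A : Matrix (Qubits n) (Qubits n) ℂ) :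
    coinAvg (coinsOf l) (fun ν => φ (umat ν l * A)) μ = circuitAvg (l.map Prod.snd) φ A := by
  induction l generalizing μ A with
  | nil => simp [coinsOf, coinAvg, umat, circuitAvg]
  | cons p l ih =>
    obtain ⟨k, g⟩ := p
    have hd' : ∀ p ∈ l, p.2.isRandom = false → p.1 = o := fun p hp => hd p (List.mem_cons_of_mem _ hp)
    cases hg : g.isRandom with
    | true =>
      have e : coinsOf ((k, g) :: l) = k :: coinsOf l := by simp [coinsOf, hg]
      rw [e] at hl ho ⊢
      rw [List.nodup_cons] at hl
      rw [List.mem_cons, not_or] at ho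
      have key : ∀ b, coinAvg (coinsOf l) (fun ν => φ (umat ν ((k, g) :: l) * A))
          (Function.update μ k b) =
          circuitAvg (l.map Prod.snd) φ ((if b then g.mat else 1) * A) := by
        intro b
        rw [← ih hl.2 ho.2 hd' (μ := Function.update μ k b) (by
          rw [Function.update_of_ne ho.1, hμ])]
        refine coinAvg_congr fun ν hν => ?_
        have : ν k = b := by rw [hν k hl.1]; simp
        simp only [umat, this, Matrix.mul_assoc]
      simp only [coinAvg, key, List.map_cons, circuitAvg, hg, if_true, smul_eq_mul,
        Bool.false_eq_true, if_false, Matrix.one_mul]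
    | false =>
      have e : coinsOf ((k, g) :: l) = coinsOf l := by simp [coinsOf, hg]
      rw [e] at hl ho ⊢
      have hk : k = o := hd (k, g) List.mem_cons_self hg
      simp only [List.map_cons, circuitAvg, hg, Bool.false_eq_true, if_false]
      rw [← ih hl ho hd' hμ]
      refine coinAvg_congr fun ν hν => ?_
      have : ν k = true := by rw [hk, hν o ho, hμ]
      simp only [umat, this, if_true, Matrix.mul_assoc]

/-- Independent fair coins take prescribed values with probability `2 ^ (-l.length)`. -/
lemma coinAvg_indicator {I : Type} (k : I → Fin c) (l : List I) (hl : (l.map k).Nodup)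
    (v : I → Bool) (μ : Mem c) :
    coinAvg (l.map k) (fun ν => if ∀ i ∈ l, ν (k i) = v i then (1 : ℝ) else 0) μ =
      (1 / 2) ^ l.length := by
  induction l generalizing μ with
  | nil => simp [coinAvg]
  | cons i l ih =>
    rw [List.map_cons, List.nodup_cons] at hl
    have key : ∀ b, coinAvg (l.map k) (fun ν => if ∀ j ∈ i :: l, ν (k j) = v j then (1 : ℝ) else 0)
        (Function.update μ (k i) b) = if b = v i then (1 / 2) ^ l.length else 0 := by
      intro b
      have hb : ∀ ν : Mem c, (∀ j, j ∉ l.map k → ν j = Function.update μ (k i) b j) → ν (k i) = b :=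
        fun ν hν => by rw [hν _ hl.1]; simp
      split_ifs with h
      · rw [← ih hl.2 (Function.update μ (k i) b)]
        refine coinAvg_congr fun ν hν => ?_
        simp only [List.forall_mem_cons, hb ν hν, h, true_and]
      · refine (coinAvg_congr fun ν hν => ?_).trans
          (coinAvg_const (l.map k) (0 : ℝ) (Function.update μ (k i) b))
        simp only [List.forall_mem_cons, hb ν hν, h, false_and, if_false]
    simp only [List.map_cons, coinAvg, key]
    cases v i <;> simp [pow_succ, mul_comm]

/-- A uniformly random basis state is maximally mixed. -/
lemma coinAvg_single (k : Fin n → Fin c) (hk : Function.Injective k) (μ : Mem c) :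
    coinAvg ((List.finRange n).map k)
      (fun ν => Matrix.single (fun i => ν (k i)) (fun i => ν (k i)) (1 : ℂ)) μ = (mixed n).1 := by
  ext x y
  let f : Matrix (Qubits n) (Qubits n) ℂ →ₗ[ℝ] ℂ :=
    { toFun := fun A => A x y, map_add' := fun _ _ => rfl, map_smul' := fun _ _ => rfl }
  have h := coinAvg_map f ((List.finRange n).map k)
    (fun ν => Matrix.single (fun i => ν (k i)) (fun i => ν (k i)) (1 : ℂ)) μ
  refine h.trans ?_
  have hf : ∀ ν : Mem c, f (Matrix.single (fun i => ν (k i)) (fun i => ν (k i)) (1 : ℂ)) =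
      ((if x = y then 1 else 0 : ℝ) : ℂ) *
        ((if ∀ i ∈ List.finRange n, ν (k i) = x i then (1 : ℝ) else 0 : ℝ) : ℂ) := by
    intro ν
    have e : (∀ i ∈ List.finRange n, ν (k i) = x i) ↔ (fun i => ν (k i)) = x :=
      ⟨fun h => funext fun i => h i (List.mem_finRange i), fun h i _ => congrFun h i⟩
    change Matrix.single (fun i => ν (k i)) (fun i => ν (k i)) (1 : ℂ) x y = _
    rw [Matrix.single_apply]
    simp only [e]
    by_cases h1 : (fun i => ν (k i)) = x
    · by_cases h2 : x = y
      · subst h2; simp [h1]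
      · have : ¬ (fun i => ν (k i)) = y := fun h => h2 (h1.symm.trans h)
        simp [h2, this]
    · simp [h1]
  simp only [hf]
  let g : ℝ →ₗ[ℝ] ℂ :=
    { toFun := fun a => ((if x = y then 1 else 0 : ℝ) : ℂ) * (a : ℂ)
      map_add' := fun a b => by push_cast; ring
      map_smul' := fun a b => by simp; ring }
  have h2 := coinAvg_map g ((List.finRange n).map k)
    (fun ν => if ∀ i ∈ List.finRange n, ν (k i) = x i then (1 : ℝ) else 0) μ
  refine (h2.symm).trans ?_
  have h3 := coinAvg_indicator k _ ((List.nodup_finRange n).map hk) x μ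
  rw [List.length_finRange] at h3
  refine (congrArg g (Eq.trans ?_ h3)).trans ?_
  · congr!
  simp only [g, LinearMap.coe_mk, AddHom.coe_mk, mixed, Matrix.smul_apply, Matrix.one_apply,
    smul_eq_mul]
  split_ifs <;> simp

end CoinAverages

/-! ### The program of the verifier -/

/-- The classical bits of the verifier: a constant, the secret bit of a round, the answer of the
prover, a carry and a temporary bit, the results of the two tests, the abort bit, the unary counters
of wins in the two tests, the random basis states (as drawn, and as applied), and the coins of the
random circuit. -/
inductive VBit (n T D : ℕ) : Type
  | one | secret | ans | car | tmp | abort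
  | acc (b : Bool)
  | cnt (b : Bool) (i : Fin T)
  | x (h : Bool) (i : Fin n)
  | y (h : Bool) (i : Fin n)
  | coin (t : Fin D) (i : Fin n)
  deriving Fintype

/-- Number of classical bits of the verifier. -/
def memSize (n T D : ℕ) : ℕ := Fintype.card (VBit n T D)

/-- The address of a classical bit. -/
def bit {n T D : ℕ} (v : VBit n T D) : Fin (memSize n T D) := Fintype.equivFin _ v

lemma bit_injective (n T D : ℕ) : Function.Injective (bit : VBit n T D → _) :=
  (Fintype.equivFin _).injective

@[simp] lemma bit_inj {n T D : ℕ} {v w : VBit n T D} : bit v = bit w ↔ v = w :=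
  (bit_injective n T D).eq_iff

/-- The qubit that labels the coin of a gate. -/
def Cliff.qubit {n : ℕ} : Cliff n → Fin n
  | .loc _ i => i
  | .cz i _ _ => i

section Program

variable {n : ℕ} (T : ℕ) (ks : List LayerKind)

/-- A layer of the random circuit, with the control bits of its gates. -/
def circuitLayer (t : Fin ks.length) : List (Fin (memSize n T ks.length) × Cliff n) :=
  ((ks.get t).gates n).map fun g =>
    (bit (if g.isRandom then .coin t g.qubit else .one : VBit n T ks.length), g)

/-- The random circuit, with the control bits of its gates. -/
def circuit : List (Fin (memSize n T ks.length) × Cliff n) :=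
  (List.finRange ks.length).flatMap (circuitLayer T ks)

/-- The bit flips that prepare a random basis state. -/
def flips (h : Bool) : List (Fin (memSize n T ks.length) × Cliff n) :=
  (List.finRange n).map fun i => (bit (.y h i), .loc .X i)

/-- The layers that turn a copy of the unknown state into one of the two qudits of a round: a copy of
the unknown state if the secret bit is `0`, and a basis state if it is `1`, followed by the random
circuit. -/
def blockLayers (h : Bool) : List (List (Op n (memSize n T ks.length))) :=
  (List.finRange n).map (Op.reset (bit .secret)) ::
  ((flips T ks h).map fun p => p.2.toOp p.1) ::
  (List.finRange ks.length).map fun t => (circuitLayer T ks t).map fun p => p.2.toOp p.1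

/-- Prepare one of the two qudits of a round and send it. -/
def block (h : Bool) : List (Instr n (memSize n T ks.length)) :=
  .query :: ((blockLayers T ks h).map .layer ++ [.send])

/-- The step at position `i` of the insertion of the carry bit into a unary counter. -/
def carryOps (p : Bool) (i : Fin T) : List (Instr n (memSize n T ks.length)) :=
  [.layer [.bool (bit .tmp) (bit (.cnt p i)) (bit .car) (· && ·)],
   .layer [.bool (bit (.cnt p i)) (bit (.cnt p i)) (bit .car) (· || ·)],
   .layer [.bool (bit .car) (bit .tmp) (bit .tmp) (· && ·)]]

/-- Receive the answer, compare it with the secret bit and update the counter of the test `p`. -/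
def scoring (p : Bool) : List (Instr n (memSize n T ks.length)) :=
  .recv (bit .ans) ::
  .layer [.bool (bit .car) (bit .ans) (bit .secret) fun a c => xor (xor a c) p] ::
  (List.finRange T).flatMap (carryOps T ks p)

/-- The coins of a round. -/
def coinBits : List (Fin (memSize n T ks.length)) :=
  bit .secret :: (coinsOf (circuit (n := n) T ks) ++ ((List.finRange n).map (fun i => bit (.x false i)) ++
    (List.finRange n).map (fun i => bit (.x true i))))

/-- The bits `(k, i, j)` such that `i` and `j` are combined into `k` to determine the basis state. -/
def flipBits : List (Fin (memSize n T ks.length) × Fin (memSize n T ks.length) ×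
    Fin (memSize n T ks.length)) :=
  (List.finRange n).map (fun i => (bit (.y false i), bit (.x false i), bit .secret)) ++
    (List.finRange n).map (fun i => (bit (.y true i), bit (.x true i), bit .secret))

/-- One round of the test `p`.  The prover has to distinguish two copies of the unknown state from
two copies of a random pure state (`p = false`) or of the maximally mixed state (`p = true`). -/
def round (p : Bool) : List (Instr n (memSize n T ks.length)) :=
  .layer [.bool (bit .one) (bit .one) (bit .one) fun _ _ => true] ::
  .layer ((coinBits T ks).map .coin) ::
  .layer ((flipBits T ks).map fun q => .bool q.1 q.2.1 q.2.2 fun a c => a && c && p) ::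
  (block T ks false ++ (block T ks true ++ scoring T ks p))

end Program

/-! ### Classical operations in the Heisenberg picture -/

section Classical

variable {n c : ℕ} {K : Type} [Fintype K] [DecidableEq K]

/-- Write `f` of the bits `i` and `j` to `k`, for all triples `(k, i, j)` of a list. -/
def boolMap (f : Bool → Bool → Bool) (L : List (Fin c × Fin c × Fin c)) (μ : Mem c) : Mem c :=
  L.foldl (fun ν q => Function.update ν q.1 (f (ν q.2.1) (ν q.2.2))) μ

lemma foldr_dual_bool (f : Bool → Bool → Bool) (L : List (Fin c × Fin c × Fin c))
    (E : Joint n c K) : (L.map fun q => Op.bool q.1 q.2.1 q.2.2 f).foldr Op.dual E =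
      fun μ => E (boolMap f L μ) := by
  induction L with
  | nil => rfl
  | cons q L ih => rw [List.map_cons, List.foldr_cons, ih, Op.dual_bool]; rfl

lemma boolMap_of_notMem (f : Bool → Bool → Bool) {L : List (Fin c × Fin c × Fin c)} {k : Fin c}
    (hk : k ∉ L.map Prod.fst) (μ : Mem c) : boolMap f L μ k = μ k := by
  induction L generalizing μ with
  | nil => rfl
  | cons q L ih =>
    rw [List.map_cons, List.mem_cons, not_or] at hk
    refine (ih hk.2 _).trans ?_
    dsimp only
    rw [Function.update_of_ne hk.1]

lemma boolMap_of_mem (f : Bool → Bool → Bool) {L : List (Fin c × Fin c × Fin c)}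
    (hL : (L.map Prod.fst).Nodup) (hr : ∀ q ∈ L, q.2.1 ∉ L.map Prod.fst ∧ q.2.2 ∉ L.map Prod.fst)
    {q : Fin c × Fin c × Fin c} (hq : q ∈ L) (μ : Mem c) :
    boolMap f L μ q.1 = f (μ q.2.1) (μ q.2.2) := by
  induction L generalizing μ with
  | nil => simp at hq
  | cons q' L ih =>
    rw [List.map_cons, List.nodup_cons] at hL
    have hq' := hr q hq
    rw [List.map_cons, List.mem_cons, not_or, List.mem_cons, not_or] at hq'
    rcases List.mem_cons.1 hq with rfl | hqL
    · refine (boolMap_of_notMem f hL.1 _).trans ?_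
      dsimp only
      rw [Function.update_self]
    · refine (ih hL.2 (fun q'' h'' => ?_) hqL _).trans ?_
      · have := hr q'' (List.mem_cons_of_mem _ h'')
        rw [List.map_cons, List.mem_cons, not_or, List.mem_cons, not_or] at this
        exact ⟨this.1.2, this.2.2⟩
      · dsimp only
        rw [Function.update_of_ne hq'.1.1, Function.update_of_ne hq'.2.1]

lemma programDual_layers (ρ : State (Qubits n)) (P : Prover n) (L : List (List (Op n c)))
    (p : List (Instr n c)) (s r : ℕ) (E : Joint n c P.K) :
    programDual ρ P (L.map .layer ++ p) s r E =
      L.flatten.foldr Op.dual (programDual ρ P p s r E) := by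
  induction L with
  | nil => rfl
  | cons l L ih => simp only [List.map_cons, List.cons_append, programDual, ih, List.flatten_cons,
      List.foldr_append]

end Classical

/-! ### Scoring -/

section Scoring

variable {n T : ℕ} {ks : List LayerKind}

/-- The effect of `carryOps` on the classical memory. -/
def carryStep (p : Bool) (μ : Mem (memSize n T ks.length)) (i : Fin T) :
    Mem (memSize n T ks.length) :=
  Function.update (Function.update (Function.update μ (bit .tmp) (μ (bit (.cnt p i)) && μ (bit .car)))
    (bit (.cnt p i)) (μ (bit (.cnt p i)) || μ (bit .car)))
    (bit .car) (μ (bit (.cnt p i)) && μ (bit .car))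

lemma programDual_carryOps (ρ : State (Qubits n)) (P : Prover n) (p : Bool) (l : List (Fin T))
    (s r : ℕ) (E : Joint n (memSize n T ks.length) P.K) :
    programDual ρ P (l.flatMap (carryOps T ks p)) s r E = fun μ => E (l.foldl (carryStep p) μ) := by
  induction l with
  | nil => rfl
  | cons i l ih =>
    rw [List.flatMap_cons, carryOps]
    simp only [List.cons_append, List.nil_append, programDual, List.foldr_cons, List.foldr_nil, ih,
      Op.dual_bool, List.foldl_cons]
    funext μ
    congr 2
    unfold carryStep
    simp

/-- The counters: the number of bits set in each of the two unary counters. -/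
def counts (μ : Mem (memSize n T ks.length)) (p : Bool) : ℕ :=
  (List.finRange T).countP fun i => μ (bit (.cnt p i))

lemma foldl_carryStep_cnt (p : Bool) {l : List (Fin T)} {b : Bool} {j : Fin T}
    (h : b = p → j ∉ l) (μ : Mem (memSize n T ks.length)) :
    l.foldl (carryStep p) μ (bit (.cnt b j)) = μ (bit (.cnt b j)) := by
  induction l generalizing μ with
  | nil => rfl
  | cons i l ih =>
    rw [List.foldl_cons, ih fun hb => fun hj => h hb (List.mem_cons_of_mem _ hj)]
    have : ¬ (b = p ∧ j = i) := fun hc => h hc.1 (hc.2 ▸ List.mem_cons_self)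
    simp [carryStep, this]

/-- The carry bit is inserted at the first free position of a unary counter, and is lost if there is
none. -/
lemma countP_foldl_carryStep (p : Bool) {l : List (Fin T)} (hl : l.Nodup)
    (μ : Mem (memSize n T ks.length)) :
    l.countP (fun i => l.foldl (carryStep p) μ (bit (.cnt p i))) =
      min l.length (l.countP (fun i => μ (bit (.cnt p i))) + (μ (bit .car)).toNat) := by
  induction l generalizing μ with
  | nil => simp
  | cons i l ih =>
    rw [List.nodup_cons] at hl
    have h1 := ih hl.2 (carryStep p μ i)
    have h2 : l.countP (fun j => carryStep p μ i (bit (.cnt p j))) =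
        l.countP (fun j => μ (bit (.cnt p j))) := by
      refine List.countP_congr fun j hj => ?_
      have : j ≠ i := fun e => hl.1 (e ▸ hj)
      simp [carryStep, this]
    have h3 : carryStep p μ i (bit .car) = (μ (bit (.cnt p i)) && μ (bit .car)) := by
      simp [carryStep]
    have h4 : carryStep p μ i (bit (.cnt p i)) = (μ (bit (.cnt p i)) || μ (bit .car)) := by
      simp [carryStep]
    have h5 := List.countP_le_length (p := fun j => μ (bit (.cnt p j))) (l := l)
    rw [h2, h3] at h1
    rw [List.countP_cons, List.countP_cons, List.foldl_cons, h1,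
      foldl_carryStep_cnt p fun _ => hl.1, h4, List.length_cons]
    cases μ (bit (.cnt p i)) <;> cases μ (bit .car) <;> simp
    omega

/-- The effect of the scoring on the classical memory if the prover answers `a`. -/
def scoreMap (p : Bool) (μ : Mem (memSize n T ks.length)) (a : Bool) :
    Mem (memSize n T ks.length) :=
  (List.finRange T).foldl (carryStep p) (Function.update (Function.update μ (bit .ans) a) (bit .car)
    (xor (xor a (μ (bit .secret))) p))

lemma counts_scoreMap (p : Bool) (μ : Mem (memSize n T ks.length)) (a : Bool) :
    counts (scoreMap p μ a) = if xor (xor a (μ (bit .secret))) p then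
      Function.update (counts μ) p (min T (counts μ p + 1)) else counts μ := by
  funext b
  by_cases hb : b = p
  · subst hb
    have h := countP_foldl_carryStep b (List.nodup_finRange T) (Function.update
      (Function.update μ (bit .ans) a) (bit .car) (xor (xor a (μ (bit .secret))) b))
    have e : counts (scoreMap b μ a) b = (List.finRange T).countP fun i =>
      (List.finRange T).foldl (carryStep b) (Function.update (Function.update μ (bit .ans) a)
        (bit .car) (xor (xor a (μ (bit .secret))) b)) (bit (.cnt b i)) := rfl
    have e' : (List.finRange T).countP (fun i => Function.update
        (Function.update μ (bit .ans) a) (bit .car) (xor (xor a (μ (bit .secret))) b)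
          (bit (.cnt b i))) = counts μ b := by
      simp [counts]
    rw [e, h, e', Function.update_self, List.length_finRange]
    have h5 : counts μ b ≤ T :=
      (List.countP_le_length (l := List.finRange T)).trans_eq (List.length_finRange)
    cases xor (xor a (μ (bit .secret))) b
    · simpa using h5
    · simp
  · have e : counts (scoreMap p μ a) b = counts μ b := by
      refine List.countP_congr fun i _ => ?_
      rw [scoreMap, foldl_carryStep_cnt p fun h => absurd h hb]
      simp
    rw [e]
    split_ifs
    · rw [Function.update_of_ne hb]
    · rfl

/-- The observable of the memory before the prover's answer is received. -/
lemma programDual_scoring (ρ : State (Qubits n)) (P : Prover n) (p : Bool) (s r : ℕ)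
    (F : Mem (memSize n T ks.length) → ℝ) :
    programDual ρ P (scoring T ks p) s r (fun μ => (F μ : ℂ) • 1) = fun μ =>
      (1 : Matrix (Qubits n) (Qubits n) ℂ) ⊗ₖ
        ∑ a, (F (scoreMap p μ a) : ℂ) • (P.answer r).dual a 1 := by
  funext μ
  simp only [scoring, programDual, programDual_carryOps, List.foldr_cons, List.foldr_nil,
    Op.dual_bool, recvDual]
  have hk : ∀ X Y : Matrix P.K P.K ℂ, (1 : Matrix (Qubits n) (Qubits n) ℂ) ⊗ₖ (X + Y) =
      1 ⊗ₖ X + 1 ⊗ₖ Y := fun X Y => Matrix.kronecker_add 1 X Y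
  have hs : ∀ (ι : Type) (S : Finset ι) (f : ι → Matrix P.K P.K ℂ),
      (1 : Matrix (Qubits n) (Qubits n) ℂ) ⊗ₖ (∑ i ∈ S, f i) = ∑ i ∈ S, 1 ⊗ₖ f i := by
    intro ι S f
    classical
    induction S using Finset.induction_on with
    | empty => simp
    | insert i S hi ih => rw [Finset.sum_insert hi, Finset.sum_insert hi, hk, ih]
  rw [hs]
  refine Finset.sum_congr rfl fun a _ => ?_
  rw [Matrix.kronecker_smul, Instrument.dual, hs, Finset.smul_sum]
  refine Finset.sum_congr rfl fun i _ => ?_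
  rw [Matrix.mul_smul, Matrix.smul_mul, Matrix.mul_one, Matrix.conjTranspose_kronecker,
    Matrix.conjTranspose_one, ← Matrix.mul_kronecker_mul, Matrix.one_mul, Matrix.mul_one]
  simp [scoreMap]

end Scoring

/-! ### One round of the interaction -/

section Round

variable {n T : ℕ} {ks : List LayerKind}

/-- The state of the qudit that is sent in a block. -/
def sentState (ρ : State (Qubits n)) (h : Bool) (μ : Mem (memSize n T ks.length)) :
    Matrix (Qubits n) (Qubits n) ℂ :=
  umat μ (circuit T ks) * (umat μ (flips T ks h) * (if μ (bit .secret) then zeroState n else ρ.1) *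
    (umat μ (flips T ks h))ᴴ) * (umat μ (circuit T ks))ᴴ

lemma trace_zeroState : (zeroState n).trace = 1 := (zeros_isState _).2

/-- An observable of the prover's memory and the classical memory, pulled back through a block. -/
lemma programDual_block (ρ : State (Qubits n)) (P : Prover n) (h : Bool)
    (p : List (Instr n (memSize n T ks.length))) (s r : ℕ) (E : Joint n (memSize n T ks.length) P.K)
    (Y : Mem (memSize n T ks.length) → Matrix P.K P.K ℂ)
    (hY : programDual ρ P p (s + 1) r E = fun μ => 1 ⊗ₖ Y μ) :
    programDual ρ P (block T ks h ++ p) s r E = fun μ =>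
      1 ⊗ₖ slice (sentState ρ h μ) ((P.absorb s).dual () (Y μ)) := by
  have e0 : block T ks h ++ p = .query :: ((blockLayers T ks h).map .layer ++ (.send :: p)) := by
    simp [block]
  rw [e0]
  funext μ
  rw [programDual, programDual_layers, programDual]
  simp only [hY, slice_one_kronecker, trace_zeroState, one_smul]
  congr 1
  rw [slice_foldr_dual]
  · congr 1
    have e1 : ((List.finRange ks.length).map fun t =>
        (circuitLayer (n := n) T ks t).map fun p => p.2.toOp p.1).flatten =
        (circuit T ks).map fun p => p.2.toOp p.1 := by
      rw [circuit, List.map_flatMap]; rfl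
    rw [blockLayers, List.flatten_cons, List.flatten_cons, e1, List.foldl_append, List.foldl_append,
      foldl_chan_toOp, foldl_chan_toOp, sentState]
    cases hs : μ (bit .secret) with
    | true => rw [foldl_chan_reset hs _ ρ.2.2, if_pos rfl]
    | false => rw [foldl_chan_reset_false hs, if_neg Bool.false_ne_true]
  · intro op hop
    rw [blockLayers, List.flatten_cons, List.flatten_cons, List.mem_append, List.mem_append,
      List.mem_flatten] at hop
    rcases hop with hop | hop | ⟨l, hl, hop⟩
    · obtain ⟨i, _, rfl⟩ := List.mem_map.1 hop
      exact Op.keepsMem_reset _ _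
    · obtain ⟨q, _, rfl⟩ := List.mem_map.1 hop
      exact q.2.keepsMem_toOp _
    · obtain ⟨t, _, rfl⟩ := List.mem_map.1 hl
      obtain ⟨q, _, rfl⟩ := List.mem_map.1 hop
      exact q.2.keepsMem_toOp _

/-- The probability that the prover, with memory in the unnormalized state `κ`, receives two qudits
in the states `σ` and `τ` and then answers `a`. -/
def pairProb (P : Prover n) (s r : ℕ) (κ : Matrix P.K P.K ℂ) (a : Bool)
    (σ τ : Matrix (Qubits n) (Qubits n) ℂ) : ℝ :=
  ((P.answer r).apply a ((P.absorb (s + 1)).apply () (τ ⊗ₖ (P.absorb s).apply () (σ ⊗ₖ κ)))).trace.re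

lemma Instrument.trace_apply_unit {I J : Type} [Fintype I] [Fintype J] [DecidableEq I]
    (M : Instrument Unit I J) (σ : Matrix I I ℂ) : (M.apply () σ).trace = σ.trace := by
  simpa using M.sum_trace_apply σ

/-- The prover always answers. -/
lemma pairProb_add (P : Prover n) (s r : ℕ) (κ : Matrix P.K P.K ℂ) (a : Bool)
    {σ τ : Matrix (Qubits n) (Qubits n) ℂ} (hσ : σ.trace = 1) (hτ : τ.trace = 1) :
    pairProb P s r κ a σ τ + pairProb P s r κ (!a) σ τ = κ.trace.re := by
  have h := (P.answer r).sum_trace_apply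
    ((P.absorb (s + 1)).apply () (τ ⊗ₖ (P.absorb s).apply () (σ ⊗ₖ κ)))
  rw [Instrument.trace_apply_unit, Matrix.trace_kronecker, Instrument.trace_apply_unit,
    Matrix.trace_kronecker, hσ, hτ, one_mul, one_mul, Fintype.sum_bool] at h
  have h' := congrArg Complex.re h
  rw [Complex.add_re] at h'
  cases a
  · rw [add_comm]; exact h'
  · exact h'

lemma coinAvg_add {c : ℕ} {V : Type*} [AddCommGroup V] [Module ℝ V] (l : List (Fin c))
    (E F : Mem c → V) (μ : Mem c) :
    coinAvg l (fun ν => E ν + F ν) μ = coinAvg l E μ + coinAvg l F μ := by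
  induction l generalizing μ with
  | nil => rfl
  | cons k l ih => simp only [coinAvg, ih, ← smul_add]; congr 1; abel

lemma coinAvg_const_mul {c : ℕ} (l : List (Fin c)) (a : ℝ) (E : Mem c → ℝ) (μ : Mem c) :
    coinAvg l (fun ν => a * E ν) μ = a * coinAvg l E μ :=
  (coinAvg_map (LinearMap.mulLeft ℝ a) l E μ).symm

/-- The circuit of gates on the register, without control bits. -/
lemma map_snd_circuit : (circuit (n := n) T ks).map Prod.snd = gatesOf n ks := by
  have h : ∀ t, (circuitLayer (n := n) T ks t).map Prod.snd = (ks.get t).gates n := by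
    intro t
    rw [circuitLayer, List.map_map]
    exact List.map_id _
  rw [circuit, List.map_flatMap, gatesOf]
  simp only [h]
  rw [← List.flatMap_map ks.get (LayerKind.gates n), List.map_get_finRange]

lemma coin_of_mem_circuit {p : Fin (memSize n T ks.length) × Cliff n} (hp : p ∈ circuit T ks) :
    (p.2.isRandom = false ∧ p.1 = bit .one) ∨ ∃ t, p.1 = bit (.coin t p.2.qubit) := by
  rw [circuit, List.mem_flatMap] at hp
  obtain ⟨t, _, hp⟩ := hp
  obtain ⟨g, _, rfl⟩ := List.mem_map.1 hp
  dsimp only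
  cases h : g.isRandom
  · left; simp
  · right; exact ⟨t, by simp⟩

lemma coin_of_mem_coinsOf {k : Fin (memSize n T ks.length)} (hk : k ∈ coinsOf (circuit T ks)) :
    ∃ t i, k = bit (.coin t i) := by
  obtain ⟨p, hp, rfl⟩ := List.mem_map.1 hk
  rw [List.mem_filter] at hp
  rcases coin_of_mem_circuit hp.1 with h | ⟨t, h⟩
  · rw [h.1] at hp; simp at hp
  · exact ⟨t, _, h⟩

/-- In each layer, the gates have different labels. -/
lemma nodup_map_qubit (k : LayerKind) : ((k.gates n).map Cliff.qubit).Nodup := by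
  cases k with
  | loc k =>
    rw [LayerKind.gates, List.map_map]
    have : Cliff.qubit ∘ Cliff.loc k = (id : Fin n → Fin n) := rfl
    rw [this, List.map_id]
    exact List.nodup_finRange n
  | cz t p =>
    rw [LayerKind.gates, List.map_filterMap]
    refine List.Nodup.filterMap ?_ (List.nodup_finRange n)
    intro i j q hi hj
    rw [Option.mem_def, Option.map_eq_some_iff] at hi hj
    obtain ⟨a, ha, ha'⟩ := hi
    obtain ⟨b, hb, hb'⟩ := hj
    split_ifs at ha hb
    rw [Option.some.injEq] at ha hb
    subst ha hb
    exact ha'.trans hb'.symm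

lemma nodup_coinsOf_circuit : (coinsOf (circuit (n := n) T ks)).Nodup := by
  have h : coinsOf (circuit (n := n) T ks) = (List.finRange ks.length).flatMap fun t =>
      (((ks.get t).gates n).filter Cliff.isRandom).map fun g =>
        (bit (.coin t g.qubit : VBit n T ks.length)) := by
    rw [coinsOf, circuit, List.filter_flatMap, List.map_flatMap]
    refine List.flatMap_congr fun t _ => ?_
    rw [circuitLayer, List.filter_map, List.map_map]
    refine List.map_congr_left fun g hg => ?_
    have : g.isRandom = true := by simpa using (List.mem_filter.1 hg).2
    simp [this]
  rw [h, List.nodup_flatMap]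
  constructor
  · intro t _
    have h1 : (((ks.get t).gates n).filter Cliff.isRandom).map (fun g =>
        (bit (.coin t g.qubit : VBit n T ks.length))) =
        ((((ks.get t).gates n).filter Cliff.isRandom).map Cliff.qubit).map fun i =>
          bit (.coin t i : VBit n T ks.length) := by
      rw [List.map_map]; rfl
    rw [h1]
    refine List.Nodup.map (fun i j hij => by simpa using hij) ?_
    exact (nodup_map_qubit (ks.get t)).sublist (List.filter_sublist.map _)
  · refine (List.nodup_finRange _).imp_of_mem ?_
    intro t t' _ _ hne
    rw [Function.onFun, List.disjoint_left]
    intro k hk hk'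
    obtain ⟨g, _, rfl⟩ := List.mem_map.1 hk
    obtain ⟨g', _, hg'⟩ := List.mem_map.1 hk'
    simp only [bit_inj, VBit.coin.injEq] at hg'
    exact hne hg'.1.symm

/-! ### The two qudits of a round as a joint system -/

lemma Instrument.apply_add {O I J : Type} [Fintype O] [Fintype I] [Fintype J] [DecidableEq I]
    (M : Instrument O I J) (o : O) (σ τ : Matrix I I ℂ) :
    M.apply o (σ + τ) = M.apply o σ + M.apply o τ := by
  simp only [Instrument.apply, Matrix.mul_add, Matrix.add_mul, Finset.sum_add_distrib]

lemma Instrument.apply_smul {O I J : Type} [Fintype O] [Fintype I] [Fintype J] [DecidableEq I]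
    (M : Instrument O I J) (o : O) (a : ℝ) (σ : Matrix I I ℂ) :
    M.apply o (a • σ) = a • M.apply o σ := by
  simp only [Instrument.apply, Matrix.mul_smul, Matrix.smul_mul, Finset.smul_sum]

/-- Exchange the order of the two qudits such that the second one is absorbed last. -/
def pairEquiv (Q K : Type) : Q × (Q × K) ≃ (Q × Q) × K where
  toFun z := ((z.2.1, z.1), z.2.2)
  invFun z := (z.1.2, (z.1.1, z.2))
  left_inv _ := rfl
  right_inv _ := rfl

/-- The state of the second qudit and the memory of the prover that has absorbed the first qudit. -/
def absorbFirst {K : Type} [Fintype K] [DecidableEq K] (M : Instrument Unit (Qubits n × K) K)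
    (X : Matrix ((Qubits n × Qubits n) × K) ((Qubits n × Qubits n) × K) ℂ) :
    Matrix (Qubits n × K) (Qubits n × K) ℂ :=
  ∑ i, ((1 : Matrix (Qubits n) (Qubits n) ℂ) ⊗ₖ M.op () i) *
    X.submatrix (pairEquiv _ _) (pairEquiv _ _) *
      ((1 : Matrix (Qubits n) (Qubits n) ℂ) ⊗ₖ M.op () i)ᴴ

section AbsorbFirst

variable {K : Type} [Fintype K] [DecidableEq K] (M : Instrument Unit (Qubits n × K) K)

lemma one_kronecker_sum {I J ι : Type} (S : Finset ι) (f : ι → Matrix I J ℂ) :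
    (1 : Matrix (Qubits n) (Qubits n) ℂ) ⊗ₖ (∑ i ∈ S, f i) = ∑ i ∈ S, 1 ⊗ₖ f i := by
  classical
  induction S using Finset.induction_on with
  | empty => simp
  | insert i S hi ih => rw [Finset.sum_insert hi, Finset.sum_insert hi, Matrix.kronecker_add, ih]

lemma absorbFirst_kronecker (σ τ : Matrix (Qubits n) (Qubits n) ℂ) (κ : Matrix K K ℂ) :
    absorbFirst M ((σ ⊗ₖ τ) ⊗ₖ κ) = τ ⊗ₖ M.apply () (σ ⊗ₖ κ) := by
  have h : ((σ ⊗ₖ τ) ⊗ₖ κ).submatrix (pairEquiv _ _) (pairEquiv _ _) = τ ⊗ₖ (σ ⊗ₖ κ) := by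
    ext ⟨a, b, c⟩ ⟨a', b', c'⟩
    simp [pairEquiv]
    ring
  have hs : ∀ (S : Finset M.ι) (f : M.ι → Matrix K K ℂ),
      τ ⊗ₖ (∑ i ∈ S, f i) = ∑ i ∈ S, τ ⊗ₖ f i := by
    intro S f
    classical
    induction S using Finset.induction_on with
    | empty => simp
    | insert i S hi ih => rw [Finset.sum_insert hi, Finset.sum_insert hi, Matrix.kronecker_add, ih]
  rw [absorbFirst, h, Instrument.apply, hs]
  refine Finset.sum_congr rfl fun i _ => ?_
  rw [Matrix.conjTranspose_kronecker, Matrix.conjTranspose_one, ← Matrix.mul_kronecker_mul,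
    ← Matrix.mul_kronecker_mul, Matrix.one_mul, Matrix.mul_one]

lemma absorbFirst_add (X Y : Matrix ((Qubits n × Qubits n) × K) ((Qubits n × Qubits n) × K) ℂ) :
    absorbFirst M (X + Y) = absorbFirst M X + absorbFirst M Y := by
  simp only [absorbFirst, Matrix.submatrix_add, Pi.add_apply, Matrix.mul_add, Matrix.add_mul,
    Finset.sum_add_distrib]

lemma absorbFirst_smul (a : ℝ) (X : Matrix ((Qubits n × Qubits n) × K) ((Qubits n × Qubits n) × K) ℂ) :
    absorbFirst M (a • X) = a • absorbFirst M X := by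
  simp only [absorbFirst, Matrix.submatrix_smul, Pi.smul_apply, Matrix.mul_smul, Matrix.smul_mul,
    Finset.smul_sum]

lemma posSemidef_absorbFirst {X : Matrix ((Qubits n × Qubits n) × K) ((Qubits n × Qubits n) × K) ℂ}
    (h : X.PosSemidef) : (absorbFirst M X).PosSemidef :=
  Matrix.posSemidef_sum _ fun _ _ => (h.submatrix _).mul_mul_conjTranspose_same _

lemma trace_absorbFirst (X : Matrix ((Qubits n × Qubits n) × K) ((Qubits n × Qubits n) × K) ℂ) :
    (absorbFirst M X).trace = X.trace := by
  have hM : ∑ i, (M.op () i)ᴴ * M.op () i = 1 := by simpa using M.complete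
  set Y := X.submatrix (pairEquiv _ _) (pairEquiv _ _) with hY
  have h1 : (absorbFirst M X).trace =
      ((∑ i, ((1 : Matrix (Qubits n) (Qubits n) ℂ) ⊗ₖ ((M.op () i)ᴴ * M.op () i))) * Y).trace := by
    rw [absorbFirst, Matrix.trace_sum, Finset.sum_mul, Matrix.trace_sum]
    refine Finset.sum_congr rfl fun i _ => ?_
    rw [Matrix.mul_assoc, Matrix.trace_mul_comm, Matrix.mul_assoc, Matrix.trace_mul_comm,
      Matrix.conjTranspose_kronecker, Matrix.conjTranspose_one, ← Matrix.mul_kronecker_mul,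
      Matrix.one_mul]
  rw [h1, ← one_kronecker_sum, hM, Matrix.one_kronecker_one, Matrix.one_mul, hY]
  simp only [Matrix.trace, Matrix.diag, Matrix.submatrix_apply]
  exact (pairEquiv _ _).sum_comp fun z => X z z

end AbsorbFirst

/-- The extension of `pairProb` to arbitrary joint states of the two qudits. -/
def pairMap (P : Prover n) (s r : ℕ) (κ : Matrix P.K P.K ℂ) (a : Bool) :
    Matrix (Qubits n × Qubits n) (Qubits n × Qubits n) ℂ →ₗ[ℝ] ℝ where
  toFun X := ((P.answer r).apply a ((P.absorb (s + 1)).apply ()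
    (absorbFirst (P.absorb s) (X ⊗ₖ κ)))).trace.re
  map_add' X Y := by
    rw [Matrix.add_kronecker, absorbFirst_add, Instrument.apply_add, Instrument.apply_add,
      Matrix.trace_add, Complex.add_re]
  map_smul' a X := by
    rw [Matrix.smul_kronecker, absorbFirst_smul, Instrument.apply_smul, Instrument.apply_smul,
      Matrix.trace_smul]
    simp

lemma pairMap_kronecker (P : Prover n) (s r : ℕ) (κ : Matrix P.K P.K ℂ) (a : Bool)
    (σ τ : Matrix (Qubits n) (Qubits n) ℂ) :
    pairMap P s r κ a (σ ⊗ₖ τ) = pairProb P s r κ a σ τ := by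
  change Complex.re _ = _
  rw [absorbFirst_kronecker, pairProb]

lemma pairMap_nonneg (P : Prover n) (s r : ℕ) {κ : Matrix P.K P.K ℂ} (hκ : κ.PosSemidef) (a : Bool)
    {X : Matrix (Qubits n × Qubits n) (Qubits n × Qubits n) ℂ} (hX : X.PosSemidef) :
    0 ≤ pairMap P s r κ a X :=
  Instrument.trace_apply_nonneg _ _ (Instrument.posSemidef_apply _ _
    (posSemidef_absorbFirst _ (hX.kronecker hκ)))

lemma pairMap_add (P : Prover n) (s r : ℕ) (κ : Matrix P.K P.K ℂ)
    (X : Matrix (Qubits n × Qubits n) (Qubits n × Qubits n) ℂ) :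
    pairMap P s r κ true X + pairMap P s r κ false X = (X.trace * κ.trace).re := by
  have h := (P.answer r).sum_trace_apply ((P.absorb (s + 1)).apply ()
    (absorbFirst (P.absorb s) (X ⊗ₖ κ)))
  rw [Instrument.trace_apply_unit, trace_absorbFirst, Matrix.trace_kronecker, Fintype.sum_bool] at h
  have h' := congrArg Complex.re h
  rwa [Complex.add_re] at h'

/-! ### The effect of a round -/

/-- The memory after the choice of the basis states. -/
def flipMap (p : Bool) (μ : Mem (memSize n T ks.length)) : Mem (memSize n T ks.length) :=
  boolMap (fun a c => a && c && p) (flipBits T ks) μ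

lemma map_fst_flipBits : (flipBits (n := n) T ks).map Prod.fst =
    (List.finRange n).map (fun i => bit (.y false i)) ++
      (List.finRange n).map (fun i => bit (.y true i)) := by
  rw [flipBits, List.map_append, List.map_map, List.map_map]
  rfl

lemma nodup_map_bit {I : Type} (f : I → VBit n T ks.length) (hf : Function.Injective f) {l : List I}
    (hl : l.Nodup) : (l.map fun i => bit (f i)).Nodup :=
  hl.map ((bit_injective n T ks.length).comp hf)

lemma flipMap_of_ne (p : Bool) {v : VBit n T ks.length} (hv : ∀ h i, v ≠ .y h i)
    (μ : Mem (memSize n T ks.length)) : flipMap p μ (bit v) = μ (bit v) := by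
  refine boolMap_of_notMem _ ?_ μ
  rw [map_fst_flipBits]
  simp [(hv _ _).symm]

lemma nodup_map_fst_flipBits : ((flipBits (n := n) T ks).map Prod.fst).Nodup := by
  rw [map_fst_flipBits, List.nodup_append]
  refine ⟨nodup_map_bit _ (fun i j h => by simpa using h) (List.nodup_finRange n),
    nodup_map_bit _ (fun i j h => by simpa using h) (List.nodup_finRange n), ?_⟩
  intro a ha b hb
  obtain ⟨i, _, rfl⟩ := List.mem_map.1 ha
  obtain ⟨j, _, rfl⟩ := List.mem_map.1 hb
  simp

lemma reads_flipBits {q} (hq : q ∈ flipBits (n := n) T ks) :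
    q.2.1 ∉ (flipBits (n := n) T ks).map Prod.fst ∧ q.2.2 ∉ (flipBits (n := n) T ks).map Prod.fst := by
  rw [map_fst_flipBits]
  rw [flipBits, List.mem_append] at hq
  rcases hq with hq | hq <;>
  · obtain ⟨i, _, rfl⟩ := List.mem_map.1 hq
    simp

lemma flipMap_y (p h : Bool) (i : Fin n) (μ : Mem (memSize n T ks.length)) :
    flipMap p μ (bit (.y h i)) = (μ (bit (.x h i)) && μ (bit .secret) && p) := by
  have hq : (bit (.y h i), bit (.x h i), bit .secret) ∈ flipBits (n := n) T ks := by
    rw [flipBits, List.mem_append]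
    cases h
    · exact Or.inl (List.mem_map.2 ⟨i, List.mem_finRange i, rfl⟩)
    · exact Or.inr (List.mem_map.2 ⟨i, List.mem_finRange i, rfl⟩)
  exact boolMap_of_mem _ nodup_map_fst_flipBits (fun q => reads_flipBits) hq μ

lemma umat_flipMap (p : Bool) (μ : Mem (memSize n T ks.length)) :
    umat (flipMap p μ) (circuit (n := n) T ks) = umat μ (circuit T ks) := by
  refine umat_congr fun q hq => ?_
  rcases coin_of_mem_circuit hq with h | ⟨t, h⟩
  · rw [h.2]; exact flipMap_of_ne p (by simp) μ
  · rw [h]; exact flipMap_of_ne p (by simp) μ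

lemma sentState_flipMap_of_false (ρ : State (Qubits n)) (p h : Bool)
    {μ : Mem (memSize n T ks.length)} (hμ : (μ (bit .secret) && p) = false) :
    sentState ρ h (flipMap p μ) = umat μ (circuit T ks) *
      (if μ (bit .secret) then zeroState n else ρ.1) * (umat μ (circuit T ks))ᴴ := by
  have h1 : umat (flipMap p μ) (flips T ks h) = 1 := by
    refine umat_eq_one fun q hq => ?_
    obtain ⟨i, _, rfl⟩ := List.mem_map.1 hq
    dsimp only
    rw [flipMap_y, Bool.and_assoc, hμ, Bool.and_false]
  rw [sentState, umat_flipMap, h1, flipMap_of_ne p (by simp), Matrix.conjTranspose_one,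
    Matrix.one_mul, Matrix.mul_one]

lemma sentState_flipMap_of_true (ρ : State (Qubits n)) (h : Bool)
    {μ : Mem (memSize n T ks.length)} (hμ : μ (bit .secret) = true) :
    sentState ρ h (flipMap true μ) = umat μ (circuit T ks) *
      Matrix.single (fun i => μ (bit (.x h i))) (fun i => μ (bit (.x h i))) 1 *
        (umat μ (circuit T ks))ᴴ := by
  rw [sentState, umat_flipMap, flipMap_of_ne true (by simp), if_pos hμ, zeroState, flips,
    umat_flip_conj_single _ _ _ (List.nodup_finRange n)]
  have : (fun i => if i ∈ List.finRange n then
      xor false (flipMap true μ (bit (.y h i : VBit n T ks.length))) else false) =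
      fun i => μ (bit (.x h i)) := by
    funext i
    rw [if_pos (List.mem_finRange i), flipMap_y, hμ]
    simp
  rw [this]

lemma trace_sentState (ρ : State (Qubits n)) (h : Bool) (μ : Mem (memSize n T ks.length)) :
    (sentState ρ h μ).trace = 1 := by
  have hc : ∀ U σ : Matrix (Qubits n) (Qubits n) ℂ, Uᴴ * U = 1 → (U * σ * Uᴴ).trace = σ.trace := by
    intro U σ hU
    rw [Matrix.mul_assoc, Matrix.trace_mul_comm, Matrix.mul_assoc, hU, Matrix.mul_one]
  rw [sentState, hc _ _ (umat_unitary _ _), hc _ _ (umat_unitary _ _)]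
  split_ifs
  · exact trace_zeroState
  · exact ρ.2.2

/-- The reference state of the test `p`. -/
def refState (n : ℕ) (p : Bool) : Matrix (Qubits n) (Qubits n) ℂ :=
  if p then (mixed n).1 else zeroState n

/-- The probability that the prover wins a round of the test `p`. -/
def winProb (P : Prover n) (s r : ℕ) (gs : List (Cliff n)) (ρ : State (Qubits n)) (p : Bool)
    (κ : Matrix P.K P.K ℂ) : ℝ :=
  1 / 2 * (circuitAvg gs (fun U => pairProb P s r κ (!p) (U * ρ.1 * Uᴴ) (U * ρ.1 * Uᴴ)) 1 +
    circuitAvg gs (fun U => pairProb P s r κ p (U * refState n p * Uᴴ) (U * refState n p * Uᴴ)) 1)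

lemma coinAvg_pairProb_single (P : Prover n) (s r : ℕ) (κ : Matrix P.K P.K ℂ) (a : Bool)
    (U : Matrix (Qubits n) (Qubits n) ℂ) {c : ℕ} (k k' : Fin n → Fin c)
    (hk : Function.Injective k) (hk' : Function.Injective k') (hkk : ∀ i j, k i ≠ k' j) (μ : Mem c) :
    coinAvg ((List.finRange n).map k ++ (List.finRange n).map k') (fun ν => pairProb P s r κ a
      (U * Matrix.single (fun i => ν (k i)) (fun i => ν (k i)) 1 * Uᴴ)
      (U * Matrix.single (fun i => ν (k' i)) (fun i => ν (k' i)) 1 * Uᴴ)) μ =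
      pairProb P s r κ a (U * (mixed n).1 * Uᴴ) (U * (mixed n).1 * Uᴴ) := by
  let f (X : Matrix (Qubits n) (Qubits n) ℂ) : Matrix (Qubits n) (Qubits n) ℂ →ₗ[ℝ] ℝ :=
    { toFun := fun Y => pairMap P s r κ a ((U * X * Uᴴ) ⊗ₖ (U * Y * Uᴴ))
      map_add' := fun Y Z => by
        rw [Matrix.mul_add, Matrix.add_mul, Matrix.kronecker_add, map_add]
      map_smul' := fun c Y => by
        rw [Matrix.mul_smul, Matrix.smul_mul, Matrix.kronecker_smul, map_smul, RingHom.id_apply] }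
  let g (Y : Matrix (Qubits n) (Qubits n) ℂ) : Matrix (Qubits n) (Qubits n) ℂ →ₗ[ℝ] ℝ :=
    { toFun := fun X => pairMap P s r κ a ((U * X * Uᴴ) ⊗ₖ (U * Y * Uᴴ))
      map_add' := fun Y Z => by
        rw [Matrix.mul_add, Matrix.add_mul, Matrix.add_kronecker, map_add]
      map_smul' := fun c Y => by
        rw [Matrix.mul_smul, Matrix.smul_mul, Matrix.smul_kronecker, map_smul, RingHom.id_apply] }
  have hf : ∀ X Y, f X Y = pairProb P s r κ a (U * X * Uᴴ) (U * Y * Uᴴ) :=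
    fun X Y => pairMap_kronecker _ _ _ _ _ _ _
  have hg : ∀ X Y, g Y X = pairProb P s r κ a (U * X * Uᴴ) (U * Y * Uᴴ) :=
    fun X Y => pairMap_kronecker _ _ _ _ _ _ _
  have h1 := coinAvg_map (g (mixed n).1) ((List.finRange n).map k)
    (fun ν => Matrix.single (fun i => ν (k i)) (fun i => ν (k i)) (1 : ℂ)) μ
  rw [coinAvg_single k hk, hg] at h1
  rw [coinAvg_append, h1]
  congr 1
  funext ν
  have h2 := coinAvg_map (f (Matrix.single (fun i => ν (k i)) (fun i => ν (k i)) (1 : ℂ)))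
    ((List.finRange n).map k')
    (fun ν => Matrix.single (fun i => ν (k' i)) (fun i => ν (k' i)) (1 : ℂ)) ν
  rw [coinAvg_single k' hk', hf] at h2
  rw [hg, h2]
  refine coinAvg_congr fun ν' hν => ?_
  have : ∀ i, ν' (k i) = ν (k i) := fun i => hν _ fun hm => by
    obtain ⟨j, _, hj⟩ := List.mem_map.1 hm
    exact hkk i j hj.symm
  simp only [hf, this]

/-- The average over the coins of the round, for a fixed secret bit. -/
lemma coinAvg_sentState (P : Prover n) (s r : ℕ) (κ : Matrix P.K P.K ℂ) (ρ : State (Qubits n))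
    (p a b : Bool) {μ : Mem (memSize n T ks.length)} (hone : μ (bit .one) = true)
    (hb : μ (bit .secret) = b) :
    coinAvg (coinsOf (circuit (n := n) T ks) ++ ((List.finRange n).map (fun i => bit (.x false i)) ++
      (List.finRange n).map (fun i => bit (.x true i))))
      (fun ν => pairProb P s r κ a (sentState ρ false (flipMap p ν)) (sentState ρ true (flipMap p ν)))
      μ = circuitAvg (gatesOf n ks) (fun U => pairProb P s r κ a
        (U * (if b then refState n p else ρ.1) * Uᴴ) (U * (if b then refState n p else ρ.1) * Uᴴ)) 1 := by
  have hcoin : (bit .one : Fin (memSize n T ks.length)) ∉ coinsOf (circuit (n := n) T ks) := by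
    intro h
    obtain ⟨t, i, h⟩ := coin_of_mem_coinsOf h
    simp at h
  have hsec : (bit .secret : Fin (memSize n T ks.length)) ∉ coinsOf (circuit (n := n) T ks) := by
    intro h
    obtain ⟨t, i, h⟩ := coin_of_mem_coinsOf h
    simp at h
  have hdet : ∀ q ∈ circuit (n := n) T ks, q.2.isRandom = false → q.1 = bit .one := by
    intro q hq hr
    rw [circuit, List.mem_flatMap] at hq
    obtain ⟨t, _, hq⟩ := hq
    obtain ⟨g, _, rfl⟩ := List.mem_map.1 hq
    dsimp only at hr ⊢
    rw [hr]
    simp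
  rw [← map_snd_circuit (T := T), ← coinAvg_umat (bit .one) _ nodup_coinsOf_circuit hcoin hdet hone,
    coinAvg_append]
  refine coinAvg_congr fun ν hν => ?_
  have hνs : ν (bit .secret) = b := by rw [hν _ hsec, hb]
  rw [Matrix.mul_one]
  -- the basis states do not affect the random circuit and the secret bit
  have hx : ∀ ν' : Mem (memSize n T ks.length), (∀ i, i ∉ (List.finRange n).map
      (fun i => bit (.x false i : VBit n T ks.length)) ++ (List.finRange n).map (fun i => bit (.x true i)) →
      ν' i = ν i) → ν' (bit .secret) = b ∧ umat ν' (circuit (n := n) T ks) = umat ν (circuit T ks) := by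
    intro ν' h'
    constructor
    · rw [h' _ (by simp), hνs]
    · refine umat_congr fun q hq => h' _ ?_
      rcases coin_of_mem_circuit hq with h | ⟨t, h⟩
      · rw [h.2]; simp
      · rw [h]; simp
  cases hbp : b && p with
  | false =>
    have e : (if b then refState n p else ρ.1) = if b then zeroState n else ρ.1 := by
      cases b
      · rfl
      · rw [Bool.true_and] at hbp
        rw [refState, hbp]
        rfl
    rw [e]
    refine (coinAvg_congr fun ν' h' => ?_).trans (coinAvg_const _ _ ν)
    obtain ⟨h1, h2⟩ := hx ν' h'
    rw [sentState_flipMap_of_false ρ p false (by rw [h1, hbp]),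
      sentState_flipMap_of_false ρ p true (by rw [h1, hbp]), h1, h2]
  | true =>
    rw [Bool.and_eq_true] at hbp
    rw [hbp.1, if_pos rfl, refState, if_pos hbp.2,
      ← coinAvg_pairProb_single P s r κ a _ (fun i => bit (.x false i : VBit n T ks.length))
        (fun i => bit (.x true i : VBit n T ks.length)) (fun i j h => by simpa using h)
        (fun i j h => by simpa using h) (fun i j => by simp) ν]
    refine coinAvg_congr fun ν' h' => ?_
    obtain ⟨h1, h2⟩ := hx ν' h'
    rw [hbp.2, sentState_flipMap_of_true ρ false (by rw [h1, hbp.1]),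
      sentState_flipMap_of_true ρ true (by rw [h1, hbp.1]), h2]

/-- The average over all coins of a round. The answer that wins is the secret bit, negated in the first
test. -/
lemma coinAvg_coinBits (P : Prover n) (s r : ℕ) (κ : Matrix P.K P.K ℂ) (ρ : State (Qubits n))
    (p : Bool) {μ : Mem (memSize n T ks.length)} (hone : μ (bit .one) = true) :
    coinAvg (coinBits (n := n) T ks) (fun ν => pairProb P s r κ (xor (!p) (ν (bit .secret)))
      (sentState ρ false (flipMap p ν)) (sentState ρ true (flipMap p ν))) μ =
      winProb P s r (gatesOf n ks) ρ p κ := by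
  have key : ∀ b, coinAvg (coinsOf (circuit (n := n) T ks) ++
      ((List.finRange n).map (fun i => bit (.x false i)) ++
      (List.finRange n).map (fun i => bit (.x true i))))
      (fun ν => pairProb P s r κ (xor (!p) (ν (bit .secret)))
      (sentState ρ false (flipMap p ν)) (sentState ρ true (flipMap p ν)))
      (Function.update μ (bit .secret) b) =
      circuitAvg (gatesOf n ks) (fun U => pairProb P s r κ (xor (!p) b)
        (U * (if b then refState n p else ρ.1) * Uᴴ) (U * (if b then refState n p else ρ.1) * Uᴴ))
        1 := by
    intro b
    rw [← coinAvg_sentState P s r κ ρ p (xor (!p) b) b (T := T)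
      (μ := Function.update μ (bit .secret) b) (by simpa using hone) (by simp)]
    refine coinAvg_congr fun ν hν => ?_
    have : ν (bit .secret) = b := by
      rw [hν _ ?_, Function.update_self]
      intro hm
      rw [List.mem_append] at hm
      rcases hm with hm | hm
      · obtain ⟨t, i, h⟩ := coin_of_mem_coinsOf hm
        simp at h
      · simp at hm
    rw [this]
  rw [coinBits, coinAvg]
  dsimp only
  rw [key, key, winProb]
  simp

lemma counts_congr {μ ν : Mem (memSize n T ks.length)} (h : ∀ b i, μ (bit (.cnt b i)) = ν (bit (.cnt b i))) :
    counts μ = counts ν := by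
  funext b
  simp only [counts, h]

lemma cnt_notMem_coinBits (b : Bool) (i : Fin T) :
    (bit (.cnt b i) : Fin (memSize n T ks.length)) ∉ coinBits (n := n) T ks := by
  rw [coinBits, List.mem_cons, List.mem_append]
  rintro (h | h | h)
  · simp at h
  · obtain ⟨t, j, h⟩ := coin_of_mem_coinsOf h
    simp at h
  · simp at h

/-- The counters after a win in the test `p`. -/
def incr (T : ℕ) (p : Bool) (N : Bool → ℕ) : Bool → ℕ := Function.update N p (min T (N p + 1))

/-- A round increments the counter of its test with the winning probability. -/
theorem pairing_round (ρ : State (Qubits n)) (P : Prover n) (p : Bool) (s r : ℕ)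
    (G : (Bool → ℕ) → ℝ) (Ψ : Joint n (memSize n T ks.length) P.K) :
    (pairing (fun μ => ((G (counts μ) : ℝ) : ℂ) • 1) (runProgram ρ P (round T ks p) s r Ψ)).re =
      ∑ μ, ((G (incr T p (counts μ)) - G (counts μ)) *
        winProb P s r (gatesOf n ks) ρ p (traceReg (Ψ μ)) +
          G (counts μ) * (traceReg (Ψ μ)).trace.re) := by
  rw [pairing_runProgram, pairing, Complex.re_sum]
  refine Finset.sum_congr rfl fun μ _ => ?_
  set κ := traceReg (Ψ μ) with hκ
  -- the observable before the transmission of the two qudits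
  let D (ν : Mem (memSize n T ks.length)) : Matrix P.K P.K ℂ :=
    slice (sentState ρ false ν) ((P.absorb s).dual () (slice (sentState ρ true ν)
      ((P.absorb (s + 1)).dual () (∑ a, ((G (counts (scoreMap p ν a)) : ℝ) : ℂ) •
        (P.answer r).dual a 1))))
  have hblock : programDual ρ P (block T ks false ++ (block T ks true ++ scoring T ks p)) s r
      (fun μ => ((G (counts μ) : ℝ) : ℂ) • 1) = fun ν => 1 ⊗ₖ D ν :=
    programDual_block ρ P false _ s r _ _ (programDual_block ρ P true _ (s + 1) r _ _
      (programDual_scoring ρ P p (s + 1 + 1) r _))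
  have h1 : programDual ρ P (round T ks p) s r (fun μ => ((G (counts μ) : ℝ) : ℂ) • 1) μ =
      coinAvg (coinBits (n := n) T ks) (fun ν => 1 ⊗ₖ D (flipMap p ν))
        (Function.update μ (bit .one) true) := by
    rw [round, programDual, programDual, programDual, hblock, foldr_dual_bool, foldr_dual_coin,
      List.foldr_cons, List.foldr_nil, Op.dual_bool]
    rfl
  let f : Matrix (Qubits n × P.K) (Qubits n × P.K) ℂ →ₗ[ℝ] ℝ :=
    { toFun := fun X => (X * Ψ μ).trace.re
      map_add' := fun X Y => by rw [Matrix.add_mul, Matrix.trace_add, Complex.add_re]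
      map_smul' := fun c X => by rw [Matrix.smul_mul, Matrix.trace_smul]; simp }
  have hf : ∀ Y : Matrix P.K P.K ℂ, f (1 ⊗ₖ Y) = (Y * κ).trace.re :=
    fun Y => congrArg Complex.re (trace_one_kronecker_mul Y (Ψ μ))
  have h2 := coinAvg_map f (coinBits (n := n) T ks) (fun ν => 1 ⊗ₖ D (flipMap p ν))
    (Function.update μ (bit .one) true)
  rw [← h1] at h2
  refine h2.trans ?_
  -- the value for fixed coins
  have hD : ∀ ν : Mem (memSize n T ks.length), (∀ i, i ∉ coinBits (n := n) T ks →
      ν i = Function.update μ (bit .one) true i) → f (1 ⊗ₖ D (flipMap p ν)) =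
      (G (incr T p (counts μ)) - G (counts μ)) * pairProb P s r κ (xor (!p) (ν (bit .secret)))
        (sentState ρ false (flipMap p ν)) (sentState ρ true (flipMap p ν)) +
        G (counts μ) * κ.trace.re := by
    intro ν hν
    have hc : counts (flipMap p ν) = counts μ := counts_congr fun b i => by
      rw [flipMap_of_ne p (by simp), hν _ (cnt_notMem_coinBits b i)]
      simp
    have hsec : flipMap p ν (bit .secret) = ν (bit .secret) := flipMap_of_ne p (by simp) ν
    have hlin : (D (flipMap p ν) * κ).trace.re = ∑ a, G (counts (scoreMap p (flipMap p ν) a)) *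
        pairProb P s r κ a (sentState ρ false (flipMap p ν)) (sentState ρ true (flipMap p ν)) := by
      change (slice _ _ * κ).trace.re = _
      rw [← trace_mul_kronecker, ← trace_mul_apply, ← trace_mul_kronecker, ← trace_mul_apply,
        Finset.sum_mul, Matrix.trace_sum, Complex.re_sum]
      refine Finset.sum_congr rfl fun a _ => ?_
      rw [Matrix.smul_mul, Matrix.trace_smul, smul_eq_mul, Complex.re_ofReal_mul, ← trace_mul_apply,
        Matrix.one_mul, pairProb]
    have hadd := pairProb_add P s r κ (xor (!p) (ν (bit .secret)))
      (trace_sentState ρ false (flipMap p ν)) (trace_sentState ρ true (flipMap p ν))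
    rw [hf, hlin, Fintype.sum_bool, counts_scoreMap, counts_scoreMap, hc, hsec, ← hadd]
    cases ν (bit .secret) <;> cases p <;> simp [incr] <;> ring
  rw [coinAvg_congr hD, coinAvg_add, coinAvg_const_mul, coinAvg_const,
    coinAvg_coinBits P s r κ ρ p (by simp)]

end Round

/-! ### The winning probability of a cheating prover -/

section Cheating

variable {n : ℕ}

lemma unitary_mul_conjTranspose {U : Matrix (Qubits n) (Qubits n) ℂ} (hU : Uᴴ * U = 1) : U * Uᴴ = 1 :=
  mul_eq_one_comm.1 hU

lemma trace_conj {U : Matrix (Qubits n) (Qubits n) ℂ} (hU : Uᴴ * U = 1)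
    (σ : Matrix (Qubits n) (Qubits n) ℂ) : (U * σ * Uᴴ).trace = σ.trace := by
  rw [Matrix.mul_assoc, Matrix.trace_mul_comm, Matrix.mul_assoc, hU, Matrix.mul_one]

lemma conj_mixed {U : Matrix (Qubits n) (Qubits n) ℂ} (hU : Uᴴ * U = 1) :
    U * (mixed n).1 * Uᴴ = (mixed n).1 := by
  simp only [mixed, Matrix.mul_smul, Matrix.smul_mul, Matrix.mul_one, unitary_mul_conjTranspose hU]

/-- A state after a unitary. -/
def State.conj (ρ : State (Qubits n)) {U : Matrix (Qubits n) (Qubits n) ℂ} (hU : Uᴴ * U = 1) :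
    State (Qubits n) :=
  ⟨U * ρ.1 * Uᴴ, ρ.2.1.mul_mul_conjTranspose_same U, by rw [trace_conj hU, ρ.2.2]⟩

lemma State.IsPure.conj {ρ : State (Qubits n)} (h : ρ.IsPure) {U : Matrix (Qubits n) (Qubits n) ℂ}
    (hU : Uᴴ * U = 1) : (ρ.conj hU).IsPure := by
  obtain ⟨ψ, hψ⟩ := h
  refine ⟨U *ᵥ ψ, ?_⟩
  change U * ρ.1 * Uᴴ = _
  rw [hψ, Matrix.mul_vecMulVec, Matrix.vecMulVec_mul, Matrix.star_mulVec]

/-- The density matrix `|0⋯0⟩⟨0⋯0|`, the reference state of the first test. -/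
def zeroPure (n : ℕ) : State (Qubits n) := ⟨zeroState n, zeros_isState _⟩

lemma zeroPure_isPure : (zeroPure n).IsPure := by
  refine ⟨Pi.single (fun _ => false) 1, ?_⟩
  ext a b
  simp only [zeroPure, zeroState, Matrix.single_apply, Matrix.vecMulVec_apply, Pi.star_apply,
    Pi.single_apply]
  by_cases ha : a = fun _ => false <;> by_cases hb : b = fun _ => false <;>
    simp [ha, hb, eq_comm]

lemma PosSemidef.trace_re_nonneg {I : Type} [Fintype I] {κ : Matrix I I ℂ} (hκ : κ.PosSemidef) :
    0 ≤ κ.trace.re :=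
  (Complex.le_def.1 hκ.trace_nonneg).1

lemma PosSemidef.trace_eq_re {I : Type} [Fintype I] {κ : Matrix I I ℂ} (hκ : κ.PosSemidef) :
    κ.trace = ((κ.trace.re : ℝ) : ℂ) :=
  Complex.ext rfl ((Complex.le_def.1 hκ.trace_nonneg).2.symm)

lemma posSemidef_bellProj (ℓ : Label n) : (bellProj ℓ).PosSemidef := by
  refine (Matrix.posSemidef_vecMulVec_self_star _).smul ?_
  have h : (((2 : ℂ) ^ n)⁻¹) = (((2 : ℝ) ^ n)⁻¹ : ℝ) := by push_cast; rfl
  rw [h]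
  exact_mod_cast (by positivity : (0 : ℝ) ≤ ((2 : ℝ) ^ n)⁻¹)

lemma sum_bellSite_sq (w r : Bool) : ∑ u, ∑ v, bellSite w r u v * bellSite w r u v = 2 := by
  revert w r
  decide

lemma trace_bellProj (ℓ : Label n) : (bellProj ℓ).trace = 1 := by
  have h : ∑ p : Qubits n × Qubits n, (∏ i, bellSite (ℓ.1 i) (ℓ.2 i) (p.1 i) (p.2 i)) *
      (∏ i, bellSite (ℓ.1 i) (ℓ.2 i) (p.1 i) (p.2 i)) = (2 : ℤ) ^ n := by
    simp only [← Finset.prod_mul_distrib]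
    rw [sum_label_prod fun i u v => bellSite (ℓ.1 i) (ℓ.2 i) u v * bellSite (ℓ.1 i) (ℓ.2 i) u v]
    simp only [sum_bellSite_sq]
    simp
  have h' := congrArg (Int.cast : ℤ → ℂ) h
  push_cast at h'
  rw [bellProj, Matrix.trace_smul, star_bell, Matrix.trace_vecMulVec]
  have e : bell ℓ ⬝ᵥ bell ℓ = (2 : ℂ) ^ n := by
    rw [← h']
    simp [dotProduct, bell]
  rw [e, smul_eq_mul, inv_mul_cancel₀ (by positivity)]

/-- The maximal distance of two qubits that are coupled by a gate. -/
def gateRange (n : ℕ) : ℕ := 3 * Nat.clog 2 n + 30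

/-- The layers of the random circuit: a random Pauli operator, followed by seven double steps of the
walk on labels, which leave an oscillation of about `2 ^ (-7)`. -/
def twirlKinds (n : ℕ) : List LayerKind :=
  .loc .X :: .loc .Z :: coreKinds (gateRange n) 7

lemma gatesOf_twirlKinds :
    gatesOf n (twirlKinds n) = pauliGates n ++ gatesOf n (coreKinds (gateRange n) 7) := by
  rw [twirlKinds, gatesOf_cons, gatesOf_cons, pauliGates, List.append_assoc]
  rfl

/-- The range of the gates is large enough that the union bound over `n` windows costs nothing. -/
lemma mul_pow_gateRange_le : (n : ℝ) * (3 / 4) ^ gateRange n ≤ (3 / 4) ^ 30 := by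
  have h1 : (n : ℝ) ≤ 2 ^ Nat.clog 2 n := by
    exact_mod_cast Nat.le_pow_clog (by norm_num) n
  have h2 : ((3 / 4 : ℝ) ^ 3) ^ Nat.clog 2 n ≤ (1 / 2) ^ Nat.clog 2 n :=
    pow_le_pow_left₀ (by norm_num) (by norm_num) _
  rw [gateRange, pow_add, pow_mul, ← mul_assoc]
  refine mul_le_of_le_one_left (by positivity) ?_
  calc (n : ℝ) * ((3 / 4) ^ 3) ^ Nat.clog 2 n ≤ 2 ^ Nat.clog 2 n * (1 / 2) ^ Nat.clog 2 n :=
        mul_le_mul h1 h2 (by positivity) (by positivity)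
    _ = 1 := by rw [← mul_pow]; norm_num

lemma pairMap_bellProj_mem (P : Prover n) (s r : ℕ) {κ : Matrix P.K P.K ℂ} (hκ : κ.PosSemidef)
    (a : Bool) (ℓ : Label n) : pairMap P s r κ a (bellProj ℓ) ∈ Set.Icc 0 κ.trace.re := by
  have h := pairMap_add P s r κ (bellProj ℓ)
  rw [trace_bellProj, one_mul] at h
  have h1 := pairMap_nonneg P s r hκ true (posSemidef_bellProj ℓ)
  have h0 := pairMap_nonneg P s r hκ false (posSemidef_bellProj ℓ)
  cases a
  · exact ⟨h0, by linarith⟩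
  · exact ⟨h1, by linarith⟩

/-- For every prover, the random circuit makes all pure states almost indistinguishable. -/
lemma exists_Icc_circuitAvg_pairProb (P : Prover n) (s r : ℕ) {κ : Matrix P.K P.K ℂ}
    (hκ : κ.PosSemidef) (c : Bool) : ∃ a b, b - a ≤ 0.022 * κ.trace.re ∧
      ∀ ρ : State (Qubits n), ρ.IsPure → circuitAvg (gatesOf n (twirlKinds n)) (fun U =>
        pairProb P s r κ c (U * ρ.1 * Uᴴ) (U * ρ.1 * Uᴴ)) 1 ∈ Set.Icc a b := by
  obtain ⟨a, b, hab, h⟩ := exists_Icc_labelAvg_coreKinds (K := gateRange n)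
    (f := fun ℓ => pairMap P s r κ c (bellProj ℓ)) (pairMap_bellProj_mem P s r hκ c)
    (by unfold gateRange; omega) 7
  refine ⟨a, b, ?_, ?_⟩
  · have h0 := PosSemidef.trace_re_nonneg hκ
    have h1 := mul_pow_gateRange_le (n := n)
    have h2 : (n : ℝ) * (1 / 2) ^ gateRange n ≤ n * (3 / 4) ^ gateRange n :=
      mul_le_mul_of_nonneg_left (pow_le_pow_left₀ (by norm_num) (by norm_num) _) (Nat.cast_nonneg n)
    rw [hab]
    refine mul_le_mul_of_nonneg_right ?_ h0
    have h3 : ((3 / 4 : ℝ)) ^ 30 ≤ 0.00024 := by norm_num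
    push_cast
    linarith
  · rintro ρ ⟨ψ, hψ⟩
    have hn : ∑ x, Complex.normSq (ψ x) = 1 := by
      have ht := ρ.2.2
      rw [hψ, Matrix.trace_vecMulVec, dotProduct] at ht
      have := congrArg Complex.re ht
      rw [Complex.re_sum] at this
      rw [Complex.one_re] at this
      rw [← this]
      refine Finset.sum_congr rfl fun x _ => ?_
      simp [Complex.normSq_apply]
    have hk : ρ.1 ⊗ₖ ρ.1 = Matrix.vecMulVec (fun p : Qubits n × Qubits n => ψ p.1 * ψ p.2)
        (star fun p => ψ p.1 * ψ p.2) := by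
      rw [hψ]
      ext ⟨x, y⟩ ⟨x', y'⟩
      simp [Matrix.vecMulVec_apply]
      ring
    have hc : ∀ U : Matrix (Qubits n) (Qubits n) ℂ, pairProb P s r κ c (U * ρ.1 * Uᴴ) (U * ρ.1 * Uᴴ) =
        pairMap P s r κ c (conjPair U (ρ.1 ⊗ₖ ρ.1)) := by
      intro U
      rw [← pairMap_kronecker, conjPair, Matrix.conjTranspose_kronecker, Matrix.mul_kronecker_mul,
        Matrix.mul_kronecker_mul]
    have h1 : conjPair (1 : Matrix (Qubits n) (Qubits n) ℂ) (ρ.1 ⊗ₖ ρ.1) = ρ.1 ⊗ₖ ρ.1 := by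
      simp [conjPair]
    simp only [hc]
    rw [circuitAvg_eq_twirl, h1, hk, gatesOf_twirlKinds]
    exact twirl_pure_mem_Icc _ _ a b h ψ hn

lemma pairProb_nonneg (P : Prover n) (s r : ℕ) {κ : Matrix P.K P.K ℂ} (hκ : κ.PosSemidef) (a : Bool)
    (σ τ : State (Qubits n)) : 0 ≤ pairProb P s r κ a σ.1 τ.1 := by
  rw [← pairMap_kronecker]
  exact pairMap_nonneg P s r hκ a (σ.2.1.kronecker τ.2.1)

lemma exists_state_refState (p : Bool) : ∃ τ : State (Qubits n), τ.1 = refState n p := by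
  cases p
  · exact ⟨zeroPure n, rfl⟩
  · exact ⟨mixed n, rfl⟩

lemma winProb_nonneg (P : Prover n) (s r : ℕ) (gs : List (Cliff n)) (ρ : State (Qubits n)) (p : Bool)
    {κ : Matrix P.K P.K ℂ} (hκ : κ.PosSemidef) : 0 ≤ winProb P s r gs ρ p κ := by
  have h : ∀ (σ : State (Qubits n)) a, 0 ≤ circuitAvg gs (fun U =>
      pairProb P s r κ a (U * σ.1 * Uᴴ) (U * σ.1 * Uᴴ)) 1 := by
    intro σ a
    rw [← circuitAvg_const gs 0 1]
    refine circuitAvg_mono_on gs (fun U hU => ?_) (by simp)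
    exact pairProb_nonneg P s r hκ a (σ.conj hU) (σ.conj hU)
  obtain ⟨τ, hτ⟩ := exists_state_refState (n := n) p
  have h1 := h ρ !p
  have h2 := h τ p
  rw [hτ] at h2
  rw [winProb]
  linarith

lemma circuitAvg_pairProb_add (P : Prover n) (s r : ℕ) (gs : List (Cliff n)) (κ : Matrix P.K P.K ℂ)
    (a : Bool) (σ : State (Qubits n)) :
    circuitAvg gs (fun U => pairProb P s r κ a (U * σ.1 * Uᴴ) (U * σ.1 * Uᴴ)) 1 +
      circuitAvg gs (fun U => pairProb P s r κ (!a) (U * σ.1 * Uᴴ) (U * σ.1 * Uᴴ)) 1 =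
      κ.trace.re := by
  rw [← circuitAvg_add, ← circuitAvg_const gs κ.trace.re 1]
  refine circuitAvg_congr_on gs (fun U hU => ?_) (by simp)
  exact pairProb_add P s r κ a (σ.conj hU).2.2 (σ.conj hU).2.2

/-- On a pure state, no prover wins a round of the first test with a relevant advantage. -/
lemma winProb_pure_le (P : Prover n) (s r : ℕ) {ρ : State (Qubits n)} (hρ : ρ.IsPure)
    {κ : Matrix P.K P.K ℂ} (hκ : κ.PosSemidef) :
    winProb P s r (gatesOf n (twirlKinds n)) ρ false κ ≤ 0.511 * κ.trace.re := by
  obtain ⟨a, b, hab, h⟩ := exists_Icc_circuitAvg_pairProb P s r hκ true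
  have h1 := (h ρ hρ).2
  have h2 := (h (zeroPure n) zeroPure_isPure).1
  have h3 := circuitAvg_pairProb_add P s r (gatesOf n (twirlKinds n)) κ true (zeroPure n)
  have e : refState n false = (zeroPure n).1 := rfl
  rw [winProb, e]
  simp only [Bool.not_false, Bool.not_true] at h3 ⊢
  linarith

/-- On the maximally mixed state, every prover wins a round of the second test with probability
`1 / 2`. -/
lemma winProb_mixed (P : Prover n) (s r : ℕ) (gs : List (Cliff n)) (κ : Matrix P.K P.K ℂ) :
    winProb P s r gs (mixed n) true κ = 1 / 2 * κ.trace.re := by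
  have h3 := circuitAvg_pairProb_add P s r gs κ true (mixed n)
  have e : refState n true = (mixed n).1 := rfl
  rw [winProb, e, ← h3, add_comm]

end Cheating

/-! ### The winning probability of the honest prover -/

section HonestWins

variable {n : ℕ}

lemma overwrite_apply {J Q : Type} [Fintype J] [DecidableEq J] [Fintype Q] [DecidableEq Q] (j : J)
    (X : Matrix (Q × (J → Q)) (Q × (J → Q)) ℂ) (x y : J → Q) :
    (overwrite j).apply () X x y =
      ∑ q, X (x j, Function.update x j q) (y j, Function.update y j q) := by
  have key : ∀ (q : Q) (x : J → Q) (z : Q × (J → Q)),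
      (if x = Function.update z.2 j z.1 ∧ z.2 j = q then (1 : ℂ) else 0) =
        if z = (x j, Function.update x j q) then 1 else 0 := by
    intro q x z
    refine if_congr ⟨?_, ?_⟩ rfl rfl
    · rintro ⟨rfl, rfl⟩; simp
    · rintro rfl; simp
  have e : (overwrite j).apply () X = ∑ q : Q,
      (Matrix.of fun (x : J → Q) (z : Q × (J → Q)) =>
        if x = Function.update z.2 j z.1 ∧ z.2 j = q then (1 : ℂ) else 0) * X *
      (Matrix.of fun (x : J → Q) (z : Q × (J → Q)) =>
        if x = Function.update z.2 j z.1 ∧ z.2 j = q then (1 : ℂ) else 0)ᴴ := rfl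
  rw [e, Matrix.sum_apply]
  refine Finset.sum_congr rfl fun q _ => ?_
  simp only [key, Matrix.mul_apply, Matrix.conjTranspose_apply, Matrix.of_apply, ite_mul, one_mul,
    zero_mul, Finset.sum_ite_eq', Finset.mem_univ, if_true]
  rw [Finset.sum_eq_single (y j, Function.update y j q)]
  · simp
  · intro z _ hz; simp [hz]
  · simp

/-- After two qudits, the memory of the honest prover consists of these two. -/
lemma overwrite_overwrite (σ : Matrix (Qubits n) (Qubits n) ℂ)
    (κ : Matrix (Fin 2 → Qubits n) (Fin 2 → Qubits n) ℂ) :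
    (overwrite (1 : Fin 2)).apply () (σ ⊗ₖ (overwrite (0 : Fin 2)).apply () (σ ⊗ₖ κ)) =
      κ.trace • copies 2 σ := by
  ext x y
  simp only [overwrite_apply, Matrix.kroneckerMap_apply, Matrix.smul_apply, copies,
    Fin.prod_univ_two, smul_eq_mul, Matrix.trace, Matrix.diag]
  have h : ∀ (x : Fin 2 → Qubits n) (q q' : Qubits n),
      Function.update (Function.update x 1 q) 0 q' = ![q', q] := by
    intro x q q'
    funext i
    fin_cases i <;> simp
  simp only [h, Function.update_of_ne (show (0 : Fin 2) ≠ 1 by decide)]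
  rw [sum_fin_two, Finset.sum_comm, Finset.sum_mul]
  refine Finset.sum_congr rfl fun q _ => ?_
  rw [Finset.mul_sum, Finset.sum_mul]
  exact Finset.sum_congr rfl fun q' _ => by ring

/-- The honest prover runs `A` on the two qudits of the round. As `s` is even, they are stored in the
registers `0` and `1` and overwrite the qudits of the previous round. -/
lemma pairProb_prover (A : Solver 2 n) {s : ℕ} (hs : Even s) (r : ℕ)
    {κ : Matrix (Fin 2 → Qubits n) (Fin 2 → Qubits n) ℂ} (hκ : κ.PosSemidef) (a : Bool)
    (σ : Matrix (Qubits n) (Qubits n) ℂ) :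
    pairProb (A.prover two_pos) s r κ a σ σ = κ.trace.re * A.prob a σ := by
  obtain ⟨t, rfl⟩ := hs
  have h0 : (A.prover two_pos).absorb (t + t) = overwrite (0 : Fin 2) := by
    have : (⟨(t + t) % 2, Nat.mod_lt _ two_pos⟩ : Fin 2) = 0 := Fin.ext (by simp; omega)
    exact congrArg overwrite this
  have h1 : (A.prover two_pos).absorb (t + t + 1) = overwrite (1 : Fin 2) := by
    have : (⟨(t + t + 1) % 2, Nat.mod_lt _ two_pos⟩ : Fin 2) = 1 := Fin.ext (by simp; omega)
    exact congrArg overwrite this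
  have h2 : pairProb (A.prover two_pos) (t + t) r κ a σ σ =
      (A.apply a ((overwrite (1 : Fin 2)).apply ()
        (σ ⊗ₖ (overwrite (0 : Fin 2)).apply () (σ ⊗ₖ κ)))).trace.re := by
    rw [← h0, ← h1]; rfl
  have h3 : (((κ.trace.re : ℝ) : ℂ) • copies 2 σ) = κ.trace.re • copies 2 σ := by
    ext x y
    simp
  rw [h2, overwrite_overwrite, PosSemidef.trace_eq_re hκ, h3, Instrument.apply_smul,
    Matrix.trace_smul, Solver.prob]
  simp

/-- The probability that the honest prover with the solver `A` wins a round of the test `p`. -/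
def winRate (A : Solver 2 n) (gs : List (Cliff n)) (ρ : State (Qubits n)) (p : Bool) : ℝ :=
  1 / 2 * (circuitAvg gs (fun U => A.prob (!p) (U * ρ.1 * Uᴴ)) 1 +
    circuitAvg gs (fun U => A.prob p (U * refState n p * Uᴴ)) 1)

lemma winProb_prover (A : Solver 2 n) {s : ℕ} (hs : Even s) (r : ℕ) (gs : List (Cliff n))
    (ρ : State (Qubits n)) (p : Bool) {κ : Matrix (Fin 2 → Qubits n) (Fin 2 → Qubits n) ℂ}
    (hκ : κ.PosSemidef) :
    winProb (A.prover two_pos) s r gs ρ p κ = winRate A gs ρ p * κ.trace.re := by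
  simp only [winProb, pairProb_prover A hs r hκ, circuitAvg_const_mul, winRate]
  ring

variable {A : Solver 2 n} {η : ℝ} (hn : 0 < n)

lemma Solver.Solves.le_prob_mixed (hA : A.Solves (purityTesting n hn) η) :
    1 - η ≤ A.prob true (mixed n).1 := by
  have h := hA (mixed n)
  simp only [Fintype.sum_bool, valid_mixed hn, if_true, Bool.false_eq_true, if_false,
    add_zero] at h
  exact h

lemma Solver.Solves.le_prob_pure (hA : A.Solves (purityTesting n hn) η) {ρ : State (Qubits n)}
    (hρ : ρ.IsPure) : 1 - η ≤ A.prob false ρ.1 := by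
  have h := hA ρ
  simp only [Fintype.sum_bool, valid_pure hn hρ, if_true, Bool.true_eq_false, if_false,
    zero_add] at h
  exact h

lemma le_circuitAvg_mixed (hA : A.Solves (purityTesting n hn) η) (gs : List (Cliff n)) :
    1 - η ≤ circuitAvg gs (fun U => A.prob true (U * (mixed n).1 * Uᴴ)) 1 := by
  rw [← circuitAvg_const gs (1 - η) 1]
  refine circuitAvg_mono_on gs (fun U hU => ?_) (by simp)
  rw [conj_mixed hU]
  exact hA.le_prob_mixed hn

lemma le_circuitAvg_pure (hA : A.Solves (purityTesting n hn) η) (gs : List (Cliff n))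
    {ρ : State (Qubits n)} (hρ : ρ.IsPure) :
    1 - η ≤ circuitAvg gs (fun U => A.prob false (U * ρ.1 * Uᴴ)) 1 := by
  rw [← circuitAvg_const gs (1 - η) 1]
  refine circuitAvg_mono_on gs (fun U hU => ?_) (by simp)
  have h : 1 - η ≤ A.prob false (ρ.conj hU).1 := hA.le_prob_pure hn (hρ.conj hU)
  exact h

/-- On every state, the honest prover has an advantage in one of the tests. -/
lemma le_winRate_add (hA : A.Solves (purityTesting n hn) η) (gs : List (Cliff n))
    (ρ : State (Qubits n)) : 3 / 2 - η ≤ winRate A gs ρ false + winRate A gs ρ true := by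
  have h1 := le_circuitAvg_mixed hn hA gs
  have h2 := le_circuitAvg_pure hn hA gs zeroPure_isPure
  have h3 : circuitAvg gs (fun U => A.prob true (U * ρ.1 * Uᴴ)) 1 +
      circuitAvg gs (fun U => A.prob false (U * ρ.1 * Uᴴ)) 1 = 1 := by
    rw [← circuitAvg_add, ← circuitAvg_const gs 1 1]
    exact circuitAvg_congr_on gs (fun U hU => A.prob_add (ρ.conj hU)) (by simp)
  have e1 : refState n true = (mixed n).1 := rfl
  have e0 : refState n false = (zeroPure n).1 := rfl
  rw [winRate, winRate, e1, e0]
  simp only [Bool.not_false, Bool.not_true]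
  linarith

lemma le_winRate_mixed (hA : A.Solves (purityTesting n hn) η) (gs : List (Cliff n)) :
    1 - η ≤ winRate A gs (mixed n) false := by
  have h1 := le_circuitAvg_mixed hn hA gs
  have h2 := le_circuitAvg_pure hn hA gs zeroPure_isPure
  have e0 : refState n false = (zeroPure n).1 := rfl
  rw [winRate, e0]
  simp only [Bool.not_false]
  linarith

lemma le_winRate_pure (hA : A.Solves (purityTesting n hn) η) (gs : List (Cliff n))
    {ρ : State (Qubits n)} (hρ : ρ.IsPure) : 1 - η ≤ winRate A gs ρ true := by
  have h1 := le_circuitAvg_mixed hn hA gs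
  have h2 := le_circuitAvg_pure hn hA gs hρ
  have e1 : refState n true = (mixed n).1 := rfl
  rw [winRate, e1]
  simp only [Bool.not_true]
  linarith

end HonestWins

/-! ### The interaction over many rounds -/

section Rounds

variable {n T : ℕ} {ks : List LayerKind}

/-- `N` rounds of the test `p`. -/
def rounds (T : ℕ) (ks : List LayerKind) (p : Bool) (N : ℕ) : List (Instr n (memSize n T ks.length)) :=
  (List.replicate N (round T ks p)).flatten

lemma rounds_succ (p : Bool) (N : ℕ) :
    rounds (n := n) T ks p (N + 1) = round T ks p ++ rounds T ks p N := by
  rw [rounds, List.replicate_succ, List.flatten_cons, rounds]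

lemma sendCount_append {c : ℕ} (p q : List (Instr n c)) :
    sendCount (p ++ q) = sendCount p + sendCount q := List.countP_append

lemma recvCount_append {c : ℕ} (p q : List (Instr n c)) :
    recvCount (p ++ q) = recvCount p + recvCount q := List.countP_append

lemma sendCount_map_layer {c : ℕ} (L : List (List (Op n c))) : sendCount (L.map .layer) = 0 := by
  rw [sendCount, List.countP_eq_zero]
  intro a ha
  obtain ⟨l, _, rfl⟩ := List.mem_map.1 ha
  simp

lemma recvCount_map_layer {c : ℕ} (L : List (List (Op n c))) : recvCount (L.map .layer) = 0 := by
  rw [recvCount, List.countP_eq_zero]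
  intro a ha
  obtain ⟨l, _, rfl⟩ := List.mem_map.1 ha
  simp

/-- The layers of the classical computation in a round. -/
def scoreLayers (T : ℕ) (ks : List LayerKind) (p : Bool) : List (List (Op n (memSize n T ks.length))) :=
  [.bool (bit .car) (bit .ans) (bit .secret) fun a c => xor (xor a c) p] ::
  (List.finRange T).flatMap fun i =>
    [[.bool (bit .tmp) (bit (.cnt p i)) (bit .car) (· && ·)],
     [.bool (bit (.cnt p i)) (bit (.cnt p i)) (bit .car) (· || ·)],
     [.bool (bit .car) (bit .tmp) (bit .tmp) (· && ·)]]

lemma scoring_eq (p : Bool) :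
    scoring (n := n) T ks p = .recv (bit .ans) :: (scoreLayers T ks p).map .layer := by
  rw [scoring, scoreLayers, List.map_cons, List.map_flatMap]
  rfl

lemma sendCount_round (p : Bool) : sendCount (round (n := n) T ks p) = 2 := by
  have hb : ∀ h, sendCount (block (n := n) T ks h) = 1 := by
    intro h
    have := sendCount_map_layer (blockLayers (n := n) T ks h)
    have e : sendCount (block (n := n) T ks h) = sendCount ((blockLayers (n := n) T ks h).map .layer ++
      [.send]) := by simp [block, sendCount]
    rw [e, sendCount_append, this]
    rfl
  have hs : sendCount (scoring (n := n) T ks p) = 0 := by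
    rw [scoring_eq]
    simp [sendCount]
  have e : sendCount (round (n := n) T ks p) = sendCount (block (n := n) T ks false ++
    (block T ks true ++ scoring T ks p)) := by simp [round, sendCount]
  rw [e, sendCount_append, sendCount_append, hb, hb, hs]

lemma recvCount_round (p : Bool) : recvCount (round (n := n) T ks p) = 1 := by
  have hb : ∀ h, recvCount (block (n := n) T ks h) = 0 := by
    intro h
    have := recvCount_map_layer (blockLayers (n := n) T ks h)
    have e : recvCount (block (n := n) T ks h) = recvCount ((blockLayers (n := n) T ks h).map .layer ++
      [.send]) := by simp [block, recvCount]
    rw [e, recvCount_append, this]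
    rfl
  have hs : recvCount (scoring (n := n) T ks p) = 1 := by
    have := recvCount_map_layer (scoreLayers (n := n) T ks p)
    rw [recvCount] at this
    rw [scoring_eq]
    simp [recvCount, this]
  have e : recvCount (round (n := n) T ks p) = recvCount (block (n := n) T ks false ++
    (block T ks true ++ scoring T ks p)) := by simp [round, recvCount]
  rw [e, recvCount_append, recvCount_append, hb, hb, hs]

lemma counts_le (μ : Mem (memSize n T ks.length)) (b : Bool) : counts μ b ≤ T :=
  (List.countP_le_length (l := List.finRange T)).trans_eq List.length_finRange

/-- The expectation of the function `G` of the counters. -/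
def potential {K : Type} [Fintype K] (G : (Bool → ℕ) → ℝ) (Ψ : Joint n (memSize n T ks.length) K) : ℝ :=
  ∑ μ, G (counts μ) * (Ψ μ).trace.re

lemma trace_traceReg {K : Type} [Fintype K] (σ : Matrix (Qubits n × K) (Qubits n × K) ℂ) :
    (traceReg σ).trace = σ.trace := by
  simp only [Matrix.trace, Matrix.diag, traceReg, Fintype.sum_prod_type]
  exact Finset.sum_comm

lemma re_pairing_smul_one {c : ℕ} {K : Type} [Fintype K] [DecidableEq K] (F : Mem c → ℝ)
    (Ψ : Joint n c K) :
    (pairing (fun μ => ((F μ : ℝ) : ℂ) • 1) Ψ).re = ∑ μ, F μ * (Ψ μ).trace.re := by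
  rw [pairing, Complex.re_sum]
  refine Finset.sum_congr rfl fun μ _ => ?_
  rw [Matrix.smul_mul, Matrix.one_mul, Matrix.trace_smul, smul_eq_mul, Complex.re_ofReal_mul]

/-- The change of a potential in a round. -/
lemma potential_round (ρ : State (Qubits n)) (P : Prover n) (p : Bool) (s r : ℕ)
    (G : (Bool → ℕ) → ℝ) (Ψ : Joint n (memSize n T ks.length) P.K) :
    potential G (runProgram ρ P (round T ks p) s r Ψ) =
      ∑ μ, ((G (incr T p (counts μ)) - G (counts μ)) *
        winProb P s r (gatesOf n ks) ρ p (traceReg (Ψ μ)) + G (counts μ) * (Ψ μ).trace.re) := by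
  have h := pairing_round ρ P p s r G Ψ
  rw [re_pairing_smul_one] at h
  simp only [trace_traceReg] at h
  exact h

lemma potential_mono {K : Type} [Fintype K] {G G' : (Bool → ℕ) → ℝ}
    (h : ∀ N : Bool → ℕ, (∀ b, N b ≤ T) → G N ≤ G' N) {Ψ : Joint n (memSize n T ks.length) K}
    (hΨ : Ψ.Pos) : potential G Ψ ≤ potential G' Ψ :=
  Finset.sum_le_sum fun μ _ => mul_le_mul_of_nonneg_right (h _ (counts_le μ))
    (PosSemidef.trace_re_nonneg (hΨ μ))

lemma potential_add {K : Type} [Fintype K] (G G' : (Bool → ℕ) → ℝ)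
    (Ψ : Joint n (memSize n T ks.length) K) :
    potential (fun N => G N + G' N) Ψ = potential G Ψ + potential G' Ψ := by
  simp only [potential, add_mul, Finset.sum_add_distrib]

lemma potential_const_mul {K : Type} [Fintype K] (a : ℝ) (G : (Bool → ℕ) → ℝ)
    (Ψ : Joint n (memSize n T ks.length) K) :
    potential (fun N => a * G N) Ψ = a * potential G Ψ := by
  simp only [potential, Finset.mul_sum, mul_assoc]

/-- A potential that does not depend on the counter of the test `p` does not change in rounds of this
test. -/
lemma potential_rounds_eq (ρ : State (Qubits n)) (P : Prover n) (p : Bool) {G : (Bool → ℕ) → ℝ}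
    (hG : ∀ N, G (incr T p N) = G N) (N s r : ℕ) (Ψ : Joint n (memSize n T ks.length) P.K) :
    potential G (runProgram ρ P (rounds T ks p N) s r Ψ) = potential G Ψ := by
  induction N generalizing s r Ψ with
  | zero => rfl
  | succ N ih =>
    rw [rounds_succ, runProgram_append, ih, potential_round]
    simp [hG, potential]

/-- A potential that changes at most by the factor `q` in every round. -/
lemma potential_rounds_le (ρ : State (Qubits n)) (P : Prover n) (p : Bool) {G : (Bool → ℕ) → ℝ}
    {q : ℝ} (hq : 0 ≤ q)
    (hG : ∀ s r (κ : Matrix P.K P.K ℂ), Even s → κ.PosSemidef → ∀ N : Bool → ℕ, (∀ b, N b ≤ T) →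
      (G (incr T p N) - G N) * winProb P s r (gatesOf n ks) ρ p κ + G N * κ.trace.re ≤
        q * (G N * κ.trace.re))
    (N s r : ℕ) (hs : Even s) {Ψ : Joint n (memSize n T ks.length) P.K} (hΨ : Ψ.Pos) :
    potential G (runProgram ρ P (rounds T ks p N) s r Ψ) ≤ q ^ N * potential G Ψ := by
  induction N generalizing s r Ψ with
  | zero => simp [rounds, runProgram]
  | succ N ih =>
    rw [rounds_succ, runProgram_append]
    refine (ih _ _ ?_ (pos_runProgram ρ P _ _ _ hΨ)).trans ?_
    · rw [sendCount_round]; exact hs.add even_two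
    · rw [pow_succ, mul_assoc]
      refine mul_le_mul_of_nonneg_left ?_ (pow_nonneg hq N)
      rw [potential_round, potential, Finset.mul_sum]
      refine Finset.sum_le_sum fun μ _ => ?_
      have := hG s r (traceReg (Ψ μ)) hs (posSemidef_traceReg (hΨ μ)) (counts μ) (counts_le μ)
      rwa [trace_traceReg] at this

/-- The two tests, with `N` rounds each. -/
def tests (T : ℕ) (ks : List LayerKind) (N : ℕ) : List (Instr n (memSize n T ks.length)) :=
  rounds T ks false N ++ rounds T ks true N

lemma sendCount_rounds (p : Bool) (N : ℕ) : sendCount (rounds (n := n) T ks p N) = 2 * N := by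
  induction N with
  | zero => rfl
  | succ N ih => rw [rounds_succ, sendCount_append, sendCount_round, ih]; ring

lemma recvCount_rounds (p : Bool) (N : ℕ) : recvCount (rounds (n := n) T ks p N) = N := by
  induction N with
  | zero => rfl
  | succ N ih => rw [rounds_succ, recvCount_append, recvCount_round, ih]; ring

/-- A function of the counter of one test only changes in the rounds of that test. -/
lemma potential_tests_le (ρ : State (Qubits n)) (P : Prover n) (p : Bool) (g : ℕ → ℝ)
    {q : ℝ} (hq : 0 ≤ q)
    (hG : ∀ s r (κ : Matrix P.K P.K ℂ), Even s → κ.PosSemidef → ∀ N ≤ T,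
      (g (min T (N + 1)) - g N) * winProb P s r (gatesOf n ks) ρ p κ + g N * κ.trace.re ≤
        q * (g N * κ.trace.re))
    (N : ℕ) {Ψ : Joint n (memSize n T ks.length) P.K} (hΨ : Ψ.Pos) :
    potential (fun N => g (N p)) (runProgram ρ P (tests T ks N) 0 0 Ψ) ≤
      q ^ N * potential (fun N => g (N p)) Ψ := by
  have h1 : ∀ N : Bool → ℕ, g (incr T p N p) = g (min T (N p + 1)) := fun N => by simp [incr]
  have h2 : ∀ p', p' ≠ p → ∀ N : Bool → ℕ, g (incr T p' N p) = g (N p) := fun p' hp N => by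
    rw [incr, Function.update_of_ne hp.symm]
  have h3 := potential_rounds_le ρ P p (G := fun N => g (N p)) hq
    (fun s r κ hs hκ N hN => by rw [h1]; exact hG s r κ hs hκ (N p) (hN p)) N
  rw [tests, runProgram_append]
  cases p
  · rw [potential_rounds_eq ρ P true (G := fun N => g (N false)) (h2 true (by simp))]
    exact h3 0 0 (by simp) hΨ
  · refine (h3 _ _ ?_ (pos_runProgram ρ P _ _ _ hΨ)).trans_eq ?_
    · rw [sendCount_rounds]; simp
    · rw [potential_rounds_eq ρ P false (G := fun N => g (N true)) (h2 false (by simp))]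

/-- The state at the start of an interaction. -/
def startState (c : ℕ) (P : Prover n) : Joint n c P.K := fun μ =>
  if μ = fun _ => false then zeroState n ⊗ₖ P.start.1 else 0

lemma pos_startState (c : ℕ) (P : Prover n) : (startState c P).Pos := by
  intro μ
  rw [startState]
  split_ifs
  · exact posSemidef_zeroState.kronecker P.start.2.1
  · exact Matrix.PosSemidef.zero

lemma potential_startState (P : Prover n) (G : (Bool → ℕ) → ℝ) :
    potential G (startState (memSize n T ks.length) P) = G fun _ => 0 := by
  rw [potential, Finset.sum_eq_single (fun _ => false)]
  · have h : counts (fun _ => false : Mem (memSize n T ks.length)) = fun _ => 0 := by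
      funext b; simp [counts]
    rw [h, startState, if_pos rfl, Matrix.trace_kronecker, trace_zeroState, P.start.2.2]
    simp
  · intro μ _ hμ
    simp [startState, hμ]
  · simp

/-- Conservation of probability. -/
lemma potential_tests_one (ρ : State (Qubits n)) (P : Prover n) (N : ℕ) :
    potential (fun _ => 1) (runProgram ρ P (tests T ks N) 0 0 (startState _ P)) = 1 := by
  rw [tests, runProgram_append, potential_rounds_eq _ _ _ fun _ => rfl,
    potential_rounds_eq _ _ _ fun _ => rfl, potential_startState]

set_option exponentiation.threshold 600 in
/-- The factor `1.02555 = 1 + 0.05 * 0.511` is the growth of `1.05 ^ N` in a round that is won with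
probability `0.511`. -/
lemma chernoff_upper : (1.02555 : ℝ) ^ 500 ≤ 1.05 ^ 261 * 0.9 := by norm_num

set_option exponentiation.threshold 600 in
/-- The factor `0.97335 = 1 - 0.05 * 0.533` is the decay of `0.95 ^ N` in a round that is won with
probability `0.533`. -/
lemma chernoff_lower : (0.97335 : ℝ) ^ 500 ≤ 0.95 ^ 261 * 0.9 := by norm_num

/-- If the prover wins each round with probability at most `0.511`, then its number of wins in `500 M`
rounds rarely reaches `261 M`: the expectation of `1.05 ^ N` is too small. -/
lemma potential_reached_le (ρ : State (Qubits n)) (P : Prover n) (p : Bool) {M : ℕ} (hT : T = 261 * M)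
    (hw : ∀ s r (κ : Matrix P.K P.K ℂ), κ.PosSemidef →
      winProb P s r (gatesOf n ks) ρ p κ ≤ 0.511 * κ.trace.re) :
    potential (fun N => if N p = T then 1 else 0)
      (runProgram ρ P (tests T ks (500 * M)) 0 0 (startState _ P)) ≤ 0.9 ^ M := by
  have h := potential_tests_le ρ P p (T := T) (ks := ks) (fun N => (1.05 : ℝ) ^ N) (q := 1.02555)
    (by norm_num) (by
      intro s r κ _ hκ N hN
      have h0 := winProb_nonneg P s r (gatesOf n ks) ρ p hκ
      have h1 := hw s r κ hκ
      have h2 : (1.05 : ℝ) ^ min T (N + 1) ≤ 1.05 ^ N * 1.05 := by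
        rw [← pow_succ]
        exact pow_le_pow_right₀ (by norm_num) (min_le_right _ _)
      have h3 : (0 : ℝ) < 1.05 ^ N := by positivity
      have h4 := mul_le_mul_of_nonneg_right h2 h0
      have h5 := mul_le_mul_of_nonneg_left h1 h3.le
      linarith) (500 * M) (pos_startState _ P)
  rw [potential_startState, pow_zero, mul_one] at h
  have h2 : (1.05 : ℝ) ^ T * potential (fun N => if N p = T then 1 else 0)
      (runProgram ρ P (tests T ks (500 * M)) 0 0 (startState _ P)) ≤ 1.02555 ^ (500 * M) := by
    refine le_trans ?_ h
    rw [← potential_const_mul]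
    refine potential_mono (fun N _ => ?_) (pos_runProgram _ _ _ _ _ (pos_startState _ P))
    split_ifs with hN
    · rw [hN, mul_one]
    · rw [mul_zero]; positivity
  have h3 : (1.02555 : ℝ) ^ (500 * M) ≤ 1.05 ^ T * 0.9 ^ M := by
    rw [hT, pow_mul, pow_mul, ← mul_pow]
    exact pow_le_pow_left₀ (by positivity) chernoff_upper M
  exact le_of_mul_le_mul_left (h2.trans h3) (by positivity)

/-- If the prover wins each round with probability at least `0.533`, then its number of wins in
`500 M` rounds rarely stays below `261 M`. The potential `0.95 ^ N` is replaced by `0` once the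
counter is full, as it does not increase any more. -/
lemma potential_missed_le (ρ : State (Qubits n)) (P : Prover n) (p : Bool) {M : ℕ} (hT : T = 261 * M)
    (hw : ∀ s r (κ : Matrix P.K P.K ℂ), Even s → κ.PosSemidef →
      0.533 * κ.trace.re ≤ winProb P s r (gatesOf n ks) ρ p κ) :
    potential (fun N => if N p = T then 0 else 1)
      (runProgram ρ P (tests T ks (500 * M)) 0 0 (startState _ P)) ≤ 0.9 ^ M := by
  have h := potential_tests_le ρ P p (T := T) (ks := ks)
    (fun N => if N = T then 0 else (0.95 : ℝ) ^ N) (q := 0.97335)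
    (by norm_num) (by
      intro s r κ hs hκ N hN
      have h1 := hw s r κ hs hκ
      have h0 := winProb_nonneg P s r (gatesOf n ks) ρ p hκ
      by_cases hNT : N = T
      · simp [hNT]
      · have hlt : N + 1 ≤ T := by omega
        rw [min_eq_right hlt, if_neg hNT]
        have h3 : (0 : ℝ) < 0.95 ^ N := by positivity
        have h2 : (if N + 1 = T then 0 else (0.95 : ℝ) ^ (N + 1)) ≤ 0.95 ^ N * 0.95 := by
          rw [← pow_succ]
          split_ifs
          · positivity
          · exact le_rfl
        have h4 := mul_le_mul_of_nonneg_right h2 h0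
        have h5 := mul_le_mul_of_nonneg_left h1 h3.le
        linarith) (500 * M) (pos_startState _ P)
  rw [potential_startState] at h
  have h1 : (if 0 = T then 0 else (0.95 : ℝ) ^ 0) ≤ 1 := by split_ifs <;> norm_num
  have h2 : (0.95 : ℝ) ^ T * potential (fun N => if N p = T then 0 else 1)
      (runProgram ρ P (tests T ks (500 * M)) 0 0 (startState _ P)) ≤ 0.97335 ^ (500 * M) := by
    refine le_trans ?_ (h.trans (mul_le_of_le_one_right (by positivity) h1))
    rw [← potential_const_mul]
    refine potential_mono (fun N hN => ?_) (pos_runProgram _ _ _ _ _ (pos_startState _ P))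
    split_ifs with hNT
    · rw [mul_zero]
    · rw [mul_one]
      exact pow_le_pow_of_le_one (by norm_num) (by norm_num) (hN p)
  have h3 : (0.97335 : ℝ) ^ (500 * M) ≤ 0.95 ^ T * 0.9 ^ M := by
    rw [hT, pow_mul, pow_mul, ← mul_pow]
    exact pow_le_pow_left₀ (by positivity) chernoff_lower M
  exact le_of_mul_le_mul_left (h2.trans h3) (by positivity)

end Rounds

/-! ### The verifier -/

section Verifier

variable {n : ℕ} (T : ℕ) (ks : List LayerKind)

/-- The bits that are combined to decide whether the counter of the test `b` is full. -/
def andBits (b : Bool) : List (Fin (memSize n T ks.length) × Fin (memSize n T ks.length) ×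
    Fin (memSize n T ks.length)) :=
  (List.finRange T).map fun i => (bit (.acc b), bit (.acc b), bit (.cnt b i))

/-- The layers that determine which counters are full. -/
def decideLayers : List (List (Op n (memSize n T ks.length))) :=
  [.bool (bit (.acc false)) (bit .one) (bit .one) fun _ _ => true] ::
  [.bool (bit (.acc true)) (bit .one) (bit .one) fun _ _ => true] ::
  (List.map (fun q => [Op.bool q.1 q.2.1 q.2.2 (· && ·)])
    (andBits (n := n) T ks false ++ andBits (n := n) T ks true) ++
  [[.bool (bit .abort) (bit (.acc false)) (bit (.acc true)) fun a c => !(a || c)]])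

variable {T ks}

/-- The memory at the end, before it is decided whether to abort. -/
def decideMap (μ : Mem (memSize n T ks.length)) : Mem (memSize n T ks.length) :=
  boolMap (· && ·) (andBits T ks false ++ andBits T ks true)
    (Function.update (Function.update μ (bit (.acc false)) true) (bit (.acc true)) true)

lemma flatten_map_singleton {α β : Type*} (f : α → β) (l : List α) :
    (l.map fun a => [f a]).flatten = l.map f := by
  induction l with
  | nil => rfl
  | cons a l ih => simp [ih]

lemma programDual_decideLayers (ρ : State (Qubits n)) (P : Prover n) (s r : ℕ)
    (E : Joint n (memSize n T ks.length) P.K) :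
    programDual ρ P ((decideLayers T ks).map .layer) s r E = fun μ =>
      E (Function.update (decideMap μ) (bit .abort)
        !(decideMap μ (bit (.acc false)) || decideMap μ (bit (.acc true)))) := by
  have h := programDual_layers ρ P (decideLayers T ks) [] s r E
  rw [List.append_nil] at h
  rw [h, decideLayers, List.flatten_cons, List.flatten_cons, List.flatten_append, flatten_map_singleton]
  simp only [programDual, List.flatten_cons, List.flatten_nil, List.foldr_append, List.foldr_cons,
    List.foldr_nil, foldr_dual_bool, Op.dual_bool]
  rfl

lemma boolMap_and_self {c : ℕ} {I : Type} (k : Fin c) (j : I → Fin c) (hj : ∀ i, j i ≠ k) (l : List I)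
    (μ : Mem c) : boolMap (· && ·) (l.map fun i => (k, k, j i)) μ k = (μ k && l.all fun i => μ (j i)) := by
  induction l generalizing μ with
  | nil => simp [boolMap]
  | cons i l ih =>
    refine (ih _).trans ?_
    simp only [Function.update_self, Function.update_of_ne (hj _), List.all_cons, Bool.and_assoc]

lemma boolMap_append {c : ℕ} (f : Bool → Bool → Bool) (L L' : List (Fin c × Fin c × Fin c))
    (μ : Mem c) : boolMap f (L ++ L') μ = boolMap f L' (boolMap f L μ) := List.foldl_append

lemma all_cnt_eq (μ : Mem (memSize n T ks.length)) (b : Bool) :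
    ((List.finRange T).all fun i => μ (bit (.cnt b i))) = decide (counts μ b = T) := by
  rw [Bool.eq_iff_iff, decide_eq_true_iff, List.all_eq_true]
  have h := List.countP_eq_length (p := fun i => μ (bit (.cnt b i : VBit n T ks.length)))
    (l := List.finRange T)
  rw [List.length_finRange] at h
  exact h.symm

lemma decideMap_acc (μ : Mem (memSize n T ks.length)) (b : Bool) :
    decideMap μ (bit (.acc b)) = decide (counts μ b = T) := by
  rw [decideMap, boolMap_append, ← all_cnt_eq]
  cases b
  · rw [boolMap_of_notMem _ (by simp [andBits]), andBits, boolMap_and_self _ _ (by simp)]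
    simp
  · rw [andBits, andBits, boolMap_and_self _ _ (by simp), boolMap_of_notMem _ (by simp)]
    simp only [Function.update_self, Bool.true_and]
    congr 1
    funext i
    rw [boolMap_of_notMem _ (by simp)]
    simp

/-! ### Layers of parallel operations -/

lemma Cliff.writes_toOp {c : ℕ} (k : Fin c) (g : Cliff n) : (g.toOp k).writes = ∅ := by
  cases g <;> rfl

/-- The qubits a gate acts on. -/
def Cliff.support : Cliff n → Finset (Fin n)
  | .loc _ i => {i}
  | .cz i j _ => {i, j}

lemma Cliff.qubits_toOp {c : ℕ} (k : Fin c) (g : Cliff n) : (g.toOp k).qubits = g.support := by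
  cases g with
  | loc k i =>
    ext q
    have e : ∀ t, wire i t = i := fun _ => rfl
    simp [Cliff.toOp, Op.qubits, Cliff.support, e, eq_comm]
  | cz i j h =>
    ext q
    have e0 : wirePair i j h 0 = i := rfl
    have e1 : wirePair i j h 1 = j := rfl
    simp [Cliff.toOp, Op.qubits, Cliff.support, e0, e1, Fin.exists_fin_two, eq_comm]

lemma pairwise_toOp {c : ℕ} {l : List (Fin c × Cliff n)}
    (h : l.Pairwise fun p q => Disjoint p.2.support q.2.support) :
    (l.map fun p => p.2.toOp p.1).Pairwise Op.Parallel := by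
  rw [List.pairwise_map]
  refine h.imp fun {p q} hpq => ?_
  simp only [Op.Parallel, Cliff.qubits_toOp, Cliff.writes_toOp]
  exact ⟨hpq, disjoint_bot_left, disjoint_bot_left, disjoint_bot_right⟩

/-- The gates of a layer act on different qubits. -/
lemma pairwise_gates (k : LayerKind) :
    (k.gates n).Pairwise fun g g' => Disjoint g.support g'.support := by
  cases k with
  | loc k =>
    rw [LayerKind.gates, List.pairwise_map]
    refine (List.nodup_finRange n).imp fun {i j} hij => ?_
    simpa [Cliff.support] using hij
  | cz t p =>
    rw [LayerKind.gates, List.pairwise_filterMap]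
    refine (List.nodup_finRange n).imp fun {i j} hij => ?_
    intro g hg g' hg'
    split_ifs at hg hg' with hi hj
    · rw [Option.some.injEq] at hg hg'
      subst hg hg'
      obtain ⟨hi1, ht, hi2⟩ := hi
      obtain ⟨hj1, _, hj2⟩ := hj
      -- the quotients of `i` and `i + t` by `t` have different parities
      have e : ∀ a : ℕ, (a + t) / t = a / t + 1 := fun a => Nat.add_div_right a ht
      have h1 : ¬ i.1 = j.1 + t := fun h => by
        have := e j.1
        rw [← h] at this
        omega
      have h2 : ¬ i.1 + t = j.1 := fun h => by
        have := e i.1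
        rw [h] at this
        omega
      have h3 : ¬ i.1 = j.1 := fun h => hij (Fin.ext h)
      rw [Finset.disjoint_left]
      intro a ha ha'
      simp only [Cliff.support, Finset.mem_insert, Finset.mem_singleton, Fin.ext_iff] at ha ha'
      omega

lemma pairwise_circuitLayer (t : Fin ks.length) :
    ((circuitLayer (n := n) T ks t).map fun p => p.2.toOp p.1).Pairwise Op.Parallel := by
  refine pairwise_toOp ?_
  rw [circuitLayer, List.pairwise_map]
  exact pairwise_gates _

lemma parallel_bool {c : ℕ} (f : Bool → Bool → Bool) {L : List (Fin c × Fin c × Fin c)}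
    (hL : (L.map Prod.fst).Nodup) (hr : ∀ q ∈ L, q.2.1 ∉ L.map Prod.fst ∧ q.2.2 ∉ L.map Prod.fst) :
    (L.map fun q => (Op.bool q.1 q.2.1 q.2.2 f : Op n c)).Pairwise Op.Parallel := by
  rw [List.pairwise_map]
  rw [List.Nodup, List.pairwise_map] at hL
  refine hL.imp_of_mem fun {q q'} hq hq' hne => ?_
  have h1 := hr q hq
  have h2 := hr q' hq'
  have m1 : q.1 ∈ L.map Prod.fst := List.mem_map_of_mem hq
  have m2 : q'.1 ∈ L.map Prod.fst := List.mem_map_of_mem hq'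
  have e : ∀ a b : Fin c, a ∈ L.map Prod.fst → b ∉ L.map Prod.fst → a ≠ b := fun a b ha hb h =>
    hb (h ▸ ha)
  simp only [Op.Parallel, Op.qubits, Op.writes, Op.reads, Finset.disjoint_singleton_left,
    Finset.disjoint_singleton_right, Finset.mem_insert, Finset.mem_singleton, not_or]
  exact ⟨disjoint_bot_left, hne.symm, ⟨e _ _ m1 h2.1, e _ _ m1 h2.2⟩, ⟨e _ _ m2 h1.1, e _ _ m2 h1.2⟩⟩

lemma nodup_coinBits : (coinBits (n := n) T ks).Nodup := by
  have hc : ∀ k ∈ coinsOf (circuit (n := n) T ks), ∃ t i, k = bit (.coin t i) :=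
    fun k hk => coin_of_mem_coinsOf hk
  rw [coinBits, List.nodup_cons, List.nodup_append, List.nodup_append]
  refine ⟨?_, nodup_coinsOf_circuit, ⟨nodup_map_bit _ (fun i j h => by simpa using h)
    (List.nodup_finRange n), nodup_map_bit _ (fun i j h => by simpa using h)
    (List.nodup_finRange n), ?_⟩, ?_⟩
  · intro h
    rw [List.mem_append] at h
    rcases h with h | h
    · obtain ⟨t, i, h⟩ := hc _ h
      simp at h
    · simp at h
  · intro a ha b hb
    obtain ⟨i, _, rfl⟩ := List.mem_map.1 ha
    obtain ⟨j, _, rfl⟩ := List.mem_map.1 hb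
    simp
  · intro a ha b hb
    obtain ⟨t, i, rfl⟩ := hc _ ha
    rw [List.mem_append] at hb
    rcases hb with hb | hb <;>
    · obtain ⟨j, _, rfl⟩ := List.mem_map.1 hb
      simp

/-- The layers of a program have the property `φ`. -/
def AllLayers {c : ℕ} (φ : List (Op n c) → Prop) (p : List (Instr n c)) : Prop :=
  ∀ l, Instr.layer l ∈ p → φ l

lemma AllLayers.append {c : ℕ} {φ : List (Op n c) → Prop} {p q : List (Instr n c)}
    (hp : AllLayers φ p) (hq : AllLayers φ q) : AllLayers φ (p ++ q) := fun l hl =>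
  (List.mem_append.1 hl).elim (hp l) (hq l)

lemma allLayers_map_layer {c : ℕ} {φ : List (Op n c) → Prop} {L : List (List (Op n c))}
    (h : ∀ l ∈ L, φ l) : AllLayers φ (L.map Instr.layer) := by
  intro l hl
  obtain ⟨l', hl', e⟩ := List.mem_map.1 hl
  rw [Instr.layer.injEq] at e
  exact e ▸ h l' hl'

/-- A property of all layers of the program, except the final decision, has to be checked for six
kinds of layers. -/
lemma allLayers_tests {φ : List (Op n (memSize n T ks.length)) → Prop}
    (hsingle : ∀ k i j f, φ [.bool k i j f])
    (hcoin : φ ((coinBits T ks).map .coin))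
    (hflip : ∀ f, φ ((flipBits T ks).map fun q => .bool q.1 q.2.1 q.2.2 f))
    (hreset : φ ((List.finRange n).map (Op.reset (bit .secret))))
    (hprep : ∀ h, φ ((flips T ks h).map fun p => p.2.toOp p.1))
    (hcirc : ∀ t, φ ((circuitLayer T ks t).map fun p => p.2.toOp p.1)) (N : ℕ) :
    AllLayers φ (tests (n := n) T ks N) := by
  have hb : ∀ h, AllLayers φ (block (n := n) T ks h) := by
    intro h l hl
    have hl' : Instr.layer l ∈ (blockLayers (n := n) T ks h).map Instr.layer := by
      simpa [block] using hl
    refine allLayers_map_layer (fun l hl => ?_) l hl'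
    rw [blockLayers, List.mem_cons, List.mem_cons] at hl
    rcases hl with rfl | rfl | hl
    · exact hreset
    · exact hprep h
    · obtain ⟨t, _, rfl⟩ := List.mem_map.1 hl
      exact hcirc t
  have hs : ∀ p, AllLayers φ (scoring (n := n) T ks p) := by
    intro p l hl
    rw [scoring_eq, List.mem_cons] at hl
    refine allLayers_map_layer (L := scoreLayers T ks p) (fun l hl => ?_) l (by simpa using hl)
    rw [scoreLayers, List.mem_cons, List.mem_flatMap] at hl
    rcases hl with rfl | ⟨i, _, hl⟩
    · exact hsingle _ _ _ _
    · simp only [List.mem_cons, List.not_mem_nil, or_false] at hl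
      rcases hl with rfl | rfl | rfl <;> exact hsingle _ _ _ _
  have hr : ∀ p, AllLayers φ (round (n := n) T ks p) := by
    intro p l hl
    rw [round, List.mem_cons, List.mem_cons, List.mem_cons] at hl
    rcases hl with hl | hl | hl | hl
    · rw [Instr.layer.injEq] at hl
      exact hl ▸ hsingle _ _ _ _
    · rw [Instr.layer.injEq] at hl
      exact hl ▸ hcoin
    · rw [Instr.layer.injEq] at hl
      exact hl ▸ hflip _
    · exact (hb false).append ((hb true).append (hs p)) l hl
  have hrs : ∀ p, AllLayers φ (rounds (n := n) T ks p N) := by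
    intro p l hl
    rw [rounds, List.mem_flatten] at hl
    obtain ⟨q, hq, hl⟩ := hl
    rw [List.eq_of_mem_replicate hq] at hl
    exact hr p l hl
  exact (hrs false).append (hrs true)

lemma allLayers_decideLayers {φ : List (Op n (memSize n T ks.length)) → Prop}
    (hsingle : ∀ k i j f, φ [.bool k i j f]) : AllLayers φ ((decideLayers T ks).map .layer) := by
  refine allLayers_map_layer fun l hl => ?_
  rw [decideLayers, List.mem_cons, List.mem_cons, List.mem_append] at hl
  rcases hl with rfl | rfl | hl | hl
  · exact hsingle _ _ _ _
  · exact hsingle _ _ _ _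
  · obtain ⟨q, _, rfl⟩ := List.mem_map.1 hl
    exact hsingle _ _ _ _
  · exact List.mem_singleton.1 hl ▸ hsingle _ _ _ _

lemma allLayers_parallel_tests (N : ℕ) :
    AllLayers (fun l => l.Pairwise Op.Parallel) (tests (n := n) T ks N) := by
  refine allLayers_tests (fun _ _ _ _ => List.pairwise_singleton _ _) ?_ (fun f => ?_) ?_
    (fun h => ?_) pairwise_circuitLayer N
  · rw [List.pairwise_map]
    refine nodup_coinBits.imp fun {k k'} hk => ?_
    simpa [Op.Parallel, Op.qubits, Op.writes, Op.reads] using hk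
  · exact parallel_bool _ nodup_map_fst_flipBits fun q => reads_flipBits
  · rw [List.pairwise_map]
    refine (List.nodup_finRange n).imp fun {i j} hij => ?_
    simpa [Op.Parallel, Op.qubits, Op.writes, Op.reads] using hij
  · refine pairwise_toOp ?_
    rw [flips, List.pairwise_map]
    refine (List.nodup_finRange n).imp fun {i j} hij => ?_
    simpa [Cliff.support] using hij

variable (T ks)

/-- The verifier with `N` rounds of each test, thresholds `T` and the random circuit `ks`. It accepts
if the first counter is full, rejects if only the second one is full, and aborts otherwise. -/
def verifier (N : ℕ) : Verifier n where
  c := memSize n T ks.length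
  program := tests T ks N ++ (decideLayers T ks).map .layer
  parallel := (allLayers_parallel_tests N).append
    (allLayers_decideLayers fun _ _ _ _ => List.pairwise_singleton _ _)
  abortBit := bit .abort
  answerBit := bit (.acc false)

/-- The output of the verifier as a function of the counters. -/
def outcome (T : ℕ) (N : Bool → ℕ) : Option Bool :=
  if N false = T then some true else if N true = T then some false else none

variable {T ks}

open Classical in
/-- The indicator function of the counters for which the output lies in `S`. -/
def outcomeInd (T : ℕ) (S : Set (Option Bool)) (N : Bool → ℕ) : ℝ := if outcome T N ∈ S then 1 else 0

lemma outcomeInd_of_mem {S : Set (Option Bool)} {N : Bool → ℕ} (h : outcome T N ∈ S) :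
    outcomeInd T S N = 1 := if_pos h

lemma outcomeInd_of_notMem {S : Set (Option Bool)} {N : Bool → ℕ} (h : outcome T N ∉ S) :
    outcomeInd T S N = 0 := if_neg h

lemma outcomeInd_nonneg (S : Set (Option Bool)) (N : Bool → ℕ) : 0 ≤ outcomeInd T S N := by
  unfold outcomeInd
  split_ifs <;> norm_num

lemma outcomeInd_le_one (S : Set (Option Bool)) (N : Bool → ℕ) : outcomeInd T S N ≤ 1 := by
  unfold outcomeInd
  split_ifs <;> norm_num

lemma sum_runProgram_decideLayers (ρ : State (Qubits n)) (P : Prover n)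
    (p : List (Instr n (memSize n T ks.length))) (F : Mem (memSize n T ks.length) → ℝ)
    (Ψ : Joint n (memSize n T ks.length) P.K) :
    ∑ μ, F μ * (runProgram ρ P (p ++ (decideLayers T ks).map .layer) 0 0 Ψ μ).trace.re =
      ∑ μ, F (Function.update (decideMap μ) (bit .abort)
        !(decideMap μ (bit (.acc false)) || decideMap μ (bit (.acc true)))) *
          (runProgram ρ P p 0 0 Ψ μ).trace.re := by
  rw [← re_pairing_smul_one, runProgram_append, pairing_runProgram, programDual_decideLayers,
    ← re_pairing_smul_one]

/-- The distribution of the output in terms of the counters after the two tests. -/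
lemma outputProb_verifier (ρ : State (Qubits n)) (P : Prover n) (N : ℕ) (S : Set (Option Bool)) :
    outputProb (verifier T ks N) P ρ S = potential (outcomeInd T S)
      (runProgram ρ P (tests T ks N) 0 0 (startState (memSize n T ks.length) P)) := by
  classical
  have h1 : outputProb (verifier T ks N) P ρ S =
      ∑ μ : Mem (memSize n T ks.length), (if (verifier (n := n) T ks N).output μ ∈ S then (1 : ℝ) else 0) *
        (runProgram ρ P (tests T ks N ++ (decideLayers T ks).map .layer) 0 0
          (startState (memSize n T ks.length) P) μ).trace.re := by
    refine Finset.sum_congr rfl fun μ _ => ?_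
    rw [ite_mul, one_mul, zero_mul]
    congr!
  refine h1.trans ((sum_runProgram_decideLayers ρ P _ (fun μ =>
    if (verifier (n := n) T ks N).output μ ∈ S then (1 : ℝ) else 0) _).trans ?_)
  refine Finset.sum_congr rfl fun μ _ => ?_
  have h2 : (verifier (n := n) T ks N).output (Function.update (decideMap μ) (bit .abort)
      !(decideMap μ (bit (.acc false)) || decideMap μ (bit (.acc true)))) = outcome T (counts μ) := by
    change (if Function.update (decideMap μ) (bit .abort) _ (bit .abort) = true then none else
      some (Function.update (decideMap μ) (bit .abort) _ (bit (.acc false)))) = _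
    rw [Function.update_self, Function.update_of_ne (by simp), decideMap_acc, decideMap_acc, outcome]
    by_cases h0 : counts μ false = T <;> by_cases h1 : counts μ true = T <;> simp [h0, h1]
  congr 1
  exact congrArg (fun o => if o ∈ S then (1 : ℝ) else 0) h2

/-! ### Soundness and completeness -/

/-- An invalid answer requires a full counter of the test in which no prover has a relevant advantage:
the second test if `ρ` is maximally mixed, and the first one if `ρ` is pure. -/
lemma sound_verifier {n : ℕ} (hn : 0 < n) {δ : ℝ} (hδ : 0 < δ) {M : ℕ} (hM : 2 * (0.9 : ℝ) ^ M ≤ δ) :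
    Sound (purityTesting n hn) δ (verifier (261 * M) (twirlKinds n) (500 * M)) := by
  intro ρ P
  have hlt : (0.9 : ℝ) ^ M < δ := by
    have : (0 : ℝ) < 0.9 ^ M := by positivity
    linarith
  have hpos := pos_runProgram ρ P (tests (261 * M) (twirlKinds n) (500 * M)) 0 0
    (pos_startState (memSize n (261 * M) (twirlKinds n).length) P)
  rw [outputProb_verifier]
  by_cases hm : ρ = mixed n
  · subst hm
    refine lt_of_le_of_lt ?_ hlt
    refine le_trans (potential_mono (fun N _ => ?_) hpos)
      (potential_reached_le (mixed n) P true rfl fun s r κ hκ => ?_)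
    · by_cases h1 : N true = 261 * M
      · rw [if_pos h1]; exact outcomeInd_le_one _ _
      · rw [if_neg h1, outcomeInd_of_notMem]
        rintro ⟨a, ha, hv⟩
        rw [valid_mixed] at hv
        rw [outcome, if_neg h1] at ha
        split_ifs at ha
        exact hv (Option.some.inj ha).symm
    · rw [winProb_mixed]
      have := PosSemidef.trace_re_nonneg hκ
      linarith
  · by_cases hp : ρ.IsPure
    · refine lt_of_le_of_lt ?_ hlt
      refine le_trans (potential_mono (fun N _ => ?_) hpos)
        (potential_reached_le ρ P false rfl fun s r κ hκ => winProb_pure_le P s r hp hκ)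
      by_cases h1 : N false = 261 * M
      · rw [if_pos h1]; exact outcomeInd_le_one _ _
      · rw [if_neg h1, outcomeInd_of_notMem]
        rintro ⟨a, ha, hv⟩
        rw [valid_pure hn hp] at hv
        rw [outcome, if_neg h1] at ha
        split_ifs at ha
        exact hv (Option.some.inj ha).symm
    · refine lt_of_eq_of_lt ?_ hδ
      have : ∀ N : Bool → ℕ, ¬ outcome (261 * M) N ∈
          {o | ∃ a, o = some a ∧ ¬ (purityTesting n hn).Valid ρ a} := by
        rintro N ⟨a, _, hv⟩
        exact hv ⟨fun h => (hm h).elim, fun h => (hp h).elim⟩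
      simp only [potential, outcomeInd_of_notMem (this _), zero_mul, Finset.sum_const_zero]

/-- If the honest prover wins the rounds of the matching test with probability at least `0.533`, then
the counter of that test is full except with probability at most `δ / 2`. If `ρ` is maximally mixed
the answer is then "accept", as the first counter has priority. If `ρ` is pure, one also needs that
the first counter is not full, except with probability at most `δ / 2`. -/
lemma complete_verifier {n : ℕ} (hn : 0 < n) {δ : ℝ} {M : ℕ} (hM : 2 * (0.9 : ℝ) ^ M ≤ δ)
    {A : Solver 2 n} (hA : A.Solves (purityTesting n hn) (693 / 1600)) :
    Complete (purityTesting n hn) δ (verifier (261 * M) (twirlKinds n) (500 * M))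
      (A.prover two_pos) := by
  intro ρ
  have h0 : (0 : ℝ) < 0.9 ^ M := by positivity
  have hpos := pos_runProgram ρ (A.prover two_pos) (tests (261 * M) (twirlKinds n) (500 * M)) 0 0
    (pos_startState (memSize n (261 * M) (twirlKinds n).length) (A.prover two_pos))
  have hone := potential_tests_one (T := 261 * M) (ks := twirlKinds n) ρ (A.prover two_pos) (500 * M)
  have hmiss : ∀ p, 0.533 ≤ winRate A (gatesOf n (twirlKinds n)) ρ p → _ := fun p hp =>
    potential_missed_le ρ (A.prover two_pos) p (T := 261 * M) (ks := twirlKinds n) rfl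
      fun s r κ hs hκ => by
        rw [winProb_prover A hs r _ ρ p hκ]
        exact mul_le_mul_of_nonneg_right hp (PosSemidef.trace_re_nonneg hκ)
  rw [outputProb_verifier]
  set Ψ := runProgram ρ (A.prover two_pos) (tests (261 * M) (twirlKinds n) (500 * M)) 0 0
    (startState (memSize n (261 * M) (twirlKinds n).length) (A.prover two_pos))
  by_cases hm : ρ = mixed n
  · have hw : 0.533 ≤ winRate A (gatesOf n (twirlKinds n)) ρ false := by
      have := le_winRate_mixed hn hA (gatesOf n (twirlKinds n))
      rw [hm]
      linarith
    have h1 := hmiss false hw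
    have h2 := potential_mono (G := fun _ => 1) (G' := fun N => outcomeInd (261 * M)
      {o | ∃ a, o = some a ∧ (purityTesting n hn).Valid ρ a} N +
        if N false = 261 * M then 0 else 1) (fun N _ => by
        have h0 := outcomeInd_nonneg (T := 261 * M)
          {o | ∃ a, o = some a ∧ (purityTesting n hn).Valid ρ a} N
        by_cases h : N false = 261 * M
        · rw [if_pos h, outcomeInd_of_mem, add_zero]
          refine ⟨true, by rw [outcome, if_pos h], ?_⟩
          rw [hm]
          exact (valid_mixed hn true).2 rfl
        · rw [if_neg h]
          linarith) hpos
    rw [potential_add] at h2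
    linarith
  · by_cases hp : ρ.IsPure
    · have hw : 0.533 ≤ winRate A (gatesOf n (twirlKinds n)) ρ true := by
        have := le_winRate_pure hn hA (gatesOf n (twirlKinds n)) hp
        linarith
      have h1 := hmiss true hw
      have h3 := potential_reached_le ρ (A.prover two_pos) false (T := 261 * M) (ks := twirlKinds n) rfl
        fun s r κ hκ => winProb_pure_le (A.prover two_pos) s r hp hκ
      have h2 := potential_mono (G := fun _ => 1) (G' := fun N => (outcomeInd (261 * M)
        {o | ∃ a, o = some a ∧ (purityTesting n hn).Valid ρ a} N +
          if N true = 261 * M then 0 else 1) + if N false = 261 * M then 1 else 0) (fun N _ => by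
          have h0 := outcomeInd_nonneg (T := 261 * M)
            {o | ∃ a, o = some a ∧ (purityTesting n hn).Valid ρ a} N
          by_cases h : N false = 261 * M
          · rw [if_pos h]
            split_ifs <;> linarith
          · by_cases h' : N true = 261 * M
            · rw [if_neg h, if_pos h', outcomeInd_of_mem]
              · norm_num
              · refine ⟨false, by rw [outcome, if_neg h, if_pos h'], ?_⟩
                exact (valid_pure hn hp false).2 rfl
            · rw [if_neg h, if_neg h']
              linarith) hpos
      rw [potential_add, potential_add] at h2
      linarith
    · have hw : ∃ p, 0.533 ≤ winRate A (gatesOf n (twirlKinds n)) ρ p := by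
        by_contra! hc
        have := le_winRate_add hn hA (gatesOf n (twirlKinds n)) ρ
        linarith [hc false, hc true]
      obtain ⟨p, hw⟩ := hw
      have h1 := hmiss p hw
      have hv : ∀ a, (purityTesting n hn).Valid ρ a := fun a =>
        ⟨fun h => (hm h).elim, fun h => (hp h).elim⟩
      have h2 := potential_mono (G := fun _ => 1) (G' := fun N => outcomeInd (261 * M)
        {o | ∃ a, o = some a ∧ (purityTesting n hn).Valid ρ a} N +
          if N p = 261 * M then 0 else 1) (fun N _ => by
          have h0 := outcomeInd_nonneg (T := 261 * M)
            {o | ∃ a, o = some a ∧ (purityTesting n hn).Valid ρ a} N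
          by_cases h : N p = 261 * M
          · rw [if_pos h, outcomeInd_of_mem, add_zero]
            by_cases hf : N false = 261 * M
            · exact ⟨true, by rw [outcome, if_pos hf], hv _⟩
            · cases p
              · exact (hf h).elim
              · exact ⟨false, by rw [outcome, if_neg hf, if_pos h], hv _⟩
          · rw [if_neg h]
            linarith) hpos
      rw [potential_add] at h2
      linarith

end Verifier

/-! ### Resources -/

section Resources

variable {n T : ℕ} {ks : List LayerKind}

/-- Number of oracle queries in a program. -/
def queryCount {c : ℕ} (p : List (Instr n c)) : ℕ := p.countP fun | .query => true | _ => false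

lemma queryCount_append {c : ℕ} (p q : List (Instr n c)) :
    queryCount (p ++ q) = queryCount p + queryCount q := List.countP_append

lemma queryCount_map_layer {c : ℕ} (L : List (List (Op n c))) : queryCount (L.map .layer) = 0 := by
  rw [queryCount, List.countP_eq_zero]
  intro a ha
  obtain ⟨l, _, rfl⟩ := List.mem_map.1 ha
  simp

lemma queryCount_round (p : Bool) : queryCount (round (n := n) T ks p) = 2 := by
  have hb : ∀ h, queryCount (block (n := n) T ks h) = 1 := by
    intro h
    have := queryCount_map_layer (blockLayers (n := n) T ks h)
    rw [queryCount] at this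
    simp [block, queryCount, this]
  have hs : queryCount (scoring (n := n) T ks p) = 0 := by
    have := queryCount_map_layer (scoreLayers (n := n) T ks p)
    rw [queryCount] at this
    rw [scoring_eq]
    simp [queryCount, this]
  have e : queryCount (round (n := n) T ks p) = queryCount (block (n := n) T ks false ++
    (block T ks true ++ scoring T ks p)) := by simp [round, queryCount]
  rw [e, queryCount_append, queryCount_append, hb, hb, hs]

lemma queryCount_rounds (p : Bool) (N : ℕ) : queryCount (rounds (n := n) T ks p N) = 2 * N := by
  induction N with
  | zero => rfl
  | succ N ih => rw [rounds_succ, queryCount_append, queryCount_round, ih]; ring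

lemma queries_eq_queryCount (V : Verifier n) : V.queries = queryCount V.program :=
  List.countP_congr fun i _ => by cases i <;> rfl

lemma sends_eq_sendCount (V : Verifier n) : V.sends = sendCount V.program :=
  List.countP_congr fun i _ => by cases i <;> rfl

lemma recvs_eq_recvCount (V : Verifier n) : V.recvs = recvCount V.program :=
  List.countP_congr fun i _ => by cases i <;> rfl

lemma queries_verifier (N : ℕ) : (verifier (n := n) T ks N).queries = 4 * N := by
  have h := queryCount_map_layer (decideLayers (n := n) T ks)
  have e : queryCount (rounds (n := n) T ks false N ++ rounds T ks true N ++
      (decideLayers T ks).map Instr.layer) = 4 * N := by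
    rw [queryCount_append, queryCount_append, queryCount_rounds, queryCount_rounds, h]
    ring
  exact (queries_eq_queryCount _).trans e

lemma sends_verifier (N : ℕ) : (verifier (n := n) T ks N).sends = 4 * N := by
  have h := sendCount_map_layer (decideLayers (n := n) T ks)
  have e : sendCount (rounds (n := n) T ks false N ++ rounds T ks true N ++
      (decideLayers T ks).map Instr.layer) = 4 * N := by
    rw [sendCount_append, sendCount_append, sendCount_rounds, sendCount_rounds, h]
    ring
  exact (sends_eq_sendCount _).trans e

lemma recvs_verifier (N : ℕ) : (verifier (n := n) T ks N).recvs = 2 * N := by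
  have h := recvCount_map_layer (decideLayers (n := n) T ks)
  have e : recvCount (rounds (n := n) T ks false N ++ rounds T ks true N ++
      (decideLayers T ks).map Instr.layer) = 2 * N := by
    rw [recvCount_append, recvCount_append, recvCount_rounds, recvCount_rounds, h]
    ring
  exact (recvs_eq_recvCount _).trans e

lemma length_flatMap_carryOps (p : Bool) (l : List (Fin T)) :
    (l.flatMap (carryOps (n := n) T ks p)).length = 3 * l.length := by
  induction l with
  | nil => rfl
  | cons i l ih => rw [List.flatMap_cons, List.length_append, ih, List.length_cons]; simp [carryOps]; ring

lemma length_round (p : Bool) :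
    (round (n := n) T ks p).length = 13 + 2 * ks.length + 3 * T := by
  have h := length_flatMap_carryOps (n := n) (ks := ks) p (List.finRange T)
  rw [List.length_finRange] at h
  simp only [round, block, blockLayers, scoring, List.length_cons, List.length_append,
    List.length_map, List.length_finRange, List.length_nil, h]
  ring

lemma time_verifier (N : ℕ) : (verifier (n := n) T ks N).time =
    2 * (N * (13 + 2 * ks.length + 3 * T)) + (3 + 2 * T) := by
  have hr : ∀ p, (rounds (n := n) T ks p N).length = N * (13 + 2 * ks.length + 3 * T) := fun p => by
    rw [rounds, List.length_flatten, List.map_replicate, List.sum_replicate, length_round, smul_eq_mul]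
  have e : (verifier (n := n) T ks N).time =
      (tests (n := n) T ks N ++ (decideLayers (n := n) T ks).map Instr.layer).length := rfl
  rw [e, tests, List.length_append, List.length_append, hr, hr]
  simp only [decideLayers, andBits, List.length_cons, List.length_append, List.length_map,
    List.length_finRange, List.length_nil]
  ring

lemma LayerKind.length_gates_le (k : LayerKind) : (k.gates n).length ≤ n := by
  cases k with
  | loc k => simp [LayerKind.gates]
  | cz t p =>
    rw [LayerKind.gates]
    exact (List.length_filterMap_le _ _).trans_eq List.length_finRange

lemma length_coinBits_le : (coinBits (n := n) T ks).length ≤ 1 + 2 * n + n * ks.length := by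
  have h1 : (coinsOf (circuit (n := n) T ks)).length ≤ (circuit (n := n) T ks).length := by
    rw [coinsOf, List.length_map]
    exact List.length_filter_le _ _
  have h2 : (circuit (n := n) T ks).length ≤ n * ks.length := by
    rw [circuit, List.length_flatMap]
    refine (List.sum_le_card_nsmul _ n ?_).trans_eq ?_
    · intro x hx
      obtain ⟨t, _, rfl⟩ := List.mem_map.1 hx
      rw [circuitLayer, List.length_map]
      exact LayerKind.length_gates_le _
    · simp [mul_comm]
  simp only [coinBits, List.length_cons, List.length_append, List.length_map, List.length_finRange]
  omega

/-- Every layer has at most as many operations as the bound on the number of coins of a round. -/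
lemma size_verifier_le (N : ℕ) : (verifier (n := n) T ks N).size ≤
    (verifier (n := n) T ks N).time * (1 + 2 * n + n * ks.length) := by
  have h : AllLayers (fun l => l.length ≤ 1 + 2 * n + n * ks.length)
      (tests (n := n) T ks N ++ (decideLayers (n := n) T ks).map Instr.layer) := by
    have hsingle : ∀ k i j f, [(Op.bool k i j f : Op n (memSize n T ks.length))].length ≤
        1 + 2 * n + n * ks.length := fun _ _ _ _ => by
      rw [List.length_singleton]
      omega
    refine (allLayers_tests hsingle ?_ (fun f => ?_) ?_ (fun h => ?_) (fun t => ?_) N).append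
      (allLayers_decideLayers hsingle)
    · rw [List.length_map]
      exact length_coinBits_le
    · simp only [flipBits, List.length_map, List.length_append, List.length_finRange]
      omega
    · rw [List.length_map, List.length_finRange]
      omega
    · rw [List.length_map, flips, List.length_map, List.length_finRange]
      omega
    · rw [List.length_map, circuitLayer, List.length_map]
      refine (LayerKind.length_gates_le _).trans ?_
      omega
  rw [Verifier.size, Verifier.time]
  refine (List.sum_le_card_nsmul _ (1 + 2 * n + n * ks.length) ?_).trans_eq ?_
  · intro x hx
    obtain ⟨i, hi, rfl⟩ := List.mem_map.1 hx
    cases i with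
    | layer l => exact h l hi
    | _ => exact (by omega : 1 ≤ 1 + 2 * n + n * ks.length)
  · rw [List.length_map, smul_eq_mul]

lemma length_diagKinds (K : ℕ) : (diagKinds K).length = 1 + 2 * K := by
  rw [diagKinds, List.length_cons, List.length_flatMap]
  simp
  ring

lemma length_mixKinds (K R : ℕ) : (mixKinds K R).length = (R + 1) * (1 + 2 * K) + R := by
  induction R with
  | zero => rw [mixKinds, length_diagKinds]; ring
  | succ R ih =>
    rw [mixKinds, List.length_append, List.length_cons, ih, length_diagKinds]
    ring

lemma length_twirlKinds (n : ℕ) : (twirlKinds n).length = 935 + 90 * Nat.clog 2 n := by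
  rw [twirlKinds, coreKinds, List.length_cons, List.length_cons, List.length_append,
    length_mixKinds, gateRange]
  simp only [spreadKinds, List.length_cons, List.length_nil]
  ring

lemma clog_le_log (n : ℕ) : (Nat.clog 2 n : ℝ) ≤ 2 * (1 + Real.log n) := by
  have hlog : 0 ≤ Real.log n := Real.log_natCast_nonneg n
  have h2 : (0.5 : ℝ) ≤ Real.log 2 := by linarith [Real.log_two_gt_d9]
  rcases Nat.eq_zero_or_pos (Nat.clog 2 n) with h | h
  · rw [h]
    push_cast
    linarith
  · have h1 : 2 ^ (Nat.clog 2 n - 1) < n := Nat.pow_pred_clog_lt_self (by norm_num) (by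
      by_contra! hc
      rw [Nat.clog_of_right_le_one hc] at h
      exact h.false)
    have h3 : Real.log ((2 : ℝ) ^ (Nat.clog 2 n - 1)) ≤ Real.log n :=
      Real.log_le_log (by positivity) (by exact_mod_cast h1.le)
    rw [Real.log_pow, Nat.cast_sub h, Nat.cast_one] at h3
    have h4 : (0 : ℝ) ≤ (Nat.clog 2 n : ℝ) - 1 := by
      have : (1 : ℝ) ≤ Nat.clog 2 n := by exact_mod_cast h
      linarith
    nlinarith

lemma one_le_logInv {δ : ℝ} (hδ : 0 < δ) (hδ1 : δ < 1) : 1 ≤ logInv δ := by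
  have : 0 ≤ Real.log (1 / δ) := Real.log_nonneg (by rw [le_div_iff₀ hδ]; linarith)
  rw [logInv]
  linarith

/-- The parameter `M` of the verifier: thresholds `261 * M`, and `500 * M` rounds of each test. -/
def reps (δ : ℝ) : ℕ := ⌈20 * logInv δ⌉₊

lemma reps_le {δ : ℝ} (hδ : 0 < δ) (hδ1 : δ < 1) : (reps δ : ℝ) ≤ 21 * logInv δ := by
  have h := one_le_logInv hδ hδ1
  have := Nat.ceil_lt_add_one (a := 20 * logInv δ) (by linarith)
  rw [reps]
  linarith

/-- `0.9 ^ M ≤ exp (-M / 10) ≤ exp (-2) * δ ^ 2` for `M = reps δ`. -/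
lemma two_mul_pow_reps_le {δ : ℝ} (hδ : 0 < δ) (hδ1 : δ < 1) : 2 * (0.9 : ℝ) ^ reps δ ≤ δ := by
  have h1 : (0.9 : ℝ) ≤ Real.exp (-0.1) := by
    have := Real.add_one_le_exp (-0.1)
    linarith
  have h2 : (0.9 : ℝ) ^ reps δ ≤ Real.exp (-2 * logInv δ) := by
    refine (pow_le_pow_left₀ (by norm_num) h1 _).trans ?_
    rw [← Real.exp_nat_mul, Real.exp_le_exp]
    have := Nat.le_ceil (20 * logInv δ)
    rw [reps]
    linarith
  have h3 : Real.exp (-2 * logInv δ) ≤ Real.exp (-1) * δ := by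
    rw [← Real.exp_log hδ, ← Real.exp_add, Real.exp_le_exp, Real.exp_log hδ]
    have hl := one_le_logInv hδ hδ1
    have : logInv δ = 1 - Real.log δ := by rw [logInv, one_div, Real.log_inv]; ring
    linarith
  have h4 : Real.exp (-1) ≤ 1 / 2 := by
    have := Real.add_one_le_exp (1 : ℝ)
    rw [Real.exp_neg, ← one_div]
    exact one_div_le_one_div_of_le (by norm_num) (by linarith)
  nlinarith

/-- The logarithmic factor of `softO` is at least `1`. -/
lemma le_softO {C c x y : ℝ} (k : ℕ) (hx : 1 ≤ x) (hC : 0 ≤ C) (hc : c ≤ C) (hy : y ≤ c * x) :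
    y ≤ softO C k x := by
  have h1 : 1 ≤ (1 + Real.log x) ^ k := one_le_pow₀ (by linarith [Real.log_nonneg hx])
  have h2 : c * x ≤ C * x := mul_le_mul_of_nonneg_right hc (by linarith)
  rw [softO]
  exact (hy.trans h2).trans (le_mul_of_one_le_right (by positivity) h1)

lemma time_verifier_le (n : ℕ) {δ : ℝ} (hδ : 0 < δ) (hδ1 : δ < 1) :
    ((verifier (n := n) (261 * reps δ) (twirlKinds n) (500 * reps δ)).time : ℝ) ≤
      10 ^ 9 * ((1 + Real.log n) * logInv δ ^ 2) := by
  have hL := one_le_logInv hδ hδ1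
  have hM := reps_le hδ hδ1
  have hc := clog_le_log n
  have hlog : 0 ≤ Real.log n := Real.log_natCast_nonneg n
  rw [time_verifier, length_twirlKinds]
  push_cast
  set L := logInv δ
  set M : ℝ := (reps δ : ℝ)
  set c : ℝ := (Nat.clog 2 n : ℝ)
  set l := 1 + Real.log n with hl
  have hl1 : 1 ≤ l := by linarith
  have hM0 : 0 ≤ M := Nat.cast_nonneg _
  have h1 : 13 + 2 * (935 + 90 * c) + 3 * (261 * M) ≤ 20000 * (l * L) := by
    have e1 : l ≤ l * L := le_mul_of_one_le_right (by linarith) hL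
    have e2 : L ≤ l * L := le_mul_of_one_le_left (by linarith) hl1
    linarith
  have h2 : M * (13 + 2 * (935 + 90 * c) + 3 * (261 * M)) ≤ (21 * L) * (20000 * (l * L)) := by
    refine mul_le_mul hM h1 ?_ (by linarith)
    have : (0 : ℝ) ≤ c := Nat.cast_nonneg _
    linarith
  have h3 : L ≤ l * L ^ 2 := by nlinarith
  nlinarith

lemma size_verifier_le_pow (hn : 0 < n) {δ : ℝ} (hδ : 0 < δ) (hδ1 : δ < 1) :
    ((verifier (n := n) (261 * reps δ) (twirlKinds n) (500 * reps δ)).size : ℝ) ≤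
      10 ^ 13 * (n * logInv δ) ^ 3 := by
  have hL := one_le_logInv hδ hδ1
  have ht := time_verifier_le n hδ hδ1
  have hs : ((verifier (n := n) (261 * reps δ) (twirlKinds n) (500 * reps δ)).size : ℝ) ≤
      ((verifier (n := n) (261 * reps δ) (twirlKinds n) (500 * reps δ)).time : ℝ) *
        (1 + 2 * n + n * (935 + 90 * (Nat.clog 2 n : ℝ))) := by
    have h := size_verifier_le (n := n) (T := 261 * reps δ) (ks := twirlKinds n) (500 * reps δ)
    rw [length_twirlKinds] at h
    exact_mod_cast h
  have hn1 : (1 : ℝ) ≤ n := by exact_mod_cast hn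
  have hlog : 1 + Real.log n ≤ n := by linarith [Real.log_le_sub_one_of_pos (by linarith : (0 : ℝ) < n)]
  have hc : (Nat.clog 2 n : ℝ) ≤ n := by
    have : Nat.clog 2 n ≤ n := Nat.clog_le_of_le_pow Nat.lt_two_pow_self.le
    exact_mod_cast this
  have h1 : 1 + 2 * (n : ℝ) + n * (935 + 90 * (Nat.clog 2 n : ℝ)) ≤ 2000 * (n : ℝ) ^ 2 := by
    nlinarith
  have h2 : 10 ^ 9 * ((1 + Real.log n) * logInv δ ^ 2) ≤ 10 ^ 9 * (n * logInv δ ^ 2) := by gcongr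
  have h3 : logInv δ ^ 2 ≤ logInv δ ^ 3 := pow_le_pow_right₀ hL (by norm_num)
  calc _ ≤ _ := hs
    _ ≤ (10 ^ 9 * (n * logInv δ ^ 2)) * (2000 * (n : ℝ) ^ 2) :=
      mul_le_mul (ht.trans h2) h1 (by positivity) (by positivity)
    _ = 2 * 10 ^ 12 * (n ^ 3 * logInv δ ^ 2) := by ring
    _ ≤ 2 * 10 ^ 12 * (n ^ 3 * logInv δ ^ 3) := by gcongr
    _ ≤ 10 ^ 13 * (n ^ 3 * logInv δ ^ 3) := by gcongr; norm_num
    _ = _ := by ring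

lemma proverTime_honest (N : ℕ) :
    proverTime (verifier (n := n) T ks N) (honestCircuit n) = 16 * N := by
  rw [proverTime, sends_verifier, recvs_verifier]
  simp only [honestCircuit, List.length_cons, List.length_nil]
  ring

lemma proverSize_honest (N : ℕ) :
    proverSize (verifier (n := n) T ks N) (honestCircuit n) = (6 * n + 10) * N := by
  rw [proverSize, sends_verifier, recvs_verifier]
  simp only [honestCircuit, List.map_cons, List.map_nil, List.sum_cons, List.sum_nil, Gate.weight]
  ring

end Resources

end QIP

end

theorem theorem5 :
    ∃ (m : ℕ) (hm : 0 < m) (η : ℝ) (V : (n : ℕ) → ℝ → QIP.Verifier n)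
      (P : (n : ℕ) → QIP.Circuit m n) (C : ℝ) (k : ℕ),
      η < 1 / 2 ∧
      ∀ (n : ℕ) (hn : 0 < n) (δ : ℝ), 0 < δ → δ < 1 →
        -- `(V, P)` is a black-box interactive proof system for purity testing
        QIP.IsInteractiveProof (QIP.purityTesting n hn) δ (V n δ) ((P n).solver.prover hm) ∧
        (P n).solver.Solves (QIP.purityTesting n hn) η ∧
        QIP.IsBlackBox hm η (QIP.purityTesting n hn) δ (V n δ) ∧
        -- oracle queries and computation time of the verifier
        ((V n δ).queries : ℝ) ≤ C * QIP.logInv δ ∧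
        ((V n δ).time : ℝ) ≤ QIP.softO C k ((1 + Real.log n) * QIP.logInv δ ^ 2) ∧
        -- computation time of the prover
        (QIP.proverTime (V n δ) (P n) : ℝ) ≤ QIP.softO C k (QIP.logInv δ) ∧
        -- communication
        ((V n δ).sends : ℝ) ≤ QIP.softO C k (QIP.logInv δ) ∧
        ((V n δ).recvs : ℝ) ≤ C * QIP.logInv δ ∧
        -- verifier and prover are computationally efficient
        ((V n δ).size : ℝ) ≤ C * (n * QIP.logInv δ) ^ k ∧
        (QIP.proverSize (V n δ) (P n) : ℝ) ≤ C * (n * QIP.logInv δ) ^ k := by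
  refine ⟨2, two_pos, 693 / 1600,
    fun n δ => QIP.verifier (261 * QIP.reps δ) (QIP.twirlKinds n) (500 * QIP.reps δ),
    QIP.honestCircuit, 10 ^ 13, 3, by norm_num, fun n hn δ hδ hδ1 => ?_⟩
  have hM := QIP.two_mul_pow_reps_le hδ hδ1
  have hsound := QIP.sound_verifier hn hδ hM
  have hA := QIP.honestCircuit_solves hn
  have hL := QIP.one_le_logInv hδ hδ1
  have hR := QIP.reps_le hδ hδ1
  have hn1 : (1 : ℝ) ≤ n := by exact_mod_cast hn
  have hlog : 0 ≤ Real.log n := Real.log_natCast_nonneg n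
  have hL2 : 1 ≤ QIP.logInv δ ^ 2 := one_le_pow₀ hL
  refine ⟨⟨QIP.complete_verifier hn hM hA, hsound⟩, hA,
    fun A hA => ⟨QIP.complete_verifier hn hM hA, hsound⟩, ?_, ?_, ?_, ?_, ?_,
    QIP.size_verifier_le_pow hn hδ hδ1, ?_⟩
  · rw [QIP.queries_verifier]
    push_cast
    linarith
  · exact QIP.le_softO 3 (by nlinarith) (by norm_num) (by norm_num)
      (QIP.time_verifier_le n hδ hδ1)
  · rw [QIP.proverTime_honest]
    refine QIP.le_softO (c := 10 ^ 6) 3 hL (by norm_num) (by norm_num) ?_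
    push_cast
    linarith
  · rw [QIP.sends_verifier]
    refine QIP.le_softO (c := 10 ^ 6) 3 hL (by norm_num) (by norm_num) ?_
    push_cast
    linarith
  · rw [QIP.recvs_verifier]
    push_cast
    linarith
  · rw [QIP.proverSize_honest]
    push_cast
    have hx : 1 ≤ n * QIP.logInv δ := one_le_mul_of_one_le_of_one_le hn1 hL
    have h1 : (6 * (n : ℝ) + 10) * (500 * QIP.reps δ) ≤ (16 * n) * (500 * (21 * QIP.logInv δ)) := by
      gcongr
      linarith
    have h2 : n * QIP.logInv δ ≤ (n * QIP.logInv δ) ^ 3 := le_self_pow₀ hx (by norm_num)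
    nlinarith
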